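/- **Setting.** Let $K$ be a field with algebraic closure $\overline K$ and let $n,d,r,\delta,\ell\ge 1$. A circuit is an arithmetic circuit over $K$ with fan-in two; its size is its number of nodes, including one input node for every variable. For $f_1,\dots,f_m\in K[x_1,\dots,x_n]$, $\operatorname{trdeg}\{f_1,\dots,f_m\}$ is the maximal number of algebraically independent polynomials among them, and a polynomial is $\ell$-sparse if it has at most $\ell$ monomials. Let $\mathcal C_{n,d,r,\delta,\ell}$ be the class of $n$-variate circuits $C'$ over $K$ that compute a polynomial of degree at most $d$ of the form $C(f_1,\dots,f_m)$, where $m$ is arbitrary, $C$ is an $m$-variate circuit over $K$, and $f_1,\dots,f_m\in K[x_1,\dots,x_n]$ are $\ell$-sparse, of degree at most $\delta$ and of transcendence degree at most $r$. For $p\ge 1$ let $\lfloor a\rfloor_p$ be the remainder of $a$ modulo $p$. For $D=(D_1,D_2)$ and $c\in\overline K$ let $\Psi_{D,p,c}:\overline K[x_1,\dots,x_n]\to\overline K[z_0,\dots,z_r]$ be the $\overline K$-algebra homomorphism $$x_i\mapsto c^{\lfloor D_1^i\rfloor_p}+c^{\lfloor D_2^i\rfloor_p}z_0+\sum_{j=1}^r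 c^{\lfloor i(n+1)^j\rfloor_p}z_j\qquad(1\le i\le n).$$ Put $D_1=(2\delta n)^{r+1}$, $D_2=2$ and $p_{\max}=(2nr\ell)^{2(r+1)}\lceil\log_2 D_1\rceil^2+1$. For arbitrary subsets $H_1,H_2\subset\overline K$ of sizes $\delta r p_{\max}$ and $d+1$, define $$\mathcal H_{d,r,\delta,\ell}=\bigl\{\bigl(\Psi_{D,p,c}(x_1)(a),\dots,\Psi_{D,p,c}(x_n)(a)\bigr)\;\big|\;1\le p\le p_{\max},\ c\in H_1,\ a\in H_2^{r+1}\bigr\}\subset\overline K^n .$$ Algorithms are programs, independent of $K$ and of all parameters, for a random access machine with field operations in $\overline K$ at unit cost and operations on natural numbers at logarithmic cost. The input is $n,d,r,\delta,\ell$ together with lists of the elements of $H_1$ and of $H_2$. **Theorem.** 1. If $\operatorname{char}K=0$ or $\operatorname{char}K>\delta^r$, then $\mathcal H_{d,r,\delta,\ell}$ is a hitting set for $\mathcal C_{n,d,r,\delta,\ell}$: for every $C'$ in this class that computes a non-zero polynomial there is $a\in\mathcal H_{d,r,\delta,\ell}$ with $C'(a)\ne 0$. 2. There are an algorithm and a polynomial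 $P$ such that, for all $K$, all $n,d,r,\delta,\ell\ge1$ and all $H_1,H_2$ as above, the algorithm outputs a list of the points of $\mathcal H_{d,r,\delta,\ell}$ in time at most $P(dr\delta\ell n)^r$. 3. There are an algorithm with oracle and a polynomial $P$ such that, for all $K$, all $n,d,r,\delta,\ell\ge1$ with $r\le n$ and with $\operatorname{char}K=0$ or $\operatorname{char}K>\delta^r$, all $H_1,H_2$ as above, and all $C'\in\mathcal C_{n,d,r,\delta,\ell}$, the algorithm, given oracle access to the evaluation of $C'$ at points of $\overline K^n$ (each query being charged $\operatorname{size}(C')$ and the length $n$ of the point), decides whether $C'=0$ in time at most $P(\operatorname{size}(C')\cdot d\ell\delta)^r$. -/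

import Mathlib

universe u

namespace PIT

noncomputable section

/-! ## Arithmetic circuits -/

/-- `Dag K n k`: an arithmetic circuit graph over `K` with `n` input nodes and `k` nodes in total.
One starts with the `n` input nodes (the variables) and adds, one after the other, constant nodes
and sum and product gates of fan-in two whose operands are nodes that are already present. -/
inductive Dag (K : Type u) (n : ℕ) : ℕ → Type u
  | inputs : Dag K n n
  | const {k : ℕ} (G : Dag K n k) (c : K) : Dag K n (k + 1)
  | add {k : ℕ} (G : Dag K n k) (i j : Fin k) : Dag K n (k + 1)
  | mul {k : ℕ} (G : Dag K n k) (i j : Fin k) : Dag K n (k + 1)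

/-- The polynomial computed at each node. -/
def Dag.nodePoly {K : Type u} [Field K] {n : ℕ} :
    {k : ℕ} → Dag K n k → Fin k → MvPolynomial (Fin n) K
  | _, .inputs => MvPolynomial.X
  | _, .const G c =>
      Fin.snoc (α := fun _ => MvPolynomial (Fin n) K) G.nodePoly (MvPolynomial.C c)
  | _, .add G i j =>
      Fin.snoc (α := fun _ => MvPolynomial (Fin n) K) G.nodePoly (G.nodePoly i + G.nodePoly j)
  | _, .mul G i j =>
      Fin.snoc (α := fun _ => MvPolynomial (Fin n) K) G.nodePoly (G.nodePoly i * G.nodePoly j)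

/-- An `n`-variate arithmetic circuit over `K`; its size is the number of its nodes, the `n` input
nodes included. -/
structure Circuit (K : Type u) (n : ℕ) where
  size : ℕ
  dag : Dag K n size
  output : Fin size

/-- The polynomial computed by a circuit. -/
def Circuit.poly {K : Type u} [Field K] {n : ℕ} (C : Circuit K n) : MvPolynomial (Fin n) K :=
  C.dag.nodePoly C.output

/-! ## Transcendence degree and the class of circuits -/

open Classical in
/-- The transcendence degree of `f₁, …, f_m`: the maximal number of algebraically independent
polynomials among them. -/
def trdeg (K : Type u) [Field K] {n m : ℕ} (f : Fin m → MvPolynomial (Fin n) K) : ℕ :=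
  (Finset.univ.filter fun s : Finset (Fin m) =>
    AlgebraicIndependent K (fun i : s => f i)).sup Finset.card

/-- The `n`-variate circuits over `K` that compute a polynomial of degree at most `d` of the form
`C(f₁, …, f_m)`, where `C` is a circuit in any number `m` of variables and `f₁, …, f_m` are
`ℓ`-sparse polynomials of degree at most `δ` and of transcendence degree at most `r`. -/
def sparseInputCircuits (K : Type u) [Field K] (n d r δ ℓ : ℕ) : Set (Circuit K n) :=
  {C' | C'.poly.totalDegree ≤ d ∧
    ∃ (m : ℕ) (C : Circuit K m) (f : Fin m → MvPolynomial (Fin n) K),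
      (∀ i, (f i).support.card ≤ ℓ) ∧ (∀ i, (f i).totalDegree ≤ δ) ∧ trdeg K f ≤ r ∧
      C'.poly = MvPolynomial.aeval f C.poly}

/-- A hitting set for a class of circuits over `K`, with points over the algebraic closure. -/
def IsHittingSet {K : Type u} [Field K] {n : ℕ} (H : Set (Fin n → AlgebraicClosure K))
    (𝓕 : Set (Circuit K n)) : Prop :=
  ∀ C ∈ 𝓕, C.poly ≠ 0 → ∃ a ∈ H, MvPolynomial.aeval a C.poly ≠ 0

/-! ## The Vandermonde-inspired map and the explicit set -/

/-- `Ψ_{D,p} : F[x₁, …, x_n] → F[t][z₀, …, z_r]`,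
`x_i ↦ t ^ ⌊D₁ ^ i⌋_p + t ^ ⌊D₂ ^ i⌋_p z₀ + ∑_{j = 1}^{r} t ^ ⌊i (n + 1) ^ j⌋_p z_j`.
The variable `x_i` with `1 ≤ i ≤ n` has the index `i - 1` in `Fin n`. -/
def psiMod (F : Type u) [Field F] (n r D₁ D₂ p : ℕ) :
    MvPolynomial (Fin n) F →ₐ[F] MvPolynomial (Fin (r + 1)) (Polynomial F) :=
  MvPolynomial.aeval fun i : Fin n =>
    MvPolynomial.C (Polynomial.X ^ (D₁ ^ ((i : ℕ) + 1) % p)) +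
    MvPolynomial.C (Polynomial.X ^ (D₂ ^ ((i : ℕ) + 1) % p)) * MvPolynomial.X 0 +
    ∑ j : Fin r,
      MvPolynomial.C (Polynomial.X ^ ((((i : ℕ) + 1) * (n + 1) ^ ((j : ℕ) + 1)) % p)) *
        MvPolynomial.X j.succ

/-- `Ψ_{D,p,c} : F[x₁, …, x_n] → F[z₀, …, z_r]`, the map `Ψ_{D,p}` with `c` substituted for `t`. -/
def psi (F : Type u) [Field F] (n r D₁ D₂ p : ℕ) (c : F) :
    MvPolynomial (Fin n) F →ₐ[F] MvPolynomial (Fin (r + 1)) F :=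
  (MvPolynomial.mapAlgHom (Polynomial.aeval c)).comp (psiMod F n r D₁ D₂ p)

/-- `D₁ = (2 δ n) ^ (r + 1)`. -/
def paramD (n r δ : ℕ) : ℕ := (2 * δ * n) ^ (r + 1)

/-- `p_max = (2 n r ℓ) ^ (2 (r + 1)) ⌈log₂ D₁⌉ ^ 2 + 1`. -/
def pMax (n r δ ℓ : ℕ) : ℕ :=
  (2 * n * r * ℓ) ^ (2 * (r + 1)) * Nat.clog 2 (paramD n r δ) ^ 2 + 1

/-- The explicit set: all points `(Ψ_{D,p,c}(x₁)(a), …, Ψ_{D,p,c}(x_n)(a))` with `1 ≤ p ≤ p_max`,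
`c ∈ H₁` and `a ∈ H₂ ^ (r + 1)`, where `D = (D₁, 2)`. -/
def hittingSet {F : Type u} [Field F] (n r δ ℓ : ℕ) (H₁ H₂ : Finset F) : Set (Fin n → F) :=
  {v | ∃ p : ℕ, 1 ≤ p ∧ p ≤ pMax n r δ ℓ ∧ ∃ c ∈ H₁, ∃ a : Fin (r + 1) → F, (∀ j, a j ∈ H₂) ∧
    v = fun i => MvPolynomial.eval a (psi F n r (paramD n r δ) 2 p c (MvPolynomial.X i))}

/-! ## Algorithms

Programs of a random access machine that works with natural numbers, at logarithmic cost, and with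
elements of a field, at unit cost. The natural numbers are kept in registers; the field elements
are kept in arrays, which are addressed by the contents of registers. -/

/-- Operations on natural numbers (truncated subtraction, quotient and remainder). -/
inductive NatOp
  | add | sub | mul | div | mod

def NatOp.apply : NatOp → ℕ → ℕ → ℕ
  | .add, a, b => a + b
  | .sub, a, b => a - b
  | .mul, a, b => a * b
  | .div, a, b => a / b
  | .mod, a, b => a % b

/-- Operations on field elements. -/
inductive FieldOp
  | add | sub | mul

def FieldOp.apply {F : Type u} [Field F] : FieldOp → F → F → F
  | .add, a, b => a + b
  | .sub, a, b => a - b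
  | .mul, a, b => a * b

/-- A reference to the entry of the array number `arr` at the address held by register `idx`. -/
structure Ref where
  arr : ℕ
  idx : ℕ

/-- Programs. They mention registers and arrays by number, but no field elements other than `0`
and `1`, so that a program does not depend on the field. -/
inductive Prog
  /-- `R_x := k` -/
  | natConst (x k : ℕ)
  /-- `R_x := R_y op R_z` -/
  | natOp (op : NatOp) (x y z : ℕ)
  /-- `a := 0` -/
  | fieldZero (a : Ref)
  /-- `a := 1` -/
  | fieldOne (a : Ref)
  /-- `a := b op c` -/
  | fieldOp (op : FieldOp) (a b c : Ref)
  /-- ask the oracle for its value at the point given by the first `n` entries of the array number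
  `v`, and store the answer in `a` -/
  | query (v : ℕ) (a : Ref)
  /-- output the point given by the first `n` entries of the array number `v` -/
  | emit (v : ℕ)
  /-- first `P`, then `Q` -/
  | seq (P Q : Prog)
  /-- if `R_x = 0` then `P` else `Q` -/
  | ifNat (x : ℕ) (P Q : Prog)
  /-- if `a = 0` then `P` else `Q` -/
  | ifField (a : Ref) (P Q : Prog)
  /-- while `R_x ≠ 0` do `P` -/
  | loop (x : ℕ) (P : Prog)

/-- A state of the machine: registers, arrays, and the list of points that have been output. -/
structure State (F : Type u) (n : ℕ) where
  reg : ℕ → ℕ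
  mem : ℕ → ℕ → F
  out : List (Fin n → F)

namespace State

variable {F : Type u} {n : ℕ}

def setReg (s : State F n) (x k : ℕ) : State F n :=
  { s with reg := Function.update s.reg x k }

/-- The address to which a reference points. -/
def addr (s : State F n) (a : Ref) : ℕ := s.reg a.idx

def get (s : State F n) (a : Ref) : F := s.mem a.arr (s.addr a)

def set (s : State F n) (a : Ref) (y : F) : State F n :=
  { s with mem := Function.update s.mem a.arr (Function.update (s.mem a.arr) (s.addr a) y) }

/-- The point given by the first `n` entries of the array number `v`. -/
def point (s : State F n) (v : ℕ) : Fin n → F := fun i => s.mem v i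

def emit (s : State F n) (v : ℕ) : State F n :=
  { s with out := s.out ++ [s.point v] }

end State

/-- `Exec O q P s s' t`: with the oracle `O`, whose evaluation costs `q`, the program `P` started in
the state `s` halts in the state `s'` after time `t`. Each step costs `1`, plus the bit lengths
(`Nat.size`) of the natural numbers that it reads, addresses included; the oracle and the output
instructions cost in addition the length `n` of the point that they handle. -/
inductive Exec {F : Type u} [Field F] {n : ℕ} (O : (Fin n → F) → F) (q : ℕ) :
    Prog → State F n → State F n → ℕ → Prop
  | natConst (s : State F n) (x k : ℕ) :
      Exec O q (.natConst x k) s (s.setReg x k) (1 + k.size)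
  | natOp (s : State F n) (op : NatOp) (x y z : ℕ) :
      Exec O q (.natOp op x y z) s (s.setReg x (op.apply (s.reg y) (s.reg z)))
        (1 + (s.reg y).size + (s.reg z).size)
  | fieldZero (s : State F n) (a : Ref) :
      Exec O q (.fieldZero a) s (s.set a 0) (1 + (s.addr a).size)
  | fieldOne (s : State F n) (a : Ref) :
      Exec O q (.fieldOne a) s (s.set a 1) (1 + (s.addr a).size)
  | fieldOp (s : State F n) (op : FieldOp) (a b c : Ref) :
      Exec O q (.fieldOp op a b c) s (s.set a (op.apply (s.get b) (s.get c)))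
        (1 + (s.addr a).size + (s.addr b).size + (s.addr c).size)
  | query (s : State F n) (v : ℕ) (a : Ref) :
      Exec O q (.query v a) s (s.set a (O (s.point v))) (1 + n + q + (s.addr a).size)
  | emit (s : State F n) (v : ℕ) :
      Exec O q (.emit v) s (s.emit v) (1 + n)
  | seq {P Q : Prog} {s s₁ s₂ : State F n} {t₁ t₂ : ℕ} :
      Exec O q P s s₁ t₁ → Exec O q Q s₁ s₂ t₂ → Exec O q (.seq P Q) s s₂ (t₁ + t₂)
  | ifNat_zero {x : ℕ} {P Q : Prog} {s s' : State F n} {t : ℕ} :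
      s.reg x = 0 → Exec O q P s s' t → Exec O q (.ifNat x P Q) s s' (1 + t)
  | ifNat_ne_zero {x : ℕ} {P Q : Prog} {s s' : State F n} {t : ℕ} :
      s.reg x ≠ 0 → Exec O q Q s s' t → Exec O q (.ifNat x P Q) s s' (1 + (s.reg x).size + t)
  | ifField_zero {a : Ref} {P Q : Prog} {s s' : State F n} {t : ℕ} :
      s.get a = 0 → Exec O q P s s' t → Exec O q (.ifField a P Q) s s' (1 + (s.addr a).size + t)
  | ifField_ne_zero {a : Ref} {P Q : Prog} {s s' : State F n} {t : ℕ} :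
      s.get a ≠ 0 → Exec O q Q s s' t → Exec O q (.ifField a P Q) s s' (1 + (s.addr a).size + t)
  | loop_zero {x : ℕ} {P : Prog} {s : State F n} :
      s.reg x = 0 → Exec O q (.loop x P) s s 1
  | loop_ne_zero {x : ℕ} {P : Prog} {s s₁ s₂ : State F n} {t₁ t₂ : ℕ} :
      s.reg x ≠ 0 → Exec O q P s s₁ t₁ → Exec O q (.loop x P) s₁ s₂ t₂ →
      Exec O q (.loop x P) s s₂ (1 + (s.reg x).size + t₁ + t₂)

/-- The initial state on the input `n, d, r, δ, ℓ` (in the registers `0, …, 4`) and two finite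
lists of field elements (in the arrays `0` and `1`); everything else is zero. -/
def initState {F : Type u} [Field F] (n d r δ ℓ : ℕ) (h₁ h₂ : List F) : State F n where
  reg x := [n, d, r, δ, ℓ].getD x 0
  mem v i := ([h₁, h₂].getD v []).getD i 0
  out := []

/-- The list `h` enumerates the finite set `H` without repetition. -/
def Enumerates {F : Type u} (h : List F) (H : Finset F) : Prop :=
  h.Nodup ∧ ∀ x, x ∈ h ↔ x ∈ H

end

end PIT

open PIT

/-! Let `g` be a maximal algebraically independent subfamily of the `f_i`. A nonzero `C(f)` is
algebraic over `K[g]`, so it divides some nonzero `u(g)` (`exists_dvd_aeval_of_algebraic`). Hence it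
survives every substitution that keeps `g` algebraically independent, and it suffices that some
`Ψ_{D,p,c}` does so. Since `Ψ` is affine linear, the image of `C(f)` then has degree at most `d` in
`z`, and a grid of side `d + 1` detects it (`exists_aeval_ne_zero`).

Independence is tested by Jacobians. Perron's bound, in the form of the dimension count
`card_le_prod_degrees`, keeps minimal polynomials over the `g` (completed by variables) of degree at
most `δ ^ r`. Thus they are separable under the characteristic assumption, and some maximal minor of
the Jacobian matrix of `g` is nonzero (`exists_jacobian_minor_ne_zero`). Conversely, over a perfect
field a nonzero minor implies independence in every characteristic
(`algebraicIndependent_of_jacobian`).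

By the chain rule, the Jacobian of `Ψ(g)` in `z_1, …, z_s` at `z = 0` is the Jacobian of `g` on the
curve `x_i = t ^ (D₁ ^ i)` times a matrix of powers of `t`. The Cauchy-Binet expansion of its
determinant has no cancellation when the exponents are not reduced, because distinct terms have
distinct digits to the base `D₁` (`jacobianCurve_det_ne_zero`). The determinant has few terms, so a
small modulus `p` isolates one of its exponents (`exists_modulus`). Reduction of exponents is
invisible in the group algebra of `ZMod p`, so the determinant with reduced exponents is nonzero as
well. Its degree is below the size of `H₁`, which yields `c`. The coefficient of `z_0` plays no
role.

Both algorithms are nested loops over `p`, `c` and the digits of a number `e` that encodes a grid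
point; they differ in what is done at each point, which `Processes` abstracts. All numbers and
iteration counts are bounded by fixed powers of `B = (2 * Z) ^ r`, where `Z` dominates the
parameters (`exists_exec_of_processes`). -/

namespace PIT

/-! ### Counting exponents of bounded degree and of bounded weighted degree. -/

section Counting

/-- The exponents of the monomials of degree at most `N`. -/
def simplex (σ : Type*) [Fintype σ] [DecidableEq σ] (N : ℕ) : Finset (σ → ℕ) :=
  (Fintype.piFinset fun _ => Finset.range (N + 1)).filter fun a => ∑ i, a i ≤ N

variable {σ : Type*} [Fintype σ] [DecidableEq σ]

theorem mem_simplex {N : ℕ} {a : σ → ℕ} : a ∈ simplex σ N ↔ ∑ i, a i ≤ N := by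
  simp only [simplex, Finset.mem_filter, Fintype.mem_piFinset, Finset.mem_range,
    and_iff_right_iff_imp]
  intro h i
  have := Finset.single_le_sum (f := a) (fun _ _ => Nat.zero_le _) (Finset.mem_univ i)
  omega

theorem card_simplex_le (N : ℕ) : (simplex σ N).card ≤ (N + 1) ^ Fintype.card σ := by
  refine (Finset.card_filter_le _ _).trans ?_
  simp

theorem simplex_nonempty (N : ℕ) : 0 < (simplex σ N).card :=
  Finset.card_pos.2 ⟨0, mem_simplex.2 (by simp)⟩

/-- Exponents of weighted degree at most `N` are at least as many as those of degree at most `N`,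
divided by the product of the weights. -/
theorem card_simplex_le_weighted (d : σ → ℕ) (hd : ∀ i, 1 ≤ d i) (N : ℕ) :
    (simplex σ N).card ≤
      (∏ i, d i) * ((simplex σ N).filter fun a => ∑ i, d i * a i ≤ N).card := by
  have h : (simplex σ N).card ≤
      ((Fintype.piFinset fun i => Finset.range (d i)) ×ˢ
        ((simplex σ N).filter fun a => ∑ i, d i * a i ≤ N)).card := by
    -- Division with remainder by the weights: there are `∏ d i` vectors of remainders, and the
    -- weighted degree of the quotient is at most the degree of `a`.
    refine Finset.card_le_card_of_injOn (fun a => (fun i => a i % d i, fun i => a i / d i)) ?_ ?_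
    · intro a ha
      have ha' := mem_simplex.1 ha
      simp only [Finset.coe_product, Set.mem_prod, Finset.mem_coe, Fintype.mem_piFinset,
        Finset.mem_range, Finset.mem_filter, mem_simplex]
      refine ⟨fun i => Nat.mod_lt _ (hd i), ?_, ?_⟩
      · exact (Finset.sum_le_sum fun i _ => Nat.div_le_self _ _).trans ha'
      · exact (Finset.sum_le_sum fun i _ => Nat.mul_div_le _ _).trans ha'
    · intro a _ b _ hab
      simp only [Prod.mk.injEq] at hab
      funext i
      rw [← Nat.div_add_mod (a i) (d i), ← Nat.div_add_mod (b i) (d i)]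
      have h1 := congrFun hab.1 i
      have h2 := congrFun hab.2 i
      rw [h1, h2]
  simpa [Finset.card_product, Fintype.card_piFinset] using h

/-- A sequence whose ratio over steps of length `B` stays above `(Q + 1) / Q` is not polynomially
bounded. -/
theorem exists_growth_lt (c : ℕ → ℕ) (k B Q : ℕ) (hc : ∀ N, c N ≤ (N + 1) ^ k) (h0 : ∀ N, 0 < c N) :
    ∃ N, Q * c (N + B) < (Q + 1) * c N := by
  by_contra hcon
  push Not at hcon
  rcases Nat.eq_zero_or_pos Q with rfl | hQ
  · have := hcon 0
    have := h0 0
    simp_all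
  -- Iterated along the multiples of `B`, the negation forces exponential growth, against the
  -- polynomial bound `hc`.
  have key : ∀ m, (Q + 1) ^ m ≤ Q ^ m * c (m * B) := by
    intro m
    induction m with
    | zero => simpa using Nat.one_le_iff_ne_zero.2 (h0 0).ne'
    | succ m ih =>
      calc (Q + 1) ^ (m + 1) = (Q + 1) ^ m * (Q + 1) := pow_succ _ _
        _ ≤ (Q ^ m * c (m * B)) * (Q + 1) := Nat.mul_le_mul_right _ ih
        _ = Q ^ m * ((Q + 1) * c (m * B)) := by ring
        _ ≤ Q ^ m * (Q * c (m * B + B)) := Nat.mul_le_mul_left _ (hcon _)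
        _ = Q ^ (m + 1) * c ((m + 1) * B) := by rw [add_mul, one_mul, pow_succ]; ring
  have hr : (1 : ℝ) < (Q + 1) / Q := by
    rw [lt_div_iff₀ (by exact_mod_cast hQ)]; linarith
  have ht := tendsto_pow_const_div_const_pow_of_one_lt k hr
  have hev := (ht.eventually (gt_mem_nhds (show (0 : ℝ) < 1 / ((B : ℝ) + 1) ^ k by positivity))).and
    (Filter.eventually_ge_atTop 1)
  obtain ⟨m, hm, hm1⟩ := hev.exists
  have hQ' : (0 : ℝ) < Q := by exact_mod_cast hQ
  have h1 : ((Q : ℝ) + 1) ^ m ≤ Q ^ m * ((m : ℝ) * (B + 1)) ^ k := by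
    have h2 : (Q + 1) ^ m ≤ Q ^ m * (m * (B + 1)) ^ k := by
      refine (key m).trans (Nat.mul_le_mul_left _ ((hc _).trans (Nat.pow_le_pow_left ?_ _)))
      nlinarith
    exact_mod_cast h2
  rw [div_pow, div_div_eq_mul_div, div_lt_div_iff₀ (by positivity) (by positivity)] at hm
  rw [mul_pow] at h1
  nlinarith

end Counting

/-! ### Perron's degree bound and the separability that it gives. -/

section Perron

open MvPolynomial

variable {K : Type*} [Field K] {σ : Type*}

theorem derivation_aeval_eq_zero {ι : Type*} (D : Derivation K (MvPolynomial σ K) (MvPolynomial σ K))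
    (y : ι → MvPolynomial σ K) (hD : ∀ i, D (y i) = 0) (q : MvPolynomial ι K) :
    D (aeval y q) = 0 := by
  induction q using MvPolynomial.induction_on with
  | C a => simp [-aeval_eq_bind₁]
  | add p q hp hq => simp [hp, hq, -aeval_eq_bind₁]
  | mul_X p i hp => simp [hp, hD, -aeval_eq_bind₁]

/-- The coefficients are polynomials in `y`, hence constants for `D`; only the term from the outer
variable remains. -/
theorem derivation_eval₂ {ι : Type*} (D : Derivation K (MvPolynomial σ K) (MvPolynomial σ K))
    (y : ι → MvPolynomial σ K) (hD : ∀ i, D (y i) = 0) (g : MvPolynomial σ K)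
    (P : Polynomial (MvPolynomial ι K)) :
    D (P.eval₂ (aeval y).toRingHom g) =
      P.derivative.eval₂ (aeval y).toRingHom g * D g := by
  induction P using Polynomial.induction_on' with
  | add p q hp hq => rw [Polynomial.eval₂_add, map_add, hp, hq, Polynomial.derivative_add,
      Polynomial.eval₂_add, add_mul]
  | monomial k a =>
    have := derivation_aeval_eq_zero D y hD a
    simp only [Polynomial.eval₂_monomial, Polynomial.derivative_monomial]
    simp [this, Derivation.leibniz_pow, -aeval_eq_bind₁]
    ring

theorem eval₂_linearCombination_family {ι : Type*} [Fintype ι] (y : ι → MvPolynomial σ K)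
    (g : MvPolynomial σ K) (k : ℕ) (a : ι → ℕ) :
    (Polynomial.monomial k (monomial (Finsupp.equivFunOnFinite.symm a) (1 : K))).eval₂
      (aeval y).toRingHom g = g ^ k * ∏ i, y i ^ a i := by
  rw [Polynomial.eval₂_monomial, mul_comm]
  simp [aeval_monomial, Finsupp.prod_fintype, -aeval_eq_bind₁]

/-- Lets a linear relation among the products `g ^ k * ∏ y i ^ a i` be read as a single polynomial
over `K[y]` that vanishes at `g`. -/
theorem linearIndependent_monomial_family {ι : Type*} [Fintype ι] :
    LinearIndependent K fun q : ℕ × (ι → ℕ) =>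
      Polynomial.monomial q.1 (monomial (Finsupp.equivFunOnFinite.symm q.2) (1 : K)) := by
  have h := ((basisMonomials ι K).smulTower
    (Polynomial.basisMonomials (MvPolynomial ι K))).linearIndependent
  have h2 := h.comp (fun q : ℕ × (ι → ℕ) => (Finsupp.equivFunOnFinite.symm q.2, q.1)) (by
    rintro ⟨a, b⟩ ⟨a', b'⟩ h
    simp only [Prod.mk.injEq, EmbeddingLike.apply_eq_iff_eq] at h
    rw [Prod.mk.injEq]; exact ⟨h.2, h.1⟩)
  refine (?_ : (fun q : ℕ × (ι → ℕ) =>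
      Polynomial.monomial q.1 (monomial (Finsupp.equivFunOnFinite.symm q.2) (1 : K))) =
        _ ∘ _) ▸ h2
  funext q
  simp only [Function.comp, Module.Basis.smulTower_apply, coe_basisMonomials,
    Polynomial.coe_basisMonomials, Polynomial.smul_monomial, smul_eq_mul, mul_one]

variable [Fintype σ]

theorem totalDegree_prod_pow_le (y : σ → MvPolynomial σ K) (d a : σ → ℕ)
    (hy : ∀ i, (y i).totalDegree ≤ d i) : (∏ i, y i ^ a i).totalDegree ≤ ∑ i, d i * a i := by
  refine (totalDegree_finsetProd _ _).trans (Finset.sum_le_sum fun i _ => ?_)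
  refine (totalDegree_pow _ _).trans ?_
  rw [mul_comm]
  exact Nat.mul_le_mul_right _ (hy i)

variable [DecidableEq σ]

theorem card_le_card_simplex {ι : Type*} [Fintype ι] (N : ℕ) (v : ι → MvPolynomial σ K)
    (hv : LinearIndependent K v) (hd : ∀ i, (v i).totalDegree ≤ N) :
    Fintype.card ι ≤ (simplex σ N).card := by
  classical
  let w : Finset (MvPolynomial σ K) :=
    (simplex σ N).image fun a => monomial (Finsupp.equivFunOnFinite.symm a) 1
  have h : Set.range v ⊆ (Submodule.span K (w : Set (MvPolynomial σ K)) : Set _) := by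
    rintro _ ⟨i, rfl⟩
    rw [(v i).as_sum]
    refine Submodule.sum_mem _ fun s hs => ?_
    have : monomial s ((v i).coeff s) = (v i).coeff s • (monomial s (1 : K)) := by
      simp [smul_monomial]
    rw [this]
    refine Submodule.smul_mem _ _ (Submodule.subset_span ?_)
    refine Finset.mem_coe.2 (Finset.mem_image.2 ⟨⇑s, mem_simplex.2 ?_, by
      rw [Finsupp.equivFunOnFinite_symm_coe]⟩)
    have := (le_totalDegree hs).trans (hd i)
    rwa [Finsupp.sum_fintype _ _ (fun _ => rfl)] at this
  have h2 : Cardinal.mk ι ≤ (Fintype.card w : Cardinal) := linearIndependent_le_span' v hv _ h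
  rw [Cardinal.mk_fintype, Nat.cast_le, Fintype.card_coe] at h2
  exact h2.trans Finset.card_image_le

/-- Polynomials that are linearly independent over `K[y]` are at most as many as the product of
the degrees of `y`. -/
theorem card_le_prod_degrees {D : ℕ} (y : σ → MvPolynomial σ K) (d : σ → ℕ) (hd : ∀ i, 1 ≤ d i)
    (hy : ∀ i, (y i).totalDegree ≤ d i) (b : Fin D → MvPolynomial σ K)
    (hli : LinearIndependent K fun q : Fin D × (σ → ℕ) => b q.1 * ∏ i, y i ^ q.2 i) :
    D ≤ ∏ i, d i := by
  by_contra hlt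
  push Not at hlt
  obtain ⟨B, hB⟩ : ∃ B, ∀ k, (b k).totalDegree ≤ B :=
    ⟨∑ k, (b k).totalDegree, fun k => Finset.single_le_sum
      (f := fun k => (b k).totalDegree) (fun _ _ => Nat.zero_le _) (Finset.mem_univ k)⟩
  -- Multiplication by a `b k` raises degrees by at most `B`. At this `N` such a shift enlarges the
  -- space by a factor below `(Q + 1) / Q` with `Q = ∏ d i`, too little room for `Q + 1` independent
  -- copies of the weighted simplex.
  obtain ⟨N, hN⟩ := exists_growth_lt (fun N => (simplex σ N).card) (Fintype.card σ) B (∏ i, d i)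
    card_simplex_le simplex_nonempty
  set W := (simplex σ N).filter fun a => ∑ i, d i * a i ≤ N with hW
  have h1 : D * W.card ≤ (simplex σ (N + B)).card := by
    have h2 := card_le_card_simplex (N + B)
      (fun q : Fin D × W => b q.1 * ∏ i, y i ^ (q.2 : σ → ℕ) i)
      (hli.comp (fun q : Fin D × W => (q.1, (q.2 : σ → ℕ))) (by
        rintro ⟨a, b⟩ ⟨a', b'⟩ h
        simp only [Prod.mk.injEq] at h
        rw [Prod.mk.injEq]
        exact ⟨h.1, Subtype.ext h.2⟩)) (by
        rintro ⟨k, a, ha⟩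
        refine (totalDegree_mul _ _).trans ?_
        have := totalDegree_prod_pow_le y d a hy
        have h3 := (Finset.mem_filter.1 ha).2
        have h4 := hB k
        simp only
        omega)
    simpa using h2
  have h2 := card_simplex_le_weighted d hd N
  have h3 : (∏ i, d i + 1) * (simplex σ N).card ≤ (∏ i, d i) * (simplex σ (N + B)).card :=
    calc (∏ i, d i + 1) * (simplex σ N).card
        ≤ D * ((∏ i, d i) * W.card) := Nat.mul_le_mul hlt h2
      _ = (∏ i, d i) * (D * W.card) := by ring
      _ ≤ _ := Nat.mul_le_mul_left _ h1
  exact absurd hN (not_lt.2 h3)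

/-- If the product of the degrees of the algebraically independent `y` is small compared with the
characteristic, a derivation that kills `y` kills everything that is algebraic over `K[y]`. -/
theorem derivation_eq_zero_of_algebraic (y : σ → MvPolynomial σ K) (d : σ → ℕ)
    (hd : ∀ i, 1 ≤ d i) (hy : ∀ i, (y i).totalDegree ≤ d i)
    (hchar : ringChar K = 0 ∨ ∏ i, d i < ringChar K)
    (D : Derivation K (MvPolynomial σ K) (MvPolynomial σ K)) (hD : ∀ i, D (y i) = 0)
    (g : MvPolynomial σ K)
    (hg : ∃ P : Polynomial (MvPolynomial σ K), P ≠ 0 ∧ P.eval₂ (aeval y).toRingHom g = 0)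
    (hinj : AlgebraicIndependent K y) : D g = 0 := by
  classical
  obtain ⟨P, ⟨hP0, hPg⟩, hmin⟩ : ∃ P : Polynomial (MvPolynomial σ K),
      (P ≠ 0 ∧ P.eval₂ (aeval y).toRingHom g = 0) ∧
      ∀ Q : Polynomial (MvPolynomial σ K), Q ≠ 0 → Q.eval₂ (aeval y).toRingHom g = 0 →
        P.natDegree ≤ Q.natDegree := by
    let s : Set (Polynomial (MvPolynomial σ K)) :=
      {P | P ≠ 0 ∧ P.eval₂ (aeval y).toRingHom g = 0}
    have hs : s.Nonempty := hg
    refine ⟨Function.argminOn Polynomial.natDegree s hs, Function.argminOn_mem _ s hs, ?_⟩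
    intro Q h1 h2
    exact Function.argminOn_le _ s (show Q ∈ s from ⟨h1, h2⟩)
  have hpos : 0 < P.natDegree := by
    rw [Nat.pos_iff_ne_zero]
    intro h0
    rw [Polynomial.eq_C_of_natDegree_eq_zero h0, Polynomial.eval₂_C] at hPg
    have : P.coeff 0 = 0 := hinj ((by simpa [-aeval_eq_bind₁] using hPg) : aeval y (P.coeff 0) = aeval y 0)
    exact hP0 (by rw [Polynomial.eq_C_of_natDegree_eq_zero h0, this, map_zero])
  -- By minimality, the powers of `g` below the degree of `P` are independent over `K[y]`, so the
  -- dimension count bounds their number.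
  have hle : P.natDegree ≤ ∏ i, d i := by
    refine card_le_prod_degrees y d hd hy (fun k : Fin P.natDegree => g ^ (k : ℕ)) ?_
    rw [linearIndependent_iff']
    intro s c hc
    have hind := linearIndependent_iff'.1 ((linearIndependent_monomial_family (K := K)
      (ι := σ)).comp (fun q : Fin P.natDegree × (σ → ℕ) => ((q.1 : ℕ), q.2)) (by
        rintro ⟨a, b⟩ ⟨a', b'⟩ h
        simp only [Prod.mk.injEq] at h
        rw [Prod.mk.injEq]; exact ⟨Fin.ext h.1, h.2⟩)) s c
    apply hind
    set Q := ∑ q ∈ s, c q • (((fun q : ℕ × (σ → ℕ) =>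
      Polynomial.monomial q.1 (monomial (Finsupp.equivFunOnFinite.symm q.2) (1 : K))) ∘
        fun q : Fin P.natDegree × (σ → ℕ) => ((q.1 : ℕ), q.2)) q) with hQ
    by_contra hQ0
    have h1 : Q.eval₂ (aeval y).toRingHom g = 0 := by
      rw [← hc, hQ, Polynomial.eval₂_finsetSum]
      refine Finset.sum_congr rfl fun q _ => ?_
      rw [← eval₂_linearCombination_family, Function.comp, Polynomial.smul_monomial,
        Polynomial.eval₂_monomial, Polynomial.eval₂_monomial]
      simp [-aeval_eq_bind₁]
    have h2 : Q.natDegree < P.natDegree := by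
      rw [Polynomial.natDegree_lt_iff_degree_lt hQ0, ← Polynomial.mem_degreeLT]
      refine Submodule.sum_mem _ fun q _ => ?_
      rw [Polynomial.mem_degreeLT, Function.comp, Polynomial.smul_monomial]
      exact (Polynomial.degree_monomial_le _ _).trans_lt (by exact_mod_cast q.1.2)
    exact absurd (hmin Q hQ0 h1) (not_le.2 h2)
  have hcast : (P.natDegree : K) ≠ 0 := by
    intro h
    have h1 := (ringChar.spec K P.natDegree).1 h
    rcases hchar with h0 | hlt
    · rw [h0, zero_dvd_iff] at h1; omega
    · exact absurd (Nat.le_of_dvd hpos h1) (by omega)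
  -- The coefficient of the derivative in degree `P.natDegree - 1` is the leading coefficient of `P`
  -- times `P.natDegree`, which is invertible in `K`.
  have hder : P.derivative ≠ 0 := by
    intro h
    have h1 := congrArg (fun Q => Polynomial.coeff Q (P.natDegree - 1)) h
    simp only [Polynomial.coeff_derivative, Polynomial.coeff_zero] at h1
    rw [Nat.sub_add_cancel hpos] at h1
    have h2 : ((P.natDegree - 1 : ℕ) : MvPolynomial σ K) + 1 = C (P.natDegree : K) := by
      rw [map_natCast, ← Nat.cast_add_one, Nat.sub_add_cancel hpos]
    rw [h2, mul_eq_zero] at h1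
    rcases h1 with h1 | h1
    · exact hP0 (Polynomial.leadingCoeff_eq_zero.1 h1)
    · exact hcast (C_eq_zero.1 h1)
  have hne : P.derivative.eval₂ (aeval y).toRingHom g ≠ 0 := by
    intro h
    exact absurd (hmin _ hder h) (not_le.2 (Polynomial.natDegree_derivative_lt hpos.ne'))
  have := derivation_eval₂ D y hD g P
  rw [hPg, map_zero] at this
  exact (mul_eq_zero.1 this.symm).resolve_left hne

end Perron

/-! ### The Jacobian criterion: independence gives a nonzero minor. -/

section Jacobian

open MvPolynomial

/-- The determinant of a product of two rectangular matrices, expanded along the middle index. -/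
theorem det_mul_eq_sum {R ι σ : Type*} [CommRing R] [Fintype ι] [DecidableEq ι] [Fintype σ]
    [DecidableEq σ] (B : Matrix ι σ R) (A : Matrix σ ι R) :
    (B * A).det = ∑ κ : ι → σ, (∏ i, A (κ i) i) * (B.submatrix id κ).det := by
  rw [← Matrix.det_transpose]
  have h : (B * A).transpose = fun i => ∑ k, A k i • B.transpose k := by
    funext i j
    simp [Matrix.mul_apply, Finset.sum_apply, mul_comm]
  have h1 := MultilinearMap.map_sum
    (Matrix.detRowAlternating : (ι → R) [⋀^ι]→ₗ[R] R).toMultilinearMap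
    (fun i k => A k i • B.transpose k)
  rw [h]
  refine h1.trans (Finset.sum_congr rfl fun κ _ => ?_)
  refine (MultilinearMap.map_smul_univ _ (fun i => A (κ i) i) (fun i => B.transpose (κ i))).trans ?_
  rw [smul_eq_mul, ← Matrix.det_transpose (B.submatrix id κ)]
  rfl

variable {K : Type*} [Field K] {σ : Type*}

theorem mkDerivation_eq_sum [Fintype σ] (v : σ → MvPolynomial σ K) (q : MvPolynomial σ K) :
    mkDerivation K v q = ∑ j, pderiv j q * v j := by
  classical
  have : mkDerivation K v = ∑ j, v j • pderiv j := by
    refine derivation_ext fun i => ?_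
    rw [mkDerivation_X, ← Derivation.coeFnAddMonoidHom_apply, map_sum, Finset.sum_apply]
    simp [pderiv_X, Pi.single_apply]
  rw [this, ← Derivation.coeFnAddMonoidHom_apply, map_sum, Finset.sum_apply]
  simp [mul_comm]

/-- Carries an algebraic equation over the subalgebra `K[y]` back to a polynomial ring through
`aevalEquiv`. -/
theorem exists_eval₂_eq_zero {ι : Type*} {y : ι → MvPolynomial σ K}
    (hy : IsTranscendenceBasis K y) (g : MvPolynomial σ K) :
    ∃ P : Polynomial (MvPolynomial ι K), P ≠ 0 ∧ P.eval₂ (aeval y).toRingHom g = 0 := by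
  obtain ⟨P, hP0, hP⟩ := hy.isAlgebraic.isAlgebraic g
  refine ⟨P.map hy.1.aevalEquiv.symm.toRingEquiv.toRingHom, ?_, ?_⟩
  · rwa [Polynomial.map_ne_zero_iff hy.1.aevalEquiv.symm.injective]
  · rw [Polynomial.eval₂_map, ← hP, Polynomial.aeval_def]
    congr 1
    ext a
    · change coeff _ (aeval y (hy.1.aevalEquiv.symm a)) = _
      rw [← hy.1.algebraMap_aevalEquiv, AlgEquiv.apply_symm_apply]

variable [Fintype σ] [DecidableEq σ]

/-- A kernel vector `v` of the Jacobian matrix defines the derivation `∑ v j * ∂_j`, which kills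
every `y i`. It then kills each `X j`, as that is algebraic over `K[y]`; but it sends `X j` to `v
j`. -/
theorem jacobian_det_ne_zero_of_isTranscendenceBasis (y : σ → MvPolynomial σ K) (d : σ → ℕ)
    (hd : ∀ i, 1 ≤ d i) (hy : ∀ i, (y i).totalDegree ≤ d i)
    (hchar : ringChar K = 0 ∨ ∏ i, d i < ringChar K) (hb : IsTranscendenceBasis K y) :
    (Matrix.of fun i j => pderiv j (y i)).det ≠ 0 := by
  intro h
  obtain ⟨v, hv0, hv⟩ := Matrix.exists_mulVec_eq_zero_iff.2 h
  refine hv0 (funext fun j => ?_)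
  have hD : ∀ i, mkDerivation K v (y i) = 0 := fun i => by
    rw [mkDerivation_eq_sum]
    exact congrFun hv i
  have := derivation_eq_zero_of_algebraic y d hd hy hchar (mkDerivation K v) hD (X j)
    (exists_eval₂_eq_zero hb _) hb.1
  simpa using this

/-- The Jacobian criterion: algebraically independent polynomials of small degree have a nonzero
maximal minor in their Jacobian matrix. -/
theorem exists_jacobian_minor_ne_zero {ι : Type*} [Fintype ι] [DecidableEq ι]
    (f : ι → MvPolynomial σ K) (δ : ℕ) (hδ : 1 ≤ δ) (hf : ∀ i, (f i).totalDegree ≤ δ)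
    (hchar : ringChar K = 0 ∨ δ ^ Fintype.card ι < ringChar K) (hind : AlgebraicIndependent K f) :
    ∃ κ : ι → σ, (Matrix.of fun i j => pderiv (κ j) (f i)).det ≠ 0 := by
  classical
  have halg : Algebra.IsAlgebraic (Algebra.adjoin K (Set.range f ∪ Set.range (X (R := K) (σ := σ))))
      (MvPolynomial σ K) := by
    have htop : Algebra.adjoin K (Set.range f ∪ Set.range (X (R := K) (σ := σ))) = ⊤ := by
      rw [eq_top_iff, ← adjoin_range_X]
      exact Algebra.adjoin_mono Set.subset_union_right
    refine ⟨fun a => isAlgebraic_algebraMap (R := Algebra.adjoin K _)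
      (⟨a, htop ▸ Algebra.mem_top⟩ : Algebra.adjoin K _)⟩
  -- Completing `f` by variables, of degree `1`, leaves the product of the degrees at `δ ^
  -- Fintype.card ι`.
  obtain ⟨u, hfu, hux, hu⟩ := exists_isTranscendenceBasis_between (R := K) (Set.range f)
    (Set.range f ∪ Set.range X) Set.subset_union_left hind.to_subtype_range
  have hcard := hu.lift_cardinalMk_eq (IsTranscendenceBasis.mvPolynomial σ K)
  obtain ⟨e⟩ := Cardinal.lift_mk_eq'.1 hcard
  set y : σ → MvPolynomial σ K := fun i => (e.symm i : MvPolynomial σ K) with hydef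
  have hyb : IsTranscendenceBasis K y := (isTranscendenceBasis_equiv e.symm).2 hu
  let κ₀ : ι → σ := fun i => e ⟨f i, hfu ⟨i, rfl⟩⟩
  have hκ₀ : ∀ i, y (κ₀ i) = f i := fun i => by simp [hydef, κ₀]
  have hκ₀inj : Function.Injective κ₀ := fun i j hij =>
    hind.injective (by rw [← hκ₀, ← hκ₀, hij])
  let d : σ → ℕ := fun j => if j ∈ Finset.univ.image κ₀ then δ else 1
  have hprod : ∏ j, d j = δ ^ Fintype.card ι := by
    simp only [d]
    rw [Finset.prod_ite, Finset.prod_const, Finset.prod_const, one_pow, mul_one]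
    congr 1
    rw [Finset.filter_mem_eq_inter, Finset.univ_inter, Finset.card_image_of_injective _ hκ₀inj,
      Finset.card_univ]
  have hdet := jacobian_det_ne_zero_of_isTranscendenceBasis y d
    (fun j => by simp only [d]; split_ifs <;> omega)
    (fun j => by
      simp only [d]
      split_ifs with hj
      · obtain ⟨i, -, rfl⟩ := Finset.mem_image.1 hj
        rw [hκ₀]; exact hf i
      · rcases hux (e.symm j).2 with ⟨i, hi⟩ | ⟨i, hi⟩
        · refine absurd (Finset.mem_image.2 ⟨i, Finset.mem_univ _, ?_⟩) hj
          simp only [κ₀]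
          rw [← e.symm.injective.eq_iff]
          exact Subtype.ext (by simpa using hi)
        · change ((e.symm j : MvPolynomial σ K)).totalDegree ≤ 1
          rw [← hi, totalDegree_X]) (by rwa [hprod]) hyb
  set M : Matrix σ σ (MvPolynomial σ K) := Matrix.of fun i j => pderiv j (y i) with hM
  by_contra hcon
  push Not at hcon
  -- The rows of `f` times the matching columns of the adjugate give `M.det • 1`. Its determinant is
  -- a combination of the maximal minors of these rows, so if all of them vanished, `M.det` would be
  -- nilpotent.
  have h1 := det_mul_eq_sum (M.submatrix κ₀ id) (M.adjugate.submatrix id κ₀)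
  rw [← Matrix.submatrix_mul _ _ _ _ _ Function.bijective_id, Matrix.mul_adjugate] at h1
  have h2 : ∀ κ : ι → σ, ((M.submatrix κ₀ id).submatrix id κ).det = 0 := by
    intro κ
    rw [← hcon κ]
    congr 1
    funext i j
    simp [hM, hκ₀]
  simp only [h2, mul_zero, Finset.sum_const_zero] at h1
  have h3 : (M.det • (1 : Matrix σ σ (MvPolynomial σ K))).submatrix κ₀ κ₀ =
      M.det • (1 : Matrix ι ι (MvPolynomial σ K)) := by
    funext i j
    simp [Matrix.one_apply, hκ₀inj.eq_iff]
  rw [h3, Matrix.det_smul, Matrix.det_one, mul_one] at h1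
  exact hdet (eq_zero_of_pow_eq_zero h1)

end Jacobian

/-! ### The converse criterion over a perfect field. -/

section JacobianConverse

open MvPolynomial

variable {F : Type*} [Field F] {σ : Type*}

theorem totalDegree_pderiv_lt {i : σ} {q : MvPolynomial σ F} (h : pderiv i q ≠ 0) :
    (pderiv i q).totalDegree < q.totalDegree := by
  classical
  obtain ⟨m, hm, hmax⟩ := Finset.exists_mem_eq_sup (pderiv i q).support
    (support_nonempty.2 h) (fun s => s.sum fun _ e => e)
  rw [totalDegree, hmax]
  have hm' := mem_support_iff.1 hm
  rw [coeff_pderiv] at hm'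
  have h1 : m + Finsupp.single i 1 ∈ q.support := mem_support_iff.2 (left_ne_zero_of_mul hm')
  have h2 := le_totalDegree h1
  rw [Finsupp.sum_add_index' (fun _ => rfl) (fun _ _ _ => rfl)] at h2
  simp only [Finsupp.sum_single_index] at h2
  omega

/-- Over a perfect field of characteristic `p`, a polynomial whose partial derivatives vanish is a
`p`-th power. -/
theorem exists_pow_eq_of_pderiv_eq_zero (p : ℕ) [Fact p.Prime] [CharP F p] [PerfectRing F p]
    (q : MvPolynomial σ F) (h : ∀ i, pderiv i q = 0) : ∃ g, g ^ p = q := by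
  classical
  have hdvd : ∀ m ∈ q.support, ∀ i, p ∣ m i := by
    intro m hm i
    by_contra hp
    have hmi : m i ≠ 0 := fun h0 => hp (h0 ▸ dvd_zero _)
    have h1 := congrArg (coeff (m - Finsupp.single i 1)) (h i)
    rw [coeff_pderiv, coeff_zero, tsub_add_cancel_of_le (by
      rw [Finsupp.single_le_iff]; omega)] at h1
    rcases mul_eq_zero.1 h1 with h1 | h1
    · exact mem_support_iff.1 hm h1
    · have h2 : ((m i : ℕ) : F) = 0 := by
        rw [← h1]
        simp only [Finsupp.coe_tsub, Pi.sub_apply, Finsupp.single_eq_same]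
        rw [← Nat.cast_add_one, Nat.sub_add_cancel (by omega)]
      exact hp ((CharP.cast_eq_zero_iff F p _).1 h2)
  refine ⟨∑ m ∈ q.support, monomial (m.mapRange (· / p) (Nat.zero_div p))
    ((frobeniusEquiv F p).symm (q.coeff m)), ?_⟩
  have : CharP (MvPolynomial σ F) p := inferInstance
  have : ExpChar (MvPolynomial σ F) p := ExpChar.prime Fact.out
  rw [sum_pow_char]
  conv_rhs => rw [q.as_sum]
  refine Finset.sum_congr rfl fun m hm => ?_
  rw [monomial_pow, frobeniusEquiv_symm_pow_p]
  rw [show p • m.mapRange (· / p) (Nat.zero_div p) = m from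
    Finsupp.ext fun i => by simpa using Nat.mul_div_cancel' (hdvd m hm i)]

theorem pderiv_aeval {K : Type*} [Field K] [Algebra K F] {ι : Type*} [Fintype ι]
    (g : ι → MvPolynomial σ F) (j : σ) (q : MvPolynomial ι K) :
    pderiv j (aeval g q) = ∑ i, aeval g (pderiv i q) * pderiv j (g i) := by
  classical
  induction q using MvPolynomial.induction_on with
  | C a => simp [-aeval_eq_bind₁, MvPolynomial.algebraMap_apply]
  | add p q hp hq => simp only [map_add, hp, hq, add_mul, Finset.sum_add_distrib]
  | mul_X p i hp =>
    simp only [map_mul, aeval_X, pderiv_mul, hp, map_add, add_mul, Finset.sum_add_distrib,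
      Finset.sum_mul]
    congr 1
    · exact Finset.sum_congr rfl fun k _ => by ring
    · rw [Finset.sum_eq_single i]
      · simp
      · intro k _ hk
        rw [pderiv_X_of_ne hk.symm]; simp
      · simp

/-- Polynomials over a perfect field with a nonzero minor in their Jacobian matrix are
algebraically independent. -/
theorem algebraicIndependent_of_jacobian [PerfectField F] {ι : Type*} [Fintype ι]
    [DecidableEq ι] (g : ι → MvPolynomial σ F) (κ : ι → σ)
    (h : (Matrix.of fun i j => pderiv (κ j) (g i)).det ≠ 0) : AlgebraicIndependent F g := by
  rw [algebraicIndependent_iff]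
  by_contra hcon
  push Not at hcon
  let s : Set (MvPolynomial ι F) := {q | aeval g q = 0 ∧ q ≠ 0}
  have hs : s.Nonempty := hcon
  set q := Function.argminOn totalDegree s hs with hq
  obtain ⟨hq0, hqne⟩ : aeval g q = 0 ∧ q ≠ 0 := Function.argminOn_mem totalDegree s hs
  have hmin : ∀ q', aeval g q' = 0 → q' ≠ 0 → q.totalDegree ≤ q'.totalDegree := fun q' h1 h2 =>
    Function.argminOn_le totalDegree s (show q' ∈ s from ⟨h1, h2⟩)
  -- The chain rule puts the gradient of `q` at `g` into the left kernel of a nonsingular matrix. As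
  -- `q` has least degree among the relations, its partial derivatives must vanish identically.
  have hvec : (fun i => aeval g (pderiv i q)) = 0 := by
    refine Matrix.eq_zero_of_vecMul_eq_zero h (funext fun j => ?_)
    have := pderiv_aeval g (κ j) q
    rw [hq0, map_zero] at this
    exact this.symm
  have hder : ∀ i, pderiv i q = 0 := fun i => by
    by_contra hne
    exact absurd (hmin _ (congrFun hvec i) hne) (not_le.2 (totalDegree_pderiv_lt hne))
  have hdeg : q.totalDegree ≠ 0 := by
    intro h0
    rw [totalDegree_eq_zero_iff_eq_C] at h0
    rw [h0, aeval_C, algebraMap_eq, C_eq_zero] at hq0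
    exact hqne (by rw [h0, hq0, map_zero])
  obtain ⟨p, hp⟩ := CharP.exists F
  rcases CharP.char_is_prime_or_zero F p with hprime | rfl
  · have := Fact.mk hprime
    have : ExpChar F p := ExpChar.prime hprime
    obtain ⟨u, hu⟩ := exists_pow_eq_of_pderiv_eq_zero p q hder
    have hu0 : aeval g u = 0 := by
      rw [← hu, map_pow] at hq0
      exact pow_eq_zero_iff hprime.ne_zero |>.1 hq0
    have hune : u ≠ 0 := by
      rintro rfl
      rw [zero_pow hprime.ne_zero] at hu
      exact hqne hu.symm
    have h1 := hmin u hu0 hune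
    -- Splitting off two factors of `u ^ p` shows that `q` has at least twice the degree of `u`,
    -- which is itself a relation of positive degree.
    have h2 : q = u * (u * u ^ (p - 2)) := by
      rw [← hu, ← pow_succ', ← pow_succ']
      congr 1
      have := hprime.two_le
      omega
    have h3 : q.totalDegree = u.totalDegree + (u.totalDegree + (u ^ (p - 2)).totalDegree) := by
      conv_lhs => rw [h2]
      have h4 := pow_ne_zero (p - 2) hune
      rw [totalDegree_mul_of_isDomain hune (mul_ne_zero hune h4),
        totalDegree_mul_of_isDomain hune h4]
    have h5 := totalDegree_pow u p
    rw [hu] at h5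
    have h6 : u.totalDegree ≠ 0 := fun h0 => hdeg (by rw [h0, mul_zero] at h5; omega)
    omega
  · have : CharZero F := CharP.charP_to_charZero F
    obtain ⟨m, hm, hmax⟩ := Finset.exists_mem_eq_sup q.support
      (support_nonempty.2 hqne) (fun s => s.sum fun _ e => e)
    have hm0 : m ≠ 0 := by
      rintro rfl
      exact hdeg (by rw [totalDegree, hmax]; simp)
    obtain ⟨i, hi⟩ := Finsupp.ne_iff.1 hm0
    have hi' : m i ≠ 0 := hi
    have h1 := congrArg (coeff (m - Finsupp.single i 1)) (hder i)
    rw [coeff_pderiv, coeff_zero, tsub_add_cancel_of_le (by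
      rw [Finsupp.single_le_iff]; omega)] at h1
    rcases mul_eq_zero.1 h1 with h1 | h1
    · exact mem_support_iff.1 hm h1
    · exact Nat.cast_add_one_ne_zero _ h1

end JacobianConverse

/-! ### A small modulus that isolates an exponent, and uniqueness of digits. -/

section Modulus

/-- Finitely many exponents can be separated from one of them modulo a small number. -/
theorem exists_modulus (E : Finset ℕ) (e₀ L N : ℕ) (he₀ : e₀ ∈ E) (hE : ∀ e ∈ E, e ≤ 2 ^ L)
    (hN : E.card * L ≤ N) (h4 : 4 ≤ N) :
    ∃ p, 1 ≤ p ∧ p ≤ 2 * N ∧ ∀ e ∈ E, e % p = e₀ % p → e = e₀ := by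
  by_contra hcon
  push Not at hcon
  set A := ∏ e ∈ E.erase e₀, Nat.dist e e₀ with hA
  have hApos : A ≠ 0 := Finset.prod_ne_zero_iff.2 fun e he h =>
    (Finset.mem_erase.1 he).1 (Nat.eq_of_dist_eq_zero h)
  -- Every prime power dividing the central binomial coefficient is at most `2 * N`, so it is one of
  -- the moduli assumed to produce a collision, and hence it divides a difference `e - e₀`. The
  -- modulus obtained in this way need not be prime.
  have hdvd : N.centralBinom ∣ A := by
    rw [Nat.dvd_iff_prime_pow_dvd_dvd]
    intro p k hp hk
    have h1 : p ^ k ≤ 2 * N := by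
      have h2 := (hp.pow_dvd_iff_le_factorization (Nat.centralBinom_ne_zero N)).1 hk
      refine (Nat.pow_le_pow_right hp.pos h2).trans ?_
      exact Nat.pow_factorization_choose_le (by omega)
    obtain ⟨e, he, hmod, hne⟩ := hcon (p ^ k) (Nat.one_le_pow _ _ hp.pos) h1
    refine dvd_trans ?_ (Finset.dvd_prod_of_mem _ (Finset.mem_erase.2 ⟨hne, he⟩))
    rcases le_total e e₀ with h | h
    · rw [Nat.dist_eq_sub_of_le h]
      exact (Nat.modEq_iff_dvd' h).1 hmod
    · rw [Nat.dist_eq_sub_of_le_right h]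
      exact (Nat.modEq_iff_dvd' h).1 hmod.symm
  have hAle : A ≤ 2 ^ N := by
    calc A ≤ ∏ e ∈ E.erase e₀, 2 ^ L := by
          refine Finset.prod_le_prod' fun e he => ?_
          have h1 := hE e (Finset.mem_of_mem_erase he)
          have h2 := hE e₀ he₀
          rw [Nat.dist]; omega
      _ = 2 ^ (L * (E.erase e₀).card) := by rw [Finset.prod_const, pow_mul]
      _ ≤ 2 ^ N := by
          refine Nat.pow_le_pow_right (by norm_num) (le_trans ?_ hN)
          rw [mul_comm]
          exact Nat.mul_le_mul_right _ (Finset.card_le_card (Finset.erase_subset _ _))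
  -- The central binomial coefficient exceeds `4 ^ N / N`, too large to divide a nonzero number that
  -- is at most `2 ^ N`.
  have h1 := Nat.four_pow_lt_mul_centralBinom N h4
  have h2 := (Nat.le_of_dvd (Nat.pos_of_ne_zero hApos) hdvd).trans hAle
  have h3 : 4 ^ N = 2 ^ N * 2 ^ N := by rw [← mul_pow]; norm_num
  have h5 : N * N.centralBinom ≤ 2 ^ N * 2 ^ N := Nat.mul_le_mul Nat.lt_two_pow_self.le h2
  omega

theorem digits_injective {n B : ℕ} {a b : Fin n → ℕ} (ha : ∀ i, a i < B) (hb : ∀ i, b i < B)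
    (h : ∑ i, a i * B ^ (i : ℕ) = ∑ i, b i * B ^ (i : ℕ)) : a = b := by
  have h1 : finFunctionFinEquiv (fun i => (⟨a i, ha i⟩ : Fin B)) =
      finFunctionFinEquiv (fun i => (⟨b i, hb i⟩ : Fin B)) :=
    Fin.ext (by simpa [finFunctionFinEquiv_apply] using h)
  funext i
  exact congrArg Fin.val (congrFun (finFunctionFinEquiv.injective h1) i)

theorem digits_lt {n B : ℕ} {a : Fin n → ℕ} (ha : ∀ i, a i < B) :
    ∑ i, a i * B ^ (i : ℕ) < B ^ n := by
  have h := (finFunctionFinEquiv (fun i => (⟨a i, ha i⟩ : Fin B))).2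
  simpa [finFunctionFinEquiv_apply] using h

end Modulus

/-! ### Exponents modulo `p` in the group algebra of `ZMod p`. -/

section CyclicReduction

open Polynomial

variable (K : Type*) [Field K] (p : ℕ)

/-- Reduction of the exponents modulo `p`. -/
noncomputable def cyclic : K[X] →ₐ[K] AddMonoidAlgebra K (ZMod p) :=
  aeval (AddMonoidAlgebra.single (1 : ZMod p) 1)

theorem cyclic_X_pow_mod (k : ℕ) : cyclic K p (X ^ (k % p)) = cyclic K p (X ^ k) := by
  simp [cyclic, AddMonoidAlgebra.single_pow]

variable {K p}

/-- No other exponent falls into the class of `e₀`, so the coefficient there is not altered.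
Isolating one exponent is enough; the others may collide among themselves. -/
theorem cyclic_ne_zero (g : K[X]) (e₀ : ℕ) (he₀ : e₀ ∈ g.support)
    (h : ∀ e ∈ g.support, e % p = e₀ % p → e = e₀) : cyclic K p g ≠ 0 := by
  intro h0
  have h1 : cyclic K p g =
      ∑ e ∈ g.support, AddMonoidAlgebra.single (e : ZMod p) (g.coeff e) := by
    rw [cyclic, aeval_def, eval₂_eq_sum, Polynomial.sum]
    refine Finset.sum_congr rfl fun e _ => ?_
    simp [AddMonoidAlgebra.single_pow, AddMonoidAlgebra.single_mul_single]
  have h2 := congrArg (fun f => f.coeff (e₀ : ZMod p)) (h1.symm.trans h0)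
  simp only [AddMonoidAlgebra.coeff_sum, Finsupp.finsetSum_apply] at h2
  rw [Finset.sum_eq_single e₀] at h2
  · simp at h2
    exact (mem_support_iff.1 he₀) h2
  · intro e he hne
    have : (e : ZMod p) ≠ e₀ := fun h3 => hne (h e he ((ZMod.natCast_eq_natCast_iff' _ _ _).1 h3))
    simp [this]
  · exact fun h3 => absurd he₀ h3

end CyclicReduction

/-! ### The Jacobian on a monomial curve: sparsity, degree and nonvanishing. -/

section Specialization

open MvPolynomial

variable {K : Type*} [Field K] {n s : ℕ}

/-- The substitution `x_i ↦ t ^ w i`. -/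
noncomputable def powSubst (w : Fin n → ℕ) : MvPolynomial (Fin n) K →ₐ[K] Polynomial K :=
  aeval fun i => Polynomial.X ^ w i

/-- The product of the Jacobian matrix of `f` at the point `t ^ w` and the matrix `t ^ e`. -/
noncomputable def jacobianCurve (f : Fin s → MvPolynomial (Fin n) K) (w : Fin n → ℕ)
    (e : Fin n → Fin s → ℕ) : Matrix (Fin s) (Fin s) (Polynomial K) :=
  (Matrix.of fun i k => powSubst w (pderiv k (f i)) : Matrix (Fin s) (Fin n) (Polynomial K)) *
    (Matrix.of fun k j => Polynomial.X ^ e k j : Matrix (Fin n) (Fin s) (Polynomial K))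

theorem jacobianCurve_apply (f : Fin s → MvPolynomial (Fin n) K) (w : Fin n → ℕ)
    (e : Fin n → Fin s → ℕ) (i j : Fin s) :
    jacobianCurve f w e i j =
      ∑ k, powSubst w (pderiv k (f i)) * Polynomial.X ^ e k j := rfl

/-- The map `cyclic` is an algebra homomorphism, so it commutes with determinants, and in the group
algebra a power of `t` depends only on its exponent modulo `p`. -/
theorem cyclic_jacobianCurve_det (f : Fin s → MvPolynomial (Fin n) K) (w : Fin n → ℕ)
    (e : Fin n → Fin s → ℕ) (p : ℕ) :
    cyclic K p (jacobianCurve f (fun i => w i % p) (fun k j => e k j % p)).det =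
      cyclic K p (jacobianCurve f w e).det := by
  rw [AlgHom.map_det, AlgHom.map_det]
  congr 1
  funext i j
  have h : ∀ q : MvPolynomial (Fin n) K,
      cyclic K p (powSubst (fun i => w i % p) q) = cyclic K p (powSubst w q) := by
    intro q
    have : (cyclic K p).comp (powSubst fun i => w i % p) = (cyclic K p).comp (powSubst w) := by
      refine algHom_ext fun i => ?_
      simp only [powSubst, AlgHom.comp_apply, aeval_X]
      exact cyclic_X_pow_mod K p _
    exact DFunLike.congr_fun this q
  simp only [AlgHom.mapMatrix_apply, Matrix.map_apply, jacobianCurve_apply, map_sum, map_mul, h,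
    cyclic_X_pow_mod]

theorem powSubst_eq_sum (w : Fin n → ℕ) (q : MvPolynomial (Fin n) K) :
    powSubst w q = ∑ α ∈ q.support,
      Polynomial.C (q.coeff α) * Polynomial.X ^ (∑ i, α i * w i) := by
  rw [powSubst, aeval_def, eval₂_eq']
  refine Finset.sum_congr rfl fun α _ => ?_
  congr 1
  rw [← Finset.prod_pow_eq_pow_sum]
  exact Finset.prod_congr rfl fun i _ => by rw [← pow_mul, mul_comm]

theorem card_support_sum_le {ι : Type*} (S : Finset ι) (g : ι → Polynomial K) :
    (∑ i ∈ S, g i).support.card ≤ ∑ i ∈ S, (g i).support.card := by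
  classical
  induction S using Finset.induction_on with
  | empty => simp
  | insert a S ha ih =>
    rw [Finset.sum_insert ha, Finset.sum_insert ha]
    exact (Finset.card_le_card Polynomial.support_add).trans
      ((Finset.card_union_le _ _).trans (Nat.add_le_add_left ih _))

theorem card_support_prod_le {ι : Type*} (S : Finset ι) (g : ι → Polynomial K) :
    (∏ i ∈ S, g i).support.card ≤ ∏ i ∈ S, (g i).support.card := by
  classical
  induction S using Finset.induction_on with
  | empty => simpa using Polynomial.card_support_C_mul_X_pow_le_one (c := (1 : K)) (n := 0)
  | insert a S ha ih =>
    rw [Finset.prod_insert ha, Finset.prod_insert ha]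
    exact Polynomial.card_support_mul_le.trans (Nat.mul_le_mul_left _ ih)

theorem det_eq_sum_sign_mul (M : Matrix (Fin s) (Fin s) (Polynomial K)) :
    M.det = ∑ σ : Equiv.Perm (Fin s),
      Polynomial.C ((Equiv.Perm.sign σ : ℤ) : K) * ∏ i, M (σ i) i := by
  rw [Matrix.det_apply']
  simp

theorem card_support_det_le (M : Matrix (Fin s) (Fin s) (Polynomial K)) (b : ℕ)
    (h : ∀ i j, (M i j).support.card ≤ b) : M.det.support.card ≤ s.factorial * b ^ s := by
  rw [det_eq_sum_sign_mul]
  refine (card_support_sum_le _ _).trans ((Finset.sum_le_card_nsmul _ _ (b ^ s) fun σ _ => ?_).trans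
    (by simp [Fintype.card_perm]))
  refine Polynomial.card_support_mul_le.trans ?_
  have h1 : (Polynomial.C ((Equiv.Perm.sign σ : ℤ) : K)).support.card ≤ 1 := by
    simpa using Polynomial.card_support_C_mul_X_pow_le_one
      (c := ((Equiv.Perm.sign σ : ℤ) : K)) (n := 0)
  have h2 : (∏ i, M (σ i) i).support.card ≤ b ^ s :=
    (card_support_prod_le _ _).trans
      ((Finset.prod_le_prod' fun i _ => h (σ i) i).trans (by simp))
  calc _ ≤ 1 * b ^ s := Nat.mul_le_mul h1 h2
    _ = _ := one_mul _

theorem natDegree_det_le (M : Matrix (Fin s) (Fin s) (Polynomial K)) (b : ℕ)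
    (h : ∀ i j, (M i j).natDegree ≤ b) : M.det.natDegree ≤ s * b := by
  rw [det_eq_sum_sign_mul]
  refine Polynomial.natDegree_sum_le_of_forall_le _ _ fun σ _ => ?_
  refine (Polynomial.natDegree_C_mul_le _ _).trans ((Polynomial.natDegree_prod_le _ _).trans ?_)
  refine (Finset.sum_le_card_nsmul _ _ b fun i _ => h (σ i) i).trans ?_
  simp

theorem totalDegree_det_le (M : Matrix (Fin s) (Fin s) (MvPolynomial (Fin n) K)) (b : ℕ)
    (h : ∀ i j, (M i j).totalDegree ≤ b) : M.det.totalDegree ≤ s * b := by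
  rw [Matrix.det_apply]
  refine totalDegree_finsetSum_le fun σ _ => ?_
  rw [Units.smul_def]
  refine (totalDegree_smul_le _ _).trans ((totalDegree_finsetProd _ _).trans ?_)
  refine (Finset.sum_le_card_nsmul _ _ b fun i _ => h (σ i) i).trans ?_
  simp

theorem card_support_pderiv_le (k : Fin n) (q : MvPolynomial (Fin n) K) :
    (pderiv k q).support.card ≤ q.support.card := by
  refine Finset.card_le_card_of_injOn (· + Finsupp.single k 1) ?_
    fun a _ b _ h => add_right_cancel h
  intro m hm
  have hm' := mem_support_iff.1 hm
  rw [coeff_pderiv] at hm'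
  exact mem_support_iff.2 (left_ne_zero_of_mul hm')

theorem totalDegree_pderiv_le (k : Fin n) (q : MvPolynomial (Fin n) K) :
    (pderiv k q).totalDegree ≤ q.totalDegree - 1 := by
  by_cases h : pderiv k q = 0
  · simp [h]
  · have := totalDegree_pderiv_lt h
    omega

theorem card_support_powSubst_le (w : Fin n → ℕ) (q : MvPolynomial (Fin n) K) :
    (powSubst w q).support.card ≤ q.support.card := by
  rw [powSubst_eq_sum]
  refine (card_support_sum_le _ _).trans ((Finset.sum_le_card_nsmul _ _ 1 fun α _ => ?_).trans
    (by simp))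
  exact Polynomial.card_support_C_mul_X_pow_le_one

theorem natDegree_powSubst_le (w : Fin n → ℕ) (W : ℕ) (hw : ∀ i, w i ≤ W)
    (q : MvPolynomial (Fin n) K) : (powSubst w q).natDegree ≤ q.totalDegree * W := by
  rw [powSubst_eq_sum]
  refine Polynomial.natDegree_sum_le_of_forall_le _ _ fun α hα => ?_
  refine (Polynomial.natDegree_C_mul_X_pow_le _ _).trans ?_
  have := le_totalDegree hα
  rw [Finsupp.sum_fintype _ _ (fun _ => rfl)] at this
  calc ∑ i, α i * w i ≤ ∑ i, α i * W := Finset.sum_le_sum fun i _ => Nat.mul_le_mul_left _ (hw i)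
    _ = (∑ i, α i) * W := by rw [Finset.sum_mul]
    _ ≤ _ := Nat.mul_le_mul_right _ this

/-- Each entry is a sum of `n` terms with at most `ℓ` monomials each, and the Leibniz formula has
`s!` products of `s` entries. The exponents `w` and `e` do not matter, so substituting large powers
costs nothing here. -/
theorem card_support_jacobianCurve_det_le (f : Fin s → MvPolynomial (Fin n) K) (w : Fin n → ℕ)
    (e : Fin n → Fin s → ℕ) (ℓ : ℕ) (hf : ∀ i, (f i).support.card ≤ ℓ) :
    (jacobianCurve f w e).det.support.card ≤ s.factorial * (n * ℓ) ^ s := by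
  refine card_support_det_le _ _ fun i j => ?_
  rw [jacobianCurve_apply]
  refine (card_support_sum_le _ _).trans ((Finset.sum_le_card_nsmul _ _ ℓ fun k _ => ?_).trans
    (by simp))
  refine Polynomial.card_support_mul_le.trans ?_
  have h1 : (Polynomial.X ^ e k j : Polynomial K).support.card ≤ 1 := by
    simp
  calc _ ≤ ℓ * 1 := Nat.mul_le_mul ((card_support_powSubst_le _ _).trans
        ((card_support_pderiv_le _ _).trans (hf i))) h1
    _ = ℓ := mul_one _

/-- Differentiation leaves degree at most `δ - 1`, which makes room for the factor `X ^ e k j`: for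
`W = E` and `1 ≤ δ` the bound is `s * δ * W`. -/
theorem natDegree_jacobianCurve_det_le (f : Fin s → MvPolynomial (Fin n) K) (w : Fin n → ℕ)
    (e : Fin n → Fin s → ℕ) (δ W E : ℕ) (hf : ∀ i, (f i).totalDegree ≤ δ) (hw : ∀ i, w i ≤ W)
    (he : ∀ k j, e k j ≤ E) :
    (jacobianCurve f w e).det.natDegree ≤ s * ((δ - 1) * W + E) := by
  refine natDegree_det_le _ _ fun i j => ?_
  rw [jacobianCurve_apply]
  refine Polynomial.natDegree_sum_le_of_forall_le _ _ fun k _ => ?_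
  refine Polynomial.natDegree_mul_le.trans (Nat.add_le_add ?_ ?_)
  · refine (natDegree_powSubst_le w W hw _).trans (Nat.mul_le_mul_right _ ?_)
    exact (totalDegree_pderiv_le _ _).trans (Nat.sub_le_sub_right (hf i) 1)
  · exact (Polynomial.natDegree_X_pow_le _).trans (he k j)

/-- If the exponents `e` separate the maps `Fin s → Fin n` below `D`, and `w` is the Kronecker
substitution to the base `D`, no cancellation occurs. -/
theorem jacobianCurve_det_ne_zero (f : Fin s → MvPolynomial (Fin n) K) (e : Fin n → Fin s → ℕ)
    (D δ : ℕ) (hf : ∀ i, (f i).totalDegree ≤ δ) (hD : s * δ < D)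
    (he : ∀ κ : Fin s → Fin n, ∑ j, e (κ j) j < D)
    (hinj : Function.Injective fun κ : Fin s → Fin n => ∑ j, e (κ j) j)
    (h : ∃ κ : Fin s → Fin n, (Matrix.of fun i j => pderiv (κ j) (f i)).det ≠ 0) :
    (jacobianCurve f (fun i => D ^ ((i : ℕ) + 1)) e).det ≠ 0 := by
  classical
  set J : (Fin s → Fin n) → MvPolynomial (Fin n) K :=
    fun κ => (Matrix.of fun i j => pderiv (κ j) (f i)).det with hJ
  obtain ⟨κ₀, hκ₀⟩ := h
  obtain ⟨α₀, hα₀⟩ := support_nonempty.2 hκ₀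
  have hlt : ∀ κ, ∀ α ∈ (J κ).support, ∀ i, α i < D := by
    intro κ α hα i
    have h1 : (J κ).totalDegree ≤ s * δ := totalDegree_det_le _ _ fun i j =>
      (totalDegree_pderiv_le _ _).trans ((Nat.sub_le _ _).trans (hf i))
    have h2 := le_totalDegree hα
    rw [Finsupp.sum_fintype _ _ (fun _ => rfl)] at h2
    have h3 := Finset.single_le_sum (f := α) (fun _ _ => Nat.zero_le _) (Finset.mem_univ i)
    omega
  -- By Cauchy-Binet and the Kronecker substitution, the lowest digit of each exponent to the base
  -- `D` encodes `κ`, and the higher digits are the entries of `α`.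
  have hexp : (jacobianCurve f (fun i => D ^ ((i : ℕ) + 1)) e).det =
      ∑ κ : Fin s → Fin n, ∑ α ∈ (J κ).support, Polynomial.C ((J κ).coeff α) *
        Polynomial.X ^ (∑ j, e (κ j) j + D * ∑ i, α i * D ^ (i : ℕ)) := by
    rw [jacobianCurve, det_mul_eq_sum]
    refine Finset.sum_congr rfl fun κ _ => ?_
    have h1 : ((Matrix.of fun i k => powSubst (fun i : Fin n => D ^ ((i : ℕ) + 1))
        (pderiv k (f i))).submatrix id κ).det = powSubst (fun i : Fin n => D ^ ((i : ℕ) + 1))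
          (J κ) := by
      rw [hJ, AlgHom.map_det]
      rfl
    rw [h1, powSubst_eq_sum, Finset.mul_sum]
    refine Finset.sum_congr rfl fun α _ => ?_
    simp only [Matrix.of_apply]
    rw [Finset.prod_pow_eq_pow_sum, mul_left_comm, ← pow_add]
    congr 3
    rw [Finset.mul_sum]
    exact Finset.sum_congr rfl fun i _ => by ring
  intro h0
  have h1 := congrArg (fun q => Polynomial.coeff q
    (∑ j, e (κ₀ j) j + D * ∑ i, α₀ i * D ^ (i : ℕ))) (hexp.symm.trans h0)
  simp only [Polynomial.finsetSum_coeff, Polynomial.coeff_C_mul_X_pow, Polynomial.coeff_zero] at h1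
  have hcode : ∀ κ, ∀ α ∈ (J κ).support,
      ∑ j, e (κ₀ j) j + D * ∑ i, α₀ i * D ^ (i : ℕ) =
        ∑ j, e (κ j) j + D * ∑ i, α i * D ^ (i : ℕ) → κ = κ₀ ∧ α = α₀ := by
    intro κ α hα heq
    have hm := congrArg (· % D) heq
    have hd := congrArg (· / D) heq
    simp only [Nat.add_mul_mod_self_left, Nat.mod_eq_of_lt (he _)] at hm
    have hDpos : 0 < D := by omega
    simp only [Nat.add_mul_div_left _ _ hDpos, Nat.div_eq_of_lt (he _), zero_add] at hd
    refine ⟨(hinj hm).symm, DFunLike.coe_injective ?_⟩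
    exact (digits_injective (hlt κ₀ α₀ hα₀) (hlt κ α hα) hd).symm
  rw [Finset.sum_eq_single κ₀, Finset.sum_eq_single α₀, if_pos rfl] at h1
  · exact mem_support_iff.1 hα₀ h1
  · intro α hα hne
    rw [if_neg]
    exact fun heq => hne (hcode κ₀ α hα heq).2
  · exact fun h3 => absurd hα₀ h3
  · intro κ _ hne
    refine Finset.sum_eq_zero fun α hα => ?_
    rw [if_neg]
    exact fun heq => hne (hcode κ α hα heq).1
  · exact fun h3 => absurd (Finset.mem_univ _) h3

end Specialization

/-! ### Numerical estimates for `paramD` and `pMax`. -/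

section Bounds

theorem two_mul_self_le_two_pow_succ (r : ℕ) : 2 * r ≤ 2 ^ (r + 1) := by
  have := (Nat.lt_two_pow_self (n := r)).le
  rw [pow_succ]; omega

theorem two_mul_mul_le_paramD {n r δ : ℕ} (hn : 1 ≤ n) :
    2 * (r * δ) ≤ paramD n r δ := by
  have h1 := two_mul_self_le_two_pow_succ r
  have h2 : δ ≤ δ ^ (r + 1) := Nat.le_self_pow (by omega) δ
  have h3 : 1 ≤ n ^ (r + 1) := Nat.one_le_pow _ _ hn
  calc 2 * (r * δ) = (2 * r) * δ * 1 := by ring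
    _ ≤ 2 ^ (r + 1) * δ ^ (r + 1) * n ^ (r + 1) := Nat.mul_le_mul (Nat.mul_le_mul h1 h2) h3
    _ = paramD n r δ := by rw [paramD, mul_pow, mul_pow]

theorem succ_pow_le_paramD {n r δ : ℕ} (hn : 1 ≤ n) (hδ : 1 ≤ δ) :
    (n + 1) ^ (r + 1) ≤ paramD n r δ := by
  refine Nat.pow_le_pow_left ?_ _
  nlinarith

theorem four_le_paramD {n r δ : ℕ} (hn : 1 ≤ n) (hr : 1 ≤ r) (hδ : 1 ≤ δ) : 4 ≤ paramD n r δ := by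
  calc 4 = 2 ^ 2 := rfl
    _ ≤ 2 ^ (r + 1) := Nat.pow_le_pow_right (by norm_num) (by omega)
    _ ≤ paramD n r δ := Nat.pow_le_pow_left (by nlinarith) _

theorem two_le_clog_paramD {n r δ : ℕ} (hn : 1 ≤ n) (hr : 1 ≤ r) (hδ : 1 ≤ δ) :
    2 ≤ Nat.clog 2 (paramD n r δ) := by
  by_contra h
  have h1 := Nat.le_pow_clog (b := 2) (by norm_num) (paramD n r δ)
  have h2 := four_le_paramD hn hr hδ
  have h3 : 2 ^ Nat.clog 2 (paramD n r δ) ≤ 2 ^ 1 := Nat.pow_le_pow_right (by norm_num) (by omega)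
  omega

/-- The number of exponents times their length, against the square root of `pMax`. -/
theorem sparsity_mul_length_le {n r ℓ s : ℕ} (hn : 1 ≤ n) (hr : 1 ≤ r) (hℓ : 1 ≤ ℓ)
    (hs : s ≤ r) : s.factorial * (n * ℓ) ^ s * (n + 1) ≤ (2 * n * r * ℓ) ^ (r + 1) := by
  have h1 : s.factorial ≤ r ^ s := (Nat.factorial_le_pow s).trans (Nat.pow_le_pow_left hs _)
  calc s.factorial * (n * ℓ) ^ s * (n + 1) ≤ r ^ s * (n * ℓ) ^ s * (2 * n) :=
        Nat.mul_le_mul (Nat.mul_le_mul_right _ h1) (by omega)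
    _ = (r * (n * ℓ)) ^ s * (2 * n) := by rw [mul_pow r]
    _ ≤ (2 * n * r * ℓ) ^ r * (2 * n * r * ℓ) := by
        refine Nat.mul_le_mul ?_ ?_
        · calc (r * (n * ℓ)) ^ s ≤ (r * (n * ℓ)) ^ r := Nat.pow_le_pow_right (by positivity) hs
            _ ≤ _ := Nat.pow_le_pow_left (by nlinarith [Nat.zero_le (n * r * ℓ)]) _
        · rw [mul_assoc (2 * n)]
          exact Nat.le_mul_of_pos_right _ (by positivity)
    _ = _ := (pow_succ _ _).symm

end Bounds

/-! ### A modulus for which the reduced Jacobian determinant is nonzero. -/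

section Modulus

open MvPolynomial

/-- The exponents of the matrix of linear forms in `Ψ` without reduction. -/
def vandermondeExp (n s : ℕ) (k : Fin n) (j : Fin s) : ℕ := ((k : ℕ) + 1) * (n + 1) ^ ((j : ℕ) + 1)

theorem sum_vandermondeExp {n s : ℕ} (κ : Fin s → Fin n) :
    ∑ j, vandermondeExp n s (κ j) j =
      (n + 1) * ∑ j, ((κ j : ℕ) + 1) * (n + 1) ^ (j : ℕ) := by
  rw [Finset.mul_sum]
  exact Finset.sum_congr rfl fun j _ => by rw [vandermondeExp]; ring

theorem sum_vandermondeExp_lt {n s : ℕ} (κ : Fin s → Fin n) :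
    ∑ j, vandermondeExp n s (κ j) j < (n + 1) ^ (s + 1) := by
  rw [sum_vandermondeExp, pow_succ']
  exact Nat.mul_lt_mul_of_pos_left (digits_lt fun j => by omega) (by omega)

/-- The numbers `κ j + 1` lie between `1` and `n` and are digits to the base `n + 1`. All maps `κ`
have to be separated, since the determinant is expanded over all of them. -/
theorem sum_vandermondeExp_injective (n s : ℕ) :
    Function.Injective fun κ : Fin s → Fin n => ∑ j, vandermondeExp n s (κ j) j := by
  intro κ κ' h
  simp only [sum_vandermondeExp] at h
  have h1 := digits_injective (B := n + 1) (a := fun j => (κ j : ℕ) + 1)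
    (b := fun j => (κ' j : ℕ) + 1) (fun j => by omega) (fun j => by omega)
    (Nat.eq_of_mul_eq_mul_left (by omega) h)
  funext j
  have := congrFun h1 j
  exact Fin.ext (by omega)

variable {K : Type*} [Field K]

/-- The determinant `g` with unreduced exponents is nonzero and sparse, with exponents of at most
`(n + 1) * c` bits. A modulus isolating one of them keeps its image in the group algebra nonzero;
the determinant with reduced exponents has the same image. Reduction is also what makes the degree
small enough for `H₁`. -/
theorem exists_modulus_jacobianCurve {n r δ ℓ s : ℕ} (hn : 1 ≤ n) (hr : 1 ≤ r) (hδ : 1 ≤ δ)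
    (hℓ : 1 ≤ ℓ) (hs : s ≤ r) (hchar : ringChar K = 0 ∨ δ ^ r < ringChar K)
    (f : Fin s → MvPolynomial (Fin n) K) (hind : AlgebraicIndependent K f)
    (hsp : ∀ i, (f i).support.card ≤ ℓ) (hdeg : ∀ i, (f i).totalDegree ≤ δ) :
    ∃ p, 1 ≤ p ∧ p ≤ pMax n r δ ℓ ∧
      (jacobianCurve f (fun i => paramD n r δ ^ ((i : ℕ) + 1) % p)
        (fun k j => vandermondeExp n s k j % p)).det ≠ 0 ∧
      (jacobianCurve f (fun i => paramD n r δ ^ ((i : ℕ) + 1) % p)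
        (fun k j => vandermondeExp n s k j % p)).det.natDegree < δ * r * pMax n r δ ℓ := by
  set D := paramD n r δ with hD
  have hD4 : 4 ≤ D := four_le_paramD hn hr hδ
  have hrδ : 2 * (r * δ) ≤ D := two_mul_mul_le_paramD hn
  have hsδ : s * δ ≤ r * δ := Nat.mul_le_mul_right _ hs
  have hκ : ∀ κ : Fin s → Fin n, ∑ j, vandermondeExp n s (κ j) j < D := fun κ =>
    (sum_vandermondeExp_lt κ).trans_le
      ((Nat.pow_le_pow_right (by omega) (by omega)).trans (succ_pow_le_paramD hn hδ))
  have hne := jacobianCurve_det_ne_zero f (vandermondeExp n s) D δ hdeg (by omega) hκ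
    (sum_vandermondeExp_injective n s)
    (exists_jacobian_minor_ne_zero f δ hδ hdeg (hchar.imp_right fun h => by
      rw [Fintype.card_fin]
      exact (Nat.pow_le_pow_right hδ hs).trans_lt h) hind)
  set g := (jacobianCurve f (fun i => D ^ ((i : ℕ) + 1)) (vandermondeExp n s)).det with hg
  set c := Nat.clog 2 D with hc
  -- With this `N`, `pMax` equals `N ^ 2 + 1`, while a modulus up to `2 * N` suffices.
  set N := (2 * n * r * ℓ) ^ (r + 1) * c with hN
  have hdegg : g.natDegree ≤ 2 ^ ((n + 1) * c) := by
    have h1 := natDegree_jacobianCurve_det_le f (fun i : Fin n => D ^ ((i : ℕ) + 1))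
      (vandermondeExp n s) δ (D ^ n) D hdeg
      (fun i => Nat.pow_le_pow_right (by omega) (by omega)) (fun k j => by
        have h2 := hκ fun _ => k
        have h3 := Finset.single_le_sum (f := fun j => vandermondeExp n s k j)
          (fun _ _ => Nat.zero_le _) (Finset.mem_univ j)
        exact h3.trans h2.le)
    have h2 : D ≤ D ^ n := Nat.le_self_pow (by omega) D
    calc g.natDegree ≤ s * ((δ - 1) * D ^ n + D) := h1
      _ ≤ s * ((δ - 1) * D ^ n + D ^ n) := Nat.mul_le_mul_left _ (Nat.add_le_add_left h2 _)
      _ = s * δ * D ^ n := by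
          obtain ⟨δ', rfl⟩ : ∃ δ', δ = δ' + 1 := ⟨δ - 1, by omega⟩
          simp only [Nat.add_sub_cancel]; ring
      _ ≤ D * D ^ n := Nat.mul_le_mul_right _ (by omega)
      _ = D ^ (n + 1) := (pow_succ' _ _).symm
      _ ≤ (2 ^ c) ^ (n + 1) := Nat.pow_le_pow_left (Nat.le_pow_clog (by norm_num) _) _
      _ = 2 ^ ((n + 1) * c) := by rw [← pow_mul, mul_comm]
  have hcard : g.support.card * ((n + 1) * c) ≤ N := by
    calc g.support.card * ((n + 1) * c) ≤ (s.factorial * (n * ℓ) ^ s) * ((n + 1) * c) :=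
          Nat.mul_le_mul_right _ (card_support_jacobianCurve_det_le f _ _ ℓ hsp)
      _ = (s.factorial * (n * ℓ) ^ s * (n + 1)) * c := by ring
      _ ≤ N := Nat.mul_le_mul_right _ (sparsity_mul_length_le hn hr hℓ hs)
  have hN4 : 4 ≤ N := by
    have h1 : 2 ≤ c := two_le_clog_paramD hn hr hδ
    have h2 : 2 ≤ 2 * n * r * ℓ := by
      have : 1 ≤ n * r * ℓ := Nat.mul_pos (Nat.mul_pos hn hr) hℓ
      nlinarith
    have h3 : 2 * n * r * ℓ ≤ (2 * n * r * ℓ) ^ (r + 1) := Nat.le_self_pow (by omega) _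
    calc 4 = 2 * 2 := rfl
      _ ≤ N := Nat.mul_le_mul (h2.trans h3) h1
  obtain ⟨e₀, he₀⟩ := Polynomial.support_nonempty.2 hne
  obtain ⟨p, hp1, hp2, hp⟩ := exists_modulus g.support e₀ ((n + 1) * c) N he₀
    (fun e he => (Polynomial.le_natDegree_of_mem_supp e he).trans hdegg) hcard hN4
  have hpM : p ≤ pMax n r δ ℓ := by
    have h1 : pMax n r δ ℓ = N ^ 2 + 1 := by
      rw [pMax, hN, mul_pow _ c, ← pow_mul, mul_comm (r + 1) 2]
    rw [h1]
    nlinarith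
  refine ⟨p, hp1, hpM, ?_, ?_⟩
  · intro h0
    refine cyclic_ne_zero (p := p) g e₀ he₀ hp ?_
    rw [hg, ← cyclic_jacobianCurve_det, h0, map_zero]
  · refine (natDegree_jacobianCurve_det_le f _ _ δ (p - 1) (p - 1) hdeg
      (fun i => Nat.le_sub_one_of_lt (Nat.mod_lt _ hp1))
      (fun k j => Nat.le_sub_one_of_lt (Nat.mod_lt _ hp1))).trans_lt ?_
    have h1 : (δ - 1) * (p - 1) + (p - 1) = δ * (p - 1) := by
      obtain ⟨δ', rfl⟩ : ∃ δ', δ = δ' + 1 := ⟨δ - 1, by omega⟩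
      simp only [Nat.add_sub_cancel]; ring
    rw [h1, ← mul_assoc]
    calc s * δ * (p - 1) ≤ δ * r * (p - 1) := Nat.mul_le_mul_right _ (by rw [mul_comm δ r]; exact hsδ)
      _ < δ * r * pMax n r δ ℓ := Nat.mul_lt_mul_of_pos_left (by omega) (by positivity)

end Modulus

/-! ### The substitution preserves independence, and the explicit set hits. -/

section HittingSet

open MvPolynomial

variable {K : Type u} [Field K]

theorem eval_psi_X {F : Type*} [Field F] {n r D₁ D₂ p : ℕ} (c : F) (a : Fin (r + 1) → F)
    (i : Fin n) : eval a (psi F n r D₁ D₂ p c (X i)) =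
      c ^ (D₁ ^ ((i : ℕ) + 1) % p) + c ^ (D₂ ^ ((i : ℕ) + 1) % p) * a 0 +
        ∑ j : Fin r, c ^ ((((i : ℕ) + 1) * (n + 1) ^ ((j : ℕ) + 1)) % p) * a j.succ := by
  simp [psi, psiMod, mapAlgHom_apply]

theorem psi_X {F : Type*} [Field F] {n r D₁ D₂ p : ℕ} (c : F) (i : Fin n) :
    psi F n r D₁ D₂ p c (X i) =
      C (c ^ (D₁ ^ ((i : ℕ) + 1) % p)) + C (c ^ (D₂ ^ ((i : ℕ) + 1) % p)) * X 0 +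
        ∑ j : Fin r, C (c ^ ((((i : ℕ) + 1) * (n + 1) ^ ((j : ℕ) + 1)) % p)) * X j.succ := by
  simp [psi, psiMod, mapAlgHom_apply]

theorem pderiv_psi_X {F : Type*} [Field F] {n r D₁ D₂ p : ℕ} (c : F) (i : Fin n) (j : Fin r) :
    pderiv j.succ (psi F n r D₁ D₂ p c (X i)) =
      C (c ^ ((((i : ℕ) + 1) * (n + 1) ^ ((j : ℕ) + 1)) % p)) := by
  classical
  rw [psi_X]
  simp only [map_add, map_sum, pderiv_C, pderiv_C_mul, pderiv_X, Pi.single_apply, zero_add]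
  rw [if_neg (Fin.succ_ne_zero j).symm, mul_zero, zero_add, Finset.sum_eq_single j]
  · simp
  · intro k _ hk
    rw [if_neg (fun h => hk (Fin.succ_injective _ h)), mul_zero]
  · simp

theorem totalDegree_psi_X_le {F : Type*} [Field F] {n r D₁ D₂ p : ℕ} (c : F) (i : Fin n) :
    (psi F n r D₁ D₂ p c (X i)).totalDegree ≤ 1 := by
  have hX : ∀ (a : F) (j : Fin (r + 1)), (C a * X j : MvPolynomial (Fin (r + 1)) F).totalDegree ≤ 1 :=
    fun a j => (totalDegree_mul _ _).trans (by rw [totalDegree_C, totalDegree_X])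
  rw [psi_X]
  refine (totalDegree_add _ _).trans (max_le ((totalDegree_add _ _).trans (max_le ?_ (hX _ _)))
    (totalDegree_finsetSum_le fun j _ => hX _ _))
  rw [totalDegree_C]; exact Nat.zero_le _

theorem totalDegree_aeval_le {F : Type*} [Field F] [Algebra K F] {n m : ℕ}
    (L : Fin n → MvPolynomial (Fin m) F) (hL : ∀ i, (L i).totalDegree ≤ 1)
    (h : MvPolynomial (Fin n) K) : (aeval L h).totalDegree ≤ h.totalDegree := by
  rw [aeval_def, eval₂_eq']
  refine totalDegree_finsetSum_le fun α hα => (totalDegree_mul _ _).trans ?_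
  rw [MvPolynomial.algebraMap_apply, totalDegree_C, zero_add]
  have h1 := le_totalDegree hα
  rw [Finsupp.sum_fintype _ _ (fun _ => rfl)] at h1
  refine ((totalDegree_finsetProd _ _).trans (Finset.sum_le_sum fun i _ => ?_)).trans h1
  refine (totalDegree_pow _ _).trans ?_
  calc _ ≤ α i * 1 := Nat.mul_le_mul_left _ (hL i)
    _ = α i := mul_one _

/-- A maximal algebraically independent subfamily. -/
theorem exists_trdeg_subfamily {n m : ℕ} (f : Fin m → MvPolynomial (Fin n) K) :
    ∃ g : Fin (trdeg K f) → Fin m, AlgebraicIndependent K (f ∘ g) ∧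
      ∀ i, IsAlgebraic (Algebra.adjoin K (Set.range (f ∘ g))) (f i) := by
  classical
  obtain ⟨s, hs, hmax⟩ := Finset.exists_mem_eq_sup
    (Finset.univ.filter fun s : Finset (Fin m) => AlgebraicIndependent K (fun i : s => f i))
    ⟨∅, by
      simp only [Finset.mem_filter, Finset.mem_univ, true_and]
      exact algebraicIndependent_empty_type_iff.2 (algebraMap K (MvPolynomial (Fin n) K)).injective⟩
    Finset.card
  have hs' : AlgebraicIndependent K (fun i : s => f i) := (Finset.mem_filter.1 hs).2
  have hcard : s.card = trdeg K f := by rw [trdeg]; convert hmax.symm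
  let e : Fin (trdeg K f) ≃ s := (s.equivFinOfCardEq hcard).symm
  refine ⟨fun i => e i, hs'.comp e e.injective, fun i => ?_⟩
  have hrange : Set.range (f ∘ fun i => (e i : Fin m)) = f '' (s : Set (Fin m)) := by
    ext x
    simp only [Set.mem_range, Function.comp, Set.mem_image, Finset.mem_coe]
    constructor
    · rintro ⟨j, rfl⟩; exact ⟨e j, (e j).2, rfl⟩
    · rintro ⟨j, hj, rfl⟩; exact ⟨e.symm ⟨j, hj⟩, by simp⟩
  rw [hrange]
  by_contra htr
  have hi : i ∉ s := fun hi => htr (isAlgebraic_algebraMap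
    (R := Algebra.adjoin K (f '' (s : Set (Fin m))))
    (⟨f i, Algebra.subset_adjoin ⟨i, hi, rfl⟩⟩ : Algebra.adjoin K (f '' (s : Set (Fin m)))))
  have hins : AlgebraicIndepOn K f (insert i (s : Set (Fin m))) := AlgebraicIndepOn.insert hs' htr
  have hmem : insert i s ∈ Finset.univ.filter fun s : Finset (Fin m) =>
      AlgebraicIndependent K (fun i : s => f i) := by
    simp only [Finset.mem_filter, Finset.mem_univ, true_and]
    rw [← Finset.coe_insert] at hins
    exact hins
  have := Finset.le_sup (f := Finset.card) hmem
  rw [hmax, Finset.card_insert_of_notMem hi] at this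
  omega

/-- In a domain, a nonzero algebraic element divides a nonzero element of the base ring, the
constant term of a suitable equation. So `aeval f q` cannot be killed by a homomorphism that does
not kill `aeval g u`. -/
theorem exists_dvd_aeval_of_algebraic {n m s : ℕ} (f : Fin m → MvPolynomial (Fin n) K)
    (g : Fin s → MvPolynomial (Fin n) K)
    (halg : ∀ i, IsAlgebraic (Algebra.adjoin K (Set.range g)) (f i)) (q : MvPolynomial (Fin m) K)
    (hq : aeval f q ≠ 0) : ∃ u : MvPolynomial (Fin s) K, u ≠ 0 ∧ aeval f q ∣ aeval g u := by
  have h : ∀ q : MvPolynomial (Fin m) K,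
      IsAlgebraic (Algebra.adjoin K (Set.range g)) (aeval f q) := by
    intro q
    induction q using MvPolynomial.induction_on with
    | C a =>
      rw [aeval_C, IsScalarTower.algebraMap_apply K (Algebra.adjoin K (Set.range g))]
      exact isAlgebraic_algebraMap _
    | add p q hp hq =>
      rw [map_add]
      exact hp.add hq
    | mul_X p i hp =>
      rw [map_mul, aeval_X]
      exact hp.mul (halg i)
  obtain ⟨a, ha0, ha⟩ := (h q).exists_nonzero_dvd (mem_nonZeroDivisors_of_ne_zero hq)
  have hmem : (a : MvPolynomial (Fin n) K) ∈ (aeval g : MvPolynomial (Fin s) K →ₐ[K] _).range := by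
    rw [← Algebra.adjoin_range_eq_range_aeval]
    exact a.2
  obtain ⟨u, hu⟩ := hmem
  refine ⟨u, ?_, ?_⟩
  · rintro rfl
    rw [map_zero] at hu
    exact ha0 (Subtype.ext hu.symm)
  · change aeval g u = _ at hu
    rw [hu]
    exact ha

/-- A nonzero polynomial expression in sparse polynomials of low transcendence degree does not
vanish on the explicit set. -/
theorem exists_aeval_ne_zero {F : Type*} [Field F] [IsAlgClosed F] [Algebra K F]
    {n m d r δ ℓ : ℕ} (hn : 1 ≤ n) (hr : 1 ≤ r)
    (hδ : 1 ≤ δ) (hℓ : 1 ≤ ℓ) (hchar : ringChar K = 0 ∨ δ ^ r < ringChar K)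
    (H₁ H₂ : Finset F) (hH₁ : H₁.card = δ * r * pMax n r δ ℓ) (hH₂ : H₂.card = d + 1)
    (f : Fin m → MvPolynomial (Fin n) K) (hsp : ∀ i, (f i).support.card ≤ ℓ)
    (hdeg : ∀ i, (f i).totalDegree ≤ δ) (htr : trdeg K f ≤ r) (q : MvPolynomial (Fin m) K)
    (hd : (aeval f q).totalDegree ≤ d) (hne : aeval f q ≠ 0) :
    ∃ a ∈ hittingSet n r δ ℓ H₁ H₂, aeval a (aeval f q) ≠ 0 := by
  obtain ⟨sel, hind, halg⟩ := exists_trdeg_subfamily f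
  obtain ⟨u, hu0, hu⟩ := exists_dvd_aeval_of_algebraic f (f ∘ sel) halg q hne
  obtain ⟨p, hp1, hpM, hdet, hnd⟩ := exists_modulus_jacobianCurve hn hr hδ hℓ htr hchar (f ∘ sel)
    hind (fun i => hsp _) (fun i => hdeg _)
  set w : Fin n → ℕ := fun i => paramD n r δ ^ ((i : ℕ) + 1) % p with hw
  set J := jacobianCurve (f ∘ sel) w (fun k j => vandermondeExp n (trdeg K f) k j % p) with hJ
  -- A nonzero polynomial in `t` of degree below the size of `H₁` has a non-root there.
  obtain ⟨c, hc, hcJ⟩ : ∃ c ∈ H₁, Polynomial.aeval c J.det ≠ 0 := by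
    by_contra hcon
    push Not at hcon
    refine hdet ((Polynomial.map_eq_zero (algebraMap K F)).1
      (Polynomial.eq_zero_of_natDegree_lt_card_of_eval_eq_zero' _ H₁ (fun x hx => ?_) ?_))
    · rw [Polynomial.eval_map_algebraMap]; exact hcon x hx
    · rw [Polynomial.natDegree_map, hH₁]; exact hnd
  set L : Fin n → MvPolynomial (Fin (r + 1)) F :=
    fun i => psi F n r (paramD n r δ) 2 p c (X i) with hL
  have haeval : ∀ (a : Fin (r + 1) → F) (g : MvPolynomial (Fin n) K),
      eval a (aeval L g) = aeval (fun i => eval a (L i)) g := by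
    intro a g
    have : ((aeval a : MvPolynomial (Fin (r + 1)) F →ₐ[F] F).restrictScalars K).comp (aeval L) =
        aeval fun i => eval a (L i) := by
      refine algHom_ext fun i => ?_
      simp
    rw [← this]
    simp
  -- At `z = 0` only the first summand of `Ψ` remains, so the point lies on the curve `t ^ w`, at `t
  -- = c`.
  have heval : ∀ g : MvPolynomial (Fin n) K,
      eval (0 : Fin (r + 1) → F) (aeval L g) = Polynomial.aeval c (powSubst w g) := by
    intro g
    rw [haeval]
    have : (aeval fun i => eval (0 : Fin (r + 1) → F) (L i) : MvPolynomial (Fin n) K →ₐ[K] F) =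
        (Polynomial.aeval c).comp (powSubst w) := by
      refine algHom_ext fun i => ?_
      rw [aeval_X, AlgHom.comp_apply, powSubst, aeval_X, hL]
      simp only [eval_psi_X]
      simp [hw]
    rw [this, AlgHom.comp_apply]
  let κ : Fin (trdeg K f) → Fin (r + 1) := fun j => (Fin.castLE htr j).succ
  -- By the chain rule, the value of this minor at `z = 0` is `J.det` at `c`.
  have hJac : (Matrix.of fun i j => pderiv (κ j) (aeval L ((f ∘ sel) i))).det ≠ 0 := by
    intro h0
    refine hcJ ?_
    have h1 := congrArg (eval (0 : Fin (r + 1) → F)) h0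
    rw [RingHom.map_det, map_zero] at h1
    rw [AlgHom.map_det, ← h1]
    congr 1
    funext i j
    simp only [AlgHom.mapMatrix_apply, RingHom.mapMatrix_apply, Matrix.map_apply, Matrix.of_apply]
    rw [hJ, jacobianCurve_apply, map_sum, pderiv_aeval, map_sum]
    refine Finset.sum_congr rfl fun k _ => ?_
    rw [map_mul, map_mul, heval, hL, pderiv_psi_X]
    simp [vandermondeExp]
  have hindF : AlgebraicIndependent K fun i => aeval L ((f ∘ sel) i) :=
    (algebraicIndependent_of_jacobian _ κ hJac).restrictScalars (algebraMap K F).injective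
  -- If the image vanished, so would that of its multiple `u(g)`, a relation among the independent
  -- images of `g`.
  have hLne : aeval L (aeval f q) ≠ 0 := by
    intro h0
    obtain ⟨v, hv⟩ := hu
    have h1 : aeval (fun i => aeval L ((f ∘ sel) i)) u = 0 := by
      have h2 := congrArg (aeval L) hv
      rw [map_mul, h0, zero_mul] at h2
      rw [← h2, ← AlgHom.comp_apply, comp_aeval]
    exact hu0 (algebraicIndependent_iff.1 hindF u h1)
  obtain ⟨a, ha, hane⟩ : ∃ a : Fin (r + 1) → F, (∀ j, a j ∈ H₂) ∧
      eval a (aeval L (aeval f q)) ≠ 0 := by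
    by_contra hcon
    push Not at hcon
    refine hLne (eq_zero_of_eval_zero_at_prod_finset _ (fun _ => H₂) (fun i => ?_) hcon)
    rw [hH₂]
    exact Nat.lt_succ_of_le ((degreeOf_le_totalDegree _ _).trans
      ((totalDegree_aeval_le L (fun i => totalDegree_psi_X_le c i) _).trans hd))
  exact ⟨fun i => eval a (L i), ⟨p, hp1, hpM, c, hc, a, ha, rfl⟩, haeval a _ ▸ hane⟩

theorem isHittingSet_hittingSet {n d r δ ℓ : ℕ} (hn : 1 ≤ n) (hr : 1 ≤ r)
    (hδ : 1 ≤ δ) (hℓ : 1 ≤ ℓ) (hchar : ringChar K = 0 ∨ δ ^ r < ringChar K)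
    (H₁ H₂ : Finset (AlgebraicClosure K)) (hH₁ : H₁.card = δ * r * pMax n r δ ℓ)
    (hH₂ : H₂.card = d + 1) :
    IsHittingSet (hittingSet n r δ ℓ H₁ H₂) (sparseInputCircuits K n d r δ ℓ) := by
  rintro C' ⟨hd, m, C, f, hsp, hdeg, htr, hC'⟩ hne
  rw [hC'] at hd hne ⊢
  exact exists_aeval_ne_zero hn hr hδ hℓ hchar H₁ H₂ hH₁ hH₂ f hsp hdeg htr C.poly hd hne

end HittingSet

/-! ### Rules for symbolic execution with a uniform cost per step. -/

section Machine

variable {n : ℕ}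

variable {F : Type u} {M : ℕ}

/-- A state whose registers are given by a list. -/
def mkState (l : List ℕ) (m : ℕ → ℕ → F) (o : List (Fin n → F)) : State F n where
  reg x := l.getD x 0
  mem := m
  out := o

/-- A memory with four arrays. -/
def arrays [Zero F] (A₀ A₁ A₂ A₃ : ℕ → F) : ℕ → ℕ → F
  | 0 => A₀
  | 1 => A₁
  | 2 => A₂
  | 3 => A₃
  | _ => fun _ => 0

theorem update_arrays_two [Zero F] (A₀ A₁ A₂ A₃ B : ℕ → F) :
    Function.update (arrays A₀ A₁ A₂ A₃) 2 B = arrays A₀ A₁ B A₃ := by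
  funext v
  match v with
  | 0 | 1 | 2 | 3 | _ + 4 => rfl

theorem update_arrays_three [Zero F] (A₀ A₁ A₂ A₃ B : ℕ → F) :
    Function.update (arrays A₀ A₁ A₂ A₃) 3 B = arrays A₀ A₁ A₂ B := by
  funext v
  match v with
  | 0 | 1 | 2 | 3 | _ + 4 => rfl

/-- Thirty-one registers with contents at most `M`. -/
def BoundedRegs (M : ℕ) (l : List ℕ) : Prop := l.length = 31 ∧ ∀ v ∈ l, v ≤ M

theorem BoundedRegs.getD_le {l : List ℕ} (hl : BoundedRegs M l) (x : ℕ) : l.getD x 0 ≤ M := by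
  by_cases h : x < l.length
  · rw [List.getD_eq_getElem _ _ h]
    exact hl.2 _ (List.getElem_mem h)
  · rw [List.getD_eq_default _ _ (not_lt.1 h)]
    exact Nat.zero_le _

theorem BoundedRegs.set {l : List ℕ} (hl : BoundedRegs M l) (x : ℕ) {v : ℕ} (hv : v ≤ M) :
    BoundedRegs M (l.set x v) := by
  refine ⟨by rw [List.length_set]; exact hl.1, fun w hw => ?_⟩
  rcases List.mem_or_eq_of_mem_set hw with h | rfl
  · exact hl.2 _ h
  · exact hv

theorem getD_set_self {l : List ℕ} (hl : l.length = 31) {x v : ℕ} (hx : x < 31) :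
    (l.set x v).getD x 0 = v := by
  rw [List.getD_eq_getElem _ _ (by rw [List.length_set, hl]; exact hx), List.getElem_set_self]

theorem getD_set_ne {l : List ℕ} {x y v : ℕ} (h : x ≠ y) :
    (l.set x v).getD y 0 = l.getD y 0 := by
  rw [List.getD_eq_getElem?_getD, List.getD_eq_getElem?_getD, List.getElem?_set_ne h]

/-- A crude estimate of bit lengths; it affects only the degree of the final time bound. -/
theorem natSize_le_self (a : ℕ) : a.size ≤ a := Nat.size_le.2 Nat.lt_two_pow_self

theorem mkState_setReg {l : List ℕ} (hl : l.length = 31) {x : ℕ} (hx : x < 31) (v : ℕ)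
    (m : ℕ → ℕ → F) (o : List (Fin n → F)) :
    (mkState l m o).setReg x v = mkState (l.set x v) m o := by
  simp only [mkState, State.setReg, State.mk.injEq, and_true]
  funext y
  by_cases h : y = x
  · subst h
    rw [Function.update_self, getD_set_self hl hx]
  · rw [Function.update_of_ne h, getD_set_ne (Ne.symm h)]

variable [Field F]

/-- The program `P`, started in `s`, halts within `k` steps of cost at most `U` in a state that
satisfies `R`. -/
def RunsWithin (O : (Fin n → F) → F) (q U : ℕ) (P : Prog) (k : ℕ) (R : State F n → Prop)
    (s : State F n) : Prop :=
  ∃ s' t, Exec O q P s s' t ∧ t ≤ k * U ∧ R s'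

variable {O : (Fin n → F) → F} {q U : ℕ}

theorem RunsWithin.mono {P : Prog} {k k' : ℕ} {R R' : State F n → Prop} {s : State F n}
    (h : RunsWithin O q U P k R s) (hk : k ≤ k') (hR : ∀ s', R s' → R' s') :
    RunsWithin O q U P k' R' s := by
  obtain ⟨s', t, he, ht, hs⟩ := h
  exact ⟨s', t, he, ht.trans (Nat.mul_le_mul_right _ hk), hR _ hs⟩

theorem RunsWithin.seq {P Q : Prog} {k k' : ℕ} {R : State F n → Prop} {s : State F n}
    (h : RunsWithin O q U P k (fun s' => RunsWithin O q U Q k' R s') s) :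
    RunsWithin O q U (.seq P Q) (k + k') R s := by
  obtain ⟨s₁, t₁, he₁, ht₁, s₂, t₂, he₂, ht₂, hs⟩ := h
  exact ⟨s₂, t₁ + t₂, .seq he₁ he₂, by rw [add_mul]; omega, hs⟩

/-- The invariant is indexed by the number of remaining rounds, so the loop need not count down in a
register; the computation of the logarithm uses this generality. -/
theorem RunsWithin.while {x k : ℕ} {P : Prog} (I : ℕ → State F n → Prop)
    (hx : ∀ m s, I m s → 1 + (s.reg x).size ≤ U) (h0 : ∀ s, I 0 s → s.reg x = 0)
    (hstep : ∀ m s, I (m + 1) s → s.reg x ≠ 0 ∧ RunsWithin O q U P k (I m) s) (N : ℕ)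
    (s : State F n) (hs : I N s) : RunsWithin O q U (.loop x P) (N * (k + 1) + 1) (I 0) s := by
  induction N generalizing s with
  | zero =>
    refine ⟨s, 1, .loop_zero (h0 s hs), ?_, hs⟩
    have := hx 0 s hs
    rw [zero_mul, zero_add, one_mul]; omega
  | succ N ih =>
    obtain ⟨hne, s₁, t₁, he₁, ht₁, hs₁⟩ := hstep N s hs
    obtain ⟨s₂, t₂, he₂, ht₂, hs₂⟩ := ih s₁ hs₁
    refine ⟨s₂, _, .loop_ne_zero hne he₁ he₂, ?_, hs₂⟩
    have h1 := hx _ s hs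
    calc 1 + (s.reg x).size + t₁ + t₂ ≤ U + k * U + (N * (k + 1) + 1) * U := by omega
      _ = ((N + 1) * (k + 1) + 1) * U := by ring

/-- This rule and its analogues take the claim about the updated state as a premise, so that a
straight-line program is verified by following it forward. The unit cost `1 + 3 * M + n + q` covers
the three addresses of a field operation as well as an oracle query. -/
theorem runsWithin_natConst (hU : 1 + 3 * M + n + q ≤ U)
    {l : List ℕ} {m : ℕ → ℕ → F}
    {o : List (Fin n → F)} {x k : ℕ}
    {R : State F n → Prop} (hl : BoundedRegs M l) (hx : x < 31) (hk : k ≤ M)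
    (h : R (mkState (l.set x k) m o)) :
    RunsWithin O q U (.natConst x k) 1 R (mkState l m o) := by
  refine ⟨_, _, .natConst _ _ _, ?_, by rwa [mkState_setReg hl.1 hx]⟩
  have := natSize_le_self k
  omega

theorem runsWithin_natOp (hU : 1 + 3 * M + n + q ≤ U)
    {l : List ℕ} {m : ℕ → ℕ → F} {o : List (Fin n → F)} {op : NatOp}
    {x y z v : ℕ} {R : State F n → Prop} (hl : BoundedRegs M l) (hx : x < 31)
    (hv : op.apply (l.getD y 0) (l.getD z 0) = v) (h : R (mkState (l.set x v) m o)) :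
    RunsWithin O q U (.natOp op x y z) 1 R (mkState l m o) := by
  refine ⟨_, _, .natOp _ _ _ _ _, ?_, by
    rw [mkState_setReg hl.1 hx]
    change R (mkState (l.set x (op.apply (l.getD y 0) (l.getD z 0))) m o)
    rwa [hv]⟩
  have h1 := (natSize_le_self (l.getD y 0)).trans (hl.getD_le y)
  have h2 := (natSize_le_self (l.getD z 0)).trans (hl.getD_le z)
  change 1 + (l.getD y 0).size + (l.getD z 0).size ≤ _
  omega

theorem runsWithin_fieldZero (hU : 1 + 3 * M + n + q ≤ U)
    {l : List ℕ} {m m' : ℕ → ℕ → F} {o : List (Fin n → F)}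
    {a : Ref}
    {R : State F n → Prop} (hl : BoundedRegs M l)
    (hm : Function.update m a.arr (Function.update (m a.arr) (l.getD a.idx 0) 0) = m')
    (h : R (mkState l m' o)) :
    RunsWithin O q U (.fieldZero a) 1 R (mkState l m o) := by
  refine ⟨_, _, .fieldZero _ _, ?_, by subst hm; exact h⟩
  have h1 := (natSize_le_self (l.getD a.idx 0)).trans (hl.getD_le a.idx)
  change 1 + (l.getD a.idx 0).size ≤ _
  omega

theorem runsWithin_fieldOne (hU : 1 + 3 * M + n + q ≤ U)
    {l : List ℕ} {m m' : ℕ → ℕ → F} {o : List (Fin n → F)}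
    {a : Ref}
    {R : State F n → Prop} (hl : BoundedRegs M l)
    (hm : Function.update m a.arr (Function.update (m a.arr) (l.getD a.idx 0) 1) = m')
    (h : R (mkState l m' o)) :
    RunsWithin O q U (.fieldOne a) 1 R (mkState l m o) := by
  refine ⟨_, _, .fieldOne _ _, ?_, by subst hm; exact h⟩
  have h1 := (natSize_le_self (l.getD a.idx 0)).trans (hl.getD_le a.idx)
  change 1 + (l.getD a.idx 0).size ≤ _
  omega

theorem runsWithin_fieldOp (hU : 1 + 3 * M + n + q ≤ U)
    {l : List ℕ} {m m' : ℕ → ℕ → F} {o : List (Fin n → F)}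
    {op : FieldOp}
    {a b c : Ref} {R : State F n → Prop} (hl : BoundedRegs M l)
    (hm : Function.update m a.arr (Function.update (m a.arr) (l.getD a.idx 0)
      (op.apply (m b.arr (l.getD b.idx 0)) (m c.arr (l.getD c.idx 0)))) = m')
    (h : R (mkState l m' o)) :
    RunsWithin O q U (.fieldOp op a b c) 1 R (mkState l m o) := by
  refine ⟨_, _, .fieldOp _ _ _ _ _, ?_, by subst hm; exact h⟩
  have h1 := (natSize_le_self (l.getD a.idx 0)).trans (hl.getD_le a.idx)
  have h2 := (natSize_le_self (l.getD b.idx 0)).trans (hl.getD_le b.idx)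
  have h3 := (natSize_le_self (l.getD c.idx 0)).trans (hl.getD_le c.idx)
  change 1 + (l.getD a.idx 0).size + (l.getD b.idx 0).size + (l.getD c.idx 0).size ≤ _
  omega

theorem runsWithin_emit (hU : 1 + 3 * M + n + q ≤ U)
    {l : List ℕ} {m : ℕ → ℕ → F} {o : List (Fin n → F)} {v : ℕ}
    {R : State F n → Prop} (h : R (mkState l m (o ++ [fun i : Fin n => m v i]))) :
    RunsWithin O q U (.emit v) 1 R (mkState l m o) :=
  ⟨_, _, .emit _ _, by omega, h⟩

theorem runsWithin_query (hU : 1 + 3 * M + n + q ≤ U)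
    {l : List ℕ} {m m' : ℕ → ℕ → F} {o : List (Fin n → F)}
    {v : ℕ} {a : Ref}
    {R : State F n → Prop} (hl : BoundedRegs M l)
    (hm : Function.update m a.arr (Function.update (m a.arr) (l.getD a.idx 0)
      (O fun i => m v i)) = m')
    (h : R (mkState l m' o)) :
    RunsWithin O q U (.query v a) 1 R (mkState l m o) := by
  refine ⟨_, _, .query _ _ _, ?_, by subst hm; exact h⟩
  have h1 := (natSize_le_self (l.getD a.idx 0)).trans (hl.getD_le a.idx)
  change 1 + n + q + (l.getD a.idx 0).size ≤ _
  omega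

theorem runsWithin_ifField (hU : 1 + 3 * M + n + q ≤ U)
    {l : List ℕ} {m : ℕ → ℕ → F} {o : List (Fin n → F)} {a : Ref}
    {P Q : Prog} {k : ℕ} {R : State F n → Prop} (hl : BoundedRegs M l)
    (h0 : m a.arr (l.getD a.idx 0) = 0 → RunsWithin O q U P k R (mkState l m o))
    (h1 : m a.arr (l.getD a.idx 0) ≠ 0 → RunsWithin O q U Q k R (mkState l m o)) :
    RunsWithin O q U (.ifField a P Q) (k + 1) R (mkState l m o) := by
  have h2 := (natSize_le_self (l.getD a.idx 0)).trans (hl.getD_le a.idx)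
  by_cases h : m a.arr (l.getD a.idx 0) = 0
  · obtain ⟨s', t, he, ht, hs⟩ := h0 h
    refine ⟨s', _, .ifField_zero h he, ?_, hs⟩
    change 1 + (l.getD a.idx 0).size + t ≤ _
    rw [add_mul]; omega
  · obtain ⟨s', t, he, ht, hs⟩ := h1 h
    refine ⟨s', _, .ifField_ne_zero h he, ?_, hs⟩
    change 1 + (l.getD a.idx 0).size + t ≤ _
    rw [add_mul]; omega

/-- A loop whose counter, in register `x`, is decreased by `1` in each round. -/
theorem runsWithin_for (hU : 1 + 3 * M + n + q ≤ U)
    {x k : ℕ} {P : Prog}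
    (I : ℕ → List ℕ → (ℕ → ℕ → F) → List (Fin n → F) → Prop)
    (hI : ∀ j l m o, I j l m o → BoundedRegs M l ∧ l.getD x 0 = j)
    (hstep : ∀ j l m o, I (j + 1) l m o →
      RunsWithin O q U P k (fun s => ∃ l m o, s = mkState l m o ∧ I j l m o) (mkState l m o))
    (N : ℕ) {l : List ℕ} {m : ℕ → ℕ → F} {o : List (Fin n → F)} (h : I N l m o) :
    RunsWithin O q U (.loop x P) (N * (k + 1) + 1)
      (fun s => ∃ l m o, s = mkState l m o ∧ I 0 l m o) (mkState l m o) := by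
  refine RunsWithin.while (fun j s => ∃ l m o, s = mkState l m o ∧ I j l m o) ?_ ?_ ?_ N _
    ⟨l, m, o, rfl, h⟩
  · rintro j _ ⟨l, m, o, rfl, h⟩
    have := (natSize_le_self (l.getD x 0)).trans ((hI j l m o h).1.getD_le x)
    change 1 + (l.getD x 0).size ≤ U
    omega
  · rintro _ ⟨l, m, o, rfl, h⟩
    exact (hI _ _ _ _ h).2
  · rintro j _ ⟨l, m, o, rfl, h⟩
    refine ⟨?_, hstep j l m o h⟩
    change l.getD x 0 ≠ 0
    rw [(hI _ _ _ _ h).2]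
    exact Nat.succ_ne_zero j

end Machine

/-! ### The programs. -/

section Programs

/-- Consecutive execution of a list of programs. -/
def block : List Prog → Prog
  -- Register `30` is scratch: it is written but never read.
  | [] => .natConst 30 0
  | [P] => P
  | P :: Q :: Ps => .seq P (block (Q :: Ps))

/-- Registers: `0, …, 4` hold the input, `5` holds `0`, `6` holds `1`. The field element in array
`0` at the address in register `15` is raised to the power in register `src`; the result is at the
address `0` of array `3`. -/
def fieldPow (src : ℕ) : Prog :=
  block [.fieldOne ⟨3, 5⟩, .natOp .add 27 src 5,
    .loop 27 (block [.fieldOp .mul ⟨3, 5⟩ ⟨3, 5⟩ ⟨0, 15⟩, .natOp .sub 27 27 6])]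

/-- `R_dst := R_base ^ R_exp`, with the counter in register `13`. -/
def natPow (dst base exp : ℕ) : Prog :=
  block [.natConst dst 1, .natOp .add 13 exp 5,
    .loop 13 (block [.natOp .mul dst dst base, .natOp .sub 13 13 6])]

/-- Adds one summand to the coordinate that is being computed. -/
def termProg : Prog :=
  -- Register `26` receives the next digit of `e` to the base `d + 1`, an address in array `1`.
  -- Registers `22` and `23` hold `(i + 1) * (n + 1) ^ k` and the current exponent of `c`.
  block [.natOp .mod 26 24 11, .natOp .div 24 24 11, fieldPow 23,
    .fieldOp .mul ⟨3, 5⟩ ⟨3, 5⟩ ⟨1, 26⟩, .fieldOp .add ⟨2, 18⟩ ⟨2, 18⟩ ⟨3, 5⟩,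
    .natOp .mul 22 22 12, .natOp .mod 23 22 13, .natOp .sub 25 25 6]

/-- Computes one coordinate of a point. -/
def coordProg : Prog :=
  block [.natOp .mul 20 20 7, .natOp .mod 20 20 13, .natOp .add 21 21 21, .natOp .mod 21 21 13,
    fieldPow 20, .fieldZero ⟨2, 18⟩, .fieldOp .add ⟨2, 18⟩ ⟨2, 18⟩ ⟨3, 5⟩,
    .natOp .add 22 18 6, .natOp .add 23 21 5, .natOp .add 24 17 5, .natOp .add 25 28 5,
    .loop 25 termProg, .natOp .add 18 18 6, .natOp .sub 19 19 6]

/-- Computes a point of the explicit set in array `2`. -/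
def pointProg : Prog :=
  -- Registers `20` and `21` start with the zeroth powers of `D₁` and `2` modulo `p`, that is `1 %
  -- p`, which is `0` for `p = 1`.
  block [.natOp .mod 20 6 13, .natOp .mod 21 6 13, .natConst 18 0, .natOp .add 19 0 5,
    .loop 19 coordProg]

/-- Runs `body` on the points of the explicit set that belong to a given modulus and base. -/
def pointLoop (body : Prog) : Prog :=
  .loop 16 (block [.natOp .sub 17 16 6, pointProg, body, .natOp .sub 16 16 6])

/-- Runs `body` on the points of the explicit set that belong to a given modulus. -/
def baseLoop (body : Prog) : Prog :=
  .loop 14 (block [.natOp .sub 15 14 6, .natOp .add 16 10 5, pointLoop body, .natOp .sub 14 14 6])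

/-- Runs `body` on all points of the explicit set. -/
def enumProg (body : Prog) : Prog :=
  block [.natOp .add 13 8 5,
    .loop 13 (block [.natOp .add 14 9 5, baseLoop body, .natOp .sub 13 13 6])]

/-- Computes `D₁` in register `7`. -/
def setupParamD : Prog :=
  block [.natConst 6 1, .natOp .add 28 2 6, .natOp .add 11 1 6, .natOp .add 12 0 6,
    .natOp .add 14 0 0, .natOp .mul 15 14 3, natPow 7 15 28]

/-- Computes the first factor of `p_max - 1` in register `8`. -/
def setupPow : Prog :=
  block [.natOp .mul 15 14 2, .natOp .mul 15 15 4, .natOp .add 16 28 28, natPow 8 15 16]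

/-- Computes `⌈log₂ D₁⌉` in register `18`. -/
def setupClog : Prog :=
  block [.natConst 17 1, .natConst 18 0, .natOp .sub 19 7 17,
    .loop 19 (block [.natOp .add 17 17 17, .natOp .add 18 18 6, .natOp .sub 19 7 17])]

/-- Computes `p_max` and the numbers of bases and of digit sequences. -/
def setupCounts : Prog :=
  block [.natOp .mul 18 18 18, .natOp .mul 8 8 18, .natOp .add 8 8 6,
    .natOp .mul 9 3 2, .natOp .mul 9 9 8, natPow 10 11 28]

/-- Computes the parameters from the input. -/
def setupProg : Prog :=
  block [setupParamD, setupPow, setupClog, setupCounts]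

end Programs

/-! ### Correctness of the power routines. -/

section PowerSpecs

variable {F : Type u} [Field F] {n : ℕ} {O : (Fin n → F) → F} {q U M : ℕ}

theorem fieldPow_spec (hU : 1 + 3 * M + n + q ≤ U) {l : List ℕ} (hl : BoundedRegs M l)
    (h5 : l.getD 5 0 = 0) (h6 : l.getD 6 0 = 1) {src e : ℕ} (he : l.getD src 0 = e)
    {A₀ A₁ A₂ A₃ : ℕ → F} {o : List (Fin n → F)} {R : State F n → Prop}
    (h : R (mkState (l.set 27 0)
      (arrays A₀ A₁ A₂ (Function.update A₃ 0 (A₀ (l.getD 15 0) ^ e))) o)) :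
    RunsWithin O q U (fieldPow src) (3 * M + 3) R (mkState l (arrays A₀ A₁ A₂ A₃) o) := by
  have heM : e ≤ M := he ▸ hl.getD_le src
  simp only [fieldPow, block]
  apply RunsWithin.mono (R := R) (k := 1 + (1 + (e * (1 + 1 + 1) + 1))) _ (by omega) (fun _ h => h)
  refine .seq (runsWithin_fieldOne hU hl (m' := arrays A₀ A₁ A₂ (Function.update A₃ 0 1))
    (by rw [h5, update_arrays_three]; rfl) ?_)
  refine .seq (runsWithin_natOp hU hl (v := e) (by norm_num)
    (by rw [h5, he]; exact Nat.add_zero e) ?_)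
  refine (runsWithin_for hU (fun j l' m o' => j ≤ e ∧ l' = l.set 27 j ∧
    m = arrays A₀ A₁ A₂ (Function.update A₃ 0 (A₀ (l.getD 15 0) ^ (e - j))) ∧ o' = o) ?_ ?_ e
    ⟨le_rfl, rfl, by simp, rfl⟩).mono le_rfl ?_
  · rintro j l' m o' ⟨hj, rfl, -, -⟩
    exact ⟨hl.set 27 (hj.trans heM), getD_set_self hl.1 (by norm_num)⟩
  · rintro j l' m o' ⟨hj, rfl, rfl, rfl⟩
    have hl' := hl.set 27 (hj.trans heM)
    refine .seq (runsWithin_fieldOp hU hl'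
      (m' := arrays A₀ A₁ A₂ (Function.update A₃ 0 (A₀ (l.getD 15 0) ^ (e - j)))) ?_ ?_)
    · rw [getD_set_ne (by norm_num), getD_set_ne (by norm_num), h5, update_arrays_three]
      simp only [arrays, FieldOp.apply, Function.update_self, Function.update_idem]
      rw [← pow_succ, show e - (j + 1) + 1 = e - j by omega]
    · refine runsWithin_natOp hU hl' (v := j) (by norm_num) ?_ ?_
      · rw [getD_set_self hl.1 (by norm_num), getD_set_ne (by norm_num), h6]
        rfl
      · exact ⟨_, _, _, rfl, by omega, by rw [List.set_set], rfl, rfl⟩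
  · rintro _ ⟨l', m, o', rfl, -, rfl, rfl, rfl⟩
    exact h

/-- All intermediate powers have to fit into registers; for `b = 0` the bound at `e` alone would say
nothing about `b ^ 0`. -/
theorem natPow_spec (hU : 1 + 3 * M + n + q ≤ U) {l : List ℕ} (hl : BoundedRegs M l)
    (h5 : l.getD 5 0 = 0) (h6 : l.getD 6 0 = 1) {dst base exp b e : ℕ} (hdst : dst < 31)
    (hd5 : dst ≠ 5) (hd6 : dst ≠ 6) (hdb : dst ≠ base) (hde : dst ≠ exp) (hd : dst ≠ 13)
    (hb : 13 ≠ base) (hlb : l.getD base 0 = b) (hle : l.getD exp 0 = e)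
    (hM : ∀ j ≤ e, b ^ j ≤ M) {m : ℕ → ℕ → F} {o : List (Fin n → F)} {R : State F n → Prop}
    (h : R (mkState ((l.set dst (b ^ e)).set 13 0) m o)) :
    RunsWithin O q U (natPow dst base exp) (3 * M + 3) R (mkState l m o) := by
  have heM : e ≤ M := hle ▸ hl.getD_le exp
  have h1 : 1 ≤ M := by simpa using hM 0 (Nat.zero_le _)
  simp only [natPow, block]
  apply RunsWithin.mono (R := R) (k := 1 + (1 + (e * (1 + 1 + 1) + 1))) _ (by omega) (fun _ h => h)
  refine .seq (runsWithin_natConst hU hl hdst h1 ?_)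
  have hl1 := hl.set dst h1
  refine .seq (runsWithin_natOp hU hl1 (v := e) (by norm_num)
    (by rw [getD_set_ne hde, getD_set_ne hd5, h5, hle]; exact Nat.add_zero e) ?_)
  refine (runsWithin_for hU (fun j l' m' o' => j ≤ e ∧ l' = (l.set dst (b ^ (e - j))).set 13 j ∧
    m' = m ∧ o' = o) ?_ ?_ e ⟨le_rfl, by simp, rfl, rfl⟩).mono le_rfl ?_
  · rintro j l' m o' ⟨hj, rfl, -, -⟩
    exact ⟨(hl.set dst (hM _ (Nat.sub_le _ _))).set 13 (hj.trans heM),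
      getD_set_self (by rw [List.length_set, hl.1]) (by norm_num)⟩
  · rintro j l' m' o' ⟨hj, rfl, rfl, rfl⟩
    have hl2 := hl.set dst (hM (e - (j + 1)) (Nat.sub_le _ _))
    have hl3 := hl2.set 13 (hj.trans heM)
    have hl4 := hl3.set dst (hM (e - j) (Nat.sub_le _ _))
    refine .seq (runsWithin_natOp hU hl3 (v := b ^ (e - j)) hdst ?_ ?_)
    · rw [getD_set_ne hd.symm, getD_set_ne hb, getD_set_self hl.1 hdst, getD_set_ne hdb, hlb]
      change _ * _ = _
      rw [← pow_succ, show e - (j + 1) + 1 = e - j by omega]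
    · refine runsWithin_natOp hU hl4 (v := j) (by norm_num) ?_ ?_
      · rw [getD_set_ne hd, getD_set_self hl2.1 (by norm_num), getD_set_ne hd6,
          getD_set_ne (by norm_num), getD_set_ne hd6, h6]
        rfl
      · refine ⟨_, _, _, rfl, by omega, ?_, rfl, rfl⟩
        rw [List.set_comm _ _ hd.symm, List.set_set, List.set_set]
  · rintro _ ⟨l', m, o', rfl, -, rfl, rfl, rfl⟩
    exact h

end PowerSpecs

/-! ### Correctness of the computation of one point. -/

section Point

variable {F : Type u} [Field F]

/-- The exponent of `c` in the coefficient of `z_j` in `Ψ(x_{i + 1})`, where `tm` is the one of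
`z_0`. -/
def coeffExp (n p i tm : ℕ) : ℕ → ℕ
  | 0 => tm
  | j + 1 => ((i + 1) * (n + 1) ^ (j + 1)) % p

/-- The partial sums of `Ψ(x_{i + 1})(a)`, with `a` given by the digits of `e` to the base `d + 1`
as addresses in the array `A`. -/
def partialCoord (n d p i dm tm e : ℕ) (c : F) (A : ℕ → F) (k : ℕ) : F :=
  c ^ dm + ∑ j ∈ Finset.range k, c ^ coeffExp n p i tm j * A (e / (d + 1) ^ j % (d + 1))

/-- The coordinates of a point of the explicit set. -/
def pointCoord (n d r D p : ℕ) (c : F) (A : ℕ → F) (e i : ℕ) : F :=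
  partialCoord n d p i (D ^ (i + 1) % p) (2 ^ (i + 1) % p) e c A (r + 1)

/-- The contents of the registers. -/
abbrev mainRegs (n d r δ ℓ D PM H E p x ci y e i x₁ dm tm w ex ev x₂ dg yf φ z : ℕ) : List ℕ :=
  [n, d, r, δ, ℓ, 0, 1, D, PM, H, E, d + 1, n + 1, p, x, ci, y, e, i, x₁, dm, tm, w, ex, ev, x₂, dg,
    yf, r + 1, φ, z]

variable {n : ℕ} {O : (Fin n → F) → F} {q U M : ℕ}
  {d r δ ℓ D PM H E p x ci y e i x₁ dm tm w ex ev x₂ dg yf φ z : ℕ}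
  {A₀ A₁ A₂ A₃ : ℕ → F} {o : List (Fin n → F)}

/-- After `k` rounds the coordinate is the partial sum of length `k`, and the registers hold the
data of summand `k`. The case `k = 0` is the coefficient of `z_0`, whose exponent is supplied from
outside. -/
theorem termLoop_spec (hU : 1 + 3 * M + n + q ≤ U) (hi : i < n) (hnM : (n + 1) ^ (r + 2) ≤ M)
    {R : State F n → Prop}
    (hl : BoundedRegs M (mainRegs n d r δ ℓ D PM H E p x ci y e i x₁ dm tm (i + 1) tm e (r + 1) dg yf
      φ z))
    (h : ∀ w ex ev dg yf A₃, BoundedRegs M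
        (mainRegs n d r δ ℓ D PM H E p x ci y e i x₁ dm tm w ex ev 0 dg yf φ z) →
      R (mkState (mainRegs n d r δ ℓ D PM H E p x ci y e i x₁ dm tm w ex ev 0 dg yf φ z)
        (arrays A₀ A₁ (Function.update A₂ i
          (partialCoord n d p i dm tm e (A₀ ci) A₁ (r + 1))) A₃) o)) :
    RunsWithin O q U (.loop 25 termProg) ((r + 1) * (3 * M + 11) + 1) R
      (mkState (mainRegs n d r δ ℓ D PM H E p x ci y e i x₁ dm tm (i + 1) tm e (r + 1) dg yf φ z)
        (arrays A₀ A₁ (Function.update A₂ i (A₀ ci ^ dm)) A₃) o) := by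
  refine (runsWithin_for hU (k := 3 * M + 10) (fun j l m o' => ∃ k, k + j = r + 1 ∧
    ∃ dg yf A₃, l = mainRegs n d r δ ℓ D PM H E p x ci y e i x₁ dm tm ((i + 1) * (n + 1) ^ k)
      (coeffExp n p i tm k) (e / (d + 1) ^ k) j dg yf φ z ∧ BoundedRegs M l ∧
    m = arrays A₀ A₁ (Function.update A₂ i (partialCoord n d p i dm tm e (A₀ ci) A₁ k)) A₃ ∧
    o' = o) ?_ ?_ (r + 1) ?_).mono le_rfl ?_
  · rintro j l m o' ⟨k, -, dg, yf, A₃, rfl, hb, -⟩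
    exact ⟨hb, rfl⟩
  · rintro j l m o' ⟨k, hk, dg, yf, A₃, rfl, hb, rfl, rfl⟩
    have hev : e / (d + 1) ^ k ≤ M := hb.getD_le 24
    have hjM : j + 1 ≤ M := hb.getD_le 25
    -- The multiplication also takes place after the last summand, hence the exponent `r + 2` in the
    -- bound.
    have hw : (i + 1) * (n + 1) ^ (k + 1) ≤ M := by
      calc (i + 1) * (n + 1) ^ (k + 1) ≤ (n + 1) * (n + 1) ^ (r + 1) :=
            Nat.mul_le_mul (by omega) (Nat.pow_le_pow_right (by omega) (by omega))
        _ = (n + 1) ^ (r + 2) := by ring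
        _ ≤ M := hnM
    simp only [termProg, block]
    apply RunsWithin.mono (k := 1 + (1 + ((3 * M + 3) + (1 + (1 + (1 + (1 + 1))))))) _ (by omega)
      (fun _ h => h)
    refine .seq (runsWithin_natOp hU hb (v := e / (d + 1) ^ k % (d + 1)) (by norm_num) rfl ?_)
    have hb := hb.set 26 (v := e / (d + 1) ^ k % (d + 1)) ((Nat.mod_le _ _).trans hev)
    refine .seq (runsWithin_natOp hU hb (v := e / (d + 1) ^ (k + 1)) (by norm_num)
      (show e / (d + 1) ^ k / (d + 1) = _ by rw [pow_succ, Nat.div_div_eq_div_mul]) ?_)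
    have hb := hb.set 24 (v := e / (d + 1) ^ (k + 1)) ((Nat.div_le_div_left
      (Nat.pow_le_pow_right (by omega) (by omega)) (by positivity)).trans hev)
    refine .seq (fieldPow_spec hU hb rfl rfl (e := coeffExp n p i tm k) rfl ?_)
    have hb := hb.set 27 (Nat.zero_le M)
    refine .seq (runsWithin_fieldOp hU hb (m' := arrays A₀ A₁
      (Function.update A₂ i (partialCoord n d p i dm tm e (A₀ ci) A₁ k))
      (Function.update A₃ 0 (A₀ ci ^ coeffExp n p i tm k * A₁ (e / (d + 1) ^ k % (d + 1))))) ?_ ?_)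
    · refine (update_arrays_three _ _ _ _ _).trans (congrArg _ ?_)
      refine (Function.update_idem _ _ _).trans (congrArg (Function.update A₃ 0) ?_)
      change Function.update A₃ 0 (A₀ ci ^ coeffExp n p i tm k) 0 *
        A₁ (e / (d + 1) ^ k % (d + 1)) = _
      rw [Function.update_self]
    refine .seq (runsWithin_fieldOp hU hb (m' := arrays A₀ A₁
      (Function.update A₂ i (partialCoord n d p i dm tm e (A₀ ci) A₁ (k + 1)))
      (Function.update A₃ 0 (A₀ ci ^ coeffExp n p i tm k * A₁ (e / (d + 1) ^ k % (d + 1))))) ?_ ?_)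
    · refine (update_arrays_two _ _ _ _ _).trans (congrArg (arrays A₀ A₁ · _) ?_)
      refine (Function.update_idem _ _ _).trans (congrArg (Function.update A₂ i) ?_)
      change Function.update A₂ i (partialCoord n d p i dm tm e (A₀ ci) A₁ k) i +
        Function.update A₃ 0 (A₀ ci ^ coeffExp n p i tm k * A₁ (e / (d + 1) ^ k % (d + 1))) 0 = _
      rw [Function.update_self, Function.update_self]
      simp only [partialCoord]
      rw [Finset.sum_range_succ, ← add_assoc]
    refine .seq (runsWithin_natOp hU hb (v := (i + 1) * (n + 1) ^ (k + 1)) (by norm_num)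
      (show (i + 1) * (n + 1) ^ k * (n + 1) = _ by rw [pow_succ, mul_assoc]) ?_)
    have hb := hb.set 22 (v := (i + 1) * (n + 1) ^ (k + 1)) hw
    refine .seq (runsWithin_natOp hU hb (v := coeffExp n p i tm (k + 1)) (by norm_num) rfl ?_)
    have hb := hb.set 23 (v := coeffExp n p i tm (k + 1)) ((Nat.mod_le _ _).trans hw)
    refine runsWithin_natOp hU hb (v := j) (by norm_num) rfl ?_
    have hb := hb.set 25 (v := j) (by omega)
    exact ⟨_, _, _, rfl, k + 1, by omega, e / (d + 1) ^ k % (d + 1), 0, _, rfl, hb, rfl, rfl⟩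
  · refine ⟨0, by omega, dg, yf, A₃, ?_, ?_, ?_, rfl⟩
    · simp [coeffExp]
    · exact hl
    · simp [partialCoord]
  · rintro _ ⟨l, m, o', rfl, k, hk, dg, yf, A₃, rfl, hb, rfl, rfl⟩
    obtain rfl : k = r + 1 := by omega
    exact h _ _ _ _ _ _ hb

/-- The powers of `D` and `2` are reduced modulo `p` at every coordinate. Before reduction they grow
by one factor `D` or one doubling, which explains the bounds on `D * PM` and `2 * PM`. -/
theorem pointProg_spec (hU : 1 + 3 * M + n + q ≤ U) (hp : 1 ≤ p) (hpM : p ≤ PM)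
    (hDM : D * PM ≤ M) (hPM : 2 * PM ≤ M) (hnM : (n + 1) ^ (r + 2) ≤ M) {R : State F n → Prop}
    (hl : BoundedRegs M (mainRegs n d r δ ℓ D PM H E p x ci y e i x₁ dm tm w ex ev x₂ dg yf φ z))
    (h : ∀ i x₁ dm tm w ex ev x₂ dg yf A₂ A₃, BoundedRegs M
        (mainRegs n d r δ ℓ D PM H E p x ci y e i x₁ dm tm w ex ev x₂ dg yf φ z) →
      (∀ j < n, A₂ j = pointCoord n d r D p (A₀ ci) A₁ e j) →
      R (mkState (mainRegs n d r δ ℓ D PM H E p x ci y e i x₁ dm tm w ex ev x₂ dg yf φ z)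
        (arrays A₀ A₁ A₂ A₃) o)) :
    RunsWithin O q U pointProg (n * ((r + 1) * (3 * M + 11) + 3 * M + 17) + 5) R
      (mkState (mainRegs n d r δ ℓ D PM H E p x ci y e i x₁ dm tm w ex ev x₂ dg yf φ z)
        (arrays A₀ A₁ A₂ A₃) o) := by
  have hmod : ∀ a, a % p ≤ M := fun a => ((Nat.mod_lt a hp).le.trans hpM).trans (by omega)
  have hn : n ≤ M := hl.getD_le 0
  have hr : r + 1 ≤ M := hl.getD_le 28
  have he : e ≤ M := hl.getD_le 17
  simp only [pointProg, block]
  apply RunsWithin.mono (R := R) (k := 1 + (1 + (1 + (1 +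
    (n * ((r + 1) * (3 * M + 11) + 3 * M + 17) + 1))))) _ (by omega) (fun _ h => h)
  refine .seq (runsWithin_natOp hU hl (v := 1 % p) (by norm_num) rfl ?_)
  have hb := hl.set 20 (hmod 1)
  refine .seq (runsWithin_natOp hU hb (v := 1 % p) (by norm_num) rfl ?_)
  have hb := hb.set 21 (hmod 1)
  refine .seq (runsWithin_natConst hU hb (by norm_num) (Nat.zero_le M) ?_)
  have hb := hb.set 18 (Nat.zero_le M)
  refine .seq (runsWithin_natOp hU hb (v := n) (by norm_num) rfl ?_)
  have hb := hb.set 19 hn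
  refine (runsWithin_for hU (k := (r + 1) * (3 * M + 11) + 3 * M + 16) (fun j l m o' =>
    ∃ k, k + j = n ∧ ∃ w ex ev x₂ dg yf A₂ A₃,
      l = mainRegs n d r δ ℓ D PM H E p x ci y e k j (D ^ k % p) (2 ^ k % p) w ex ev x₂ dg yf φ z ∧
      BoundedRegs M l ∧ (∀ j < k, A₂ j = pointCoord n d r D p (A₀ ci) A₁ e j) ∧
      m = arrays A₀ A₁ A₂ A₃ ∧ o' = o) ?_ ?_ n ?_).mono le_rfl ?_
  · rintro j l m o' ⟨k, -, w, ex, ev, x₂, dg, yf, A₂, A₃, rfl, hb, -⟩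
    exact ⟨hb, rfl⟩
  · clear hb
    rintro j l m o' ⟨k, hk, w, ex, ev, x₂, dg, yf, A₂, A₃, rfl, hb, hA₂, rfl, rfl⟩
    have hjM : j + 1 ≤ M := hb.getD_le 19
    have hD1 : D ^ k % p * D ≤ M := by
      rw [mul_comm]
      exact (Nat.mul_le_mul_left _ ((Nat.mod_lt _ hp).le.trans hpM)).trans hDM
    have h21 : 2 ^ k % p + 2 ^ k % p ≤ M := by
      have := (Nat.mod_lt (2 ^ k) hp).le.trans hpM
      omega
    simp only [coordProg, block]
    apply RunsWithin.mono (k := 1 + (1 + (1 + (1 + ((3 * M + 3) + (1 + (1 + (1 + (1 + (1 + (1 +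
      (((r + 1) * (3 * M + 11) + 1) + (1 + 1))))))))))))) _ (by omega) (fun _ h => h)
    refine .seq (runsWithin_natOp hU hb (v := D ^ k % p * D) (by norm_num) rfl ?_)
    have hb := hb.set 20 hD1
    refine .seq (runsWithin_natOp hU hb (v := D ^ (k + 1) % p) (by norm_num)
      (show D ^ k % p * D % p = _ by rw [pow_succ, Nat.mod_mul_mod]) ?_)
    have hb := hb.set 20 (hmod (D ^ (k + 1)))
    refine .seq (runsWithin_natOp hU hb (v := 2 ^ k % p + 2 ^ k % p) (by norm_num) rfl ?_)
    have hb := hb.set 21 h21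
    refine .seq (runsWithin_natOp hU hb (v := 2 ^ (k + 1) % p) (by norm_num)
      (show (2 ^ k % p + 2 ^ k % p) % p = _ by
        rw [pow_succ, mul_two]; exact (Nat.add_mod _ _ _).symm) ?_)
    have hb := hb.set 21 (hmod (2 ^ (k + 1)))
    refine .seq (fieldPow_spec hU hb rfl rfl (e := D ^ (k + 1) % p) rfl ?_)
    have hb := hb.set 27 (Nat.zero_le M)
    refine .seq (runsWithin_fieldZero hU hb (m' := arrays A₀ A₁ (Function.update A₂ k 0)
      (Function.update A₃ 0 (A₀ ci ^ (D ^ (k + 1) % p)))) (update_arrays_two _ _ _ _ _) ?_)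
    refine .seq (runsWithin_fieldOp hU hb (m' := arrays A₀ A₁
      (Function.update A₂ k (A₀ ci ^ (D ^ (k + 1) % p)))
      (Function.update A₃ 0 (A₀ ci ^ (D ^ (k + 1) % p)))) ?_ ?_)
    · refine (update_arrays_two _ _ _ _ _).trans (congrArg (arrays A₀ A₁ · _) ?_)
      refine (Function.update_idem _ _ _).trans (congrArg (Function.update A₂ k) ?_)
      change Function.update A₂ k 0 k + Function.update A₃ 0 (A₀ ci ^ (D ^ (k + 1) % p)) 0 = _
      rw [Function.update_self, Function.update_self, zero_add]
    refine .seq (runsWithin_natOp hU hb (v := k + 1) (by norm_num) rfl ?_)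
    have hb := hb.set 22 (v := k + 1) (by omega)
    refine .seq (runsWithin_natOp hU hb (v := 2 ^ (k + 1) % p) (by norm_num) rfl ?_)
    have hb := hb.set 23 (hmod (2 ^ (k + 1)))
    refine .seq (runsWithin_natOp hU hb (v := e) (by norm_num) rfl ?_)
    have hb := hb.set 24 he
    refine .seq (runsWithin_natOp hU hb (v := r + 1) (by norm_num) rfl ?_)
    have hb := hb.set 25 hr
    refine .seq (termLoop_spec hU (by omega) hnM hb ?_)
    intro w ex ev dg yf A₃ hb
    refine .seq (runsWithin_natOp hU hb (v := k + 1) (by norm_num) rfl ?_)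
    have hb := hb.set 18 (v := k + 1) (by omega)
    refine runsWithin_natOp hU hb (v := j) (by norm_num) rfl ?_
    have hb := hb.set 19 (v := j) (by omega)
    refine ⟨_, _, _, rfl, k + 1, by omega, w, ex, ev, 0, dg, yf, _, A₃, rfl, hb, ?_, rfl, rfl⟩
    intro j' hj'
    by_cases hjk : j' = k
    · subst hjk
      rw [Function.update_self]
      rfl
    · rw [Function.update_of_ne hjk]
      exact hA₂ j' (by omega)
  · exact ⟨0, by omega, w, ex, ev, x₂, dg, yf, A₂, A₃, by simp, hb, by omega, rfl, rfl⟩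
  · rintro _ ⟨l, m, o', rfl, k, hk, w, ex, ev, x₂, dg, yf, A₂, A₃, rfl, hb, hA₂, rfl, rfl⟩
    obtain rfl : k = n := by omega
    exact h _ _ _ _ _ _ _ _ _ _ _ _ hb hA₂

end Point

/-! ### The nested loops over all points. -/

section Enumeration

theorem Ico_eq_insert_succ {j N : ℕ} (h : j < N) : Set.Ico j N = insert j (Set.Ico (j + 1) N) := by
  ext x
  simp only [Set.mem_Ico, Set.mem_insert_iff]
  omega

variable {F : Type u} [Field F]

/-- The point with the modulus `p`, the base `A₀ c` and the digits of `e` as coordinates. -/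
def enumPoint (n d r D : ℕ) (A₀ A₁ : ℕ → F) (p c e : ℕ) : Fin n → F :=
  fun i => pointCoord n d r D p (A₀ c) A₁ e i

/-- The points with given modulus and base. -/
def pointsOfBase (n d r D E : ℕ) (A₀ A₁ : ℕ → F) (p c : ℕ) : Set (Fin n → F) :=
  enumPoint n d r D A₀ A₁ p c '' Set.Ico 0 E

/-- The points with given modulus. -/
def pointsOfModulus (n d r D E H : ℕ) (A₀ A₁ : ℕ → F) (p : ℕ) : Set (Fin n → F) :=
  ⋃ c ∈ Set.Ico 0 H, pointsOfBase n d r D E A₀ A₁ p c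

/-- All enumerated points. -/
def enumPoints (n d r D E H PM : ℕ) (A₀ A₁ : ℕ → F) : Set (Fin n → F) :=
  ⋃ p ∈ Set.Ico 1 (PM + 1), pointsOfModulus n d r D E H A₀ A₁ p

variable {n : ℕ} {O : (Fin n → F) → F} {q U M : ℕ}
  {d r δ ℓ D PM H E p x ci y e i x₁ dm tm w ex ev x₂ dg yf φ z : ℕ}
  {A₀ A₁ A₂ A₃ : ℕ → F} {o : List (Fin n → F)}

/-- The program `body` processes the point in array `2`, with the set of the points processed so
far, the flag in register `29` and the output related by `J`. -/
def Processes (O : (Fin n → F) → F) (q U M : ℕ) (A₀ A₁ : ℕ → F) (body : Prog) (kb : ℕ)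
    (J : Set (Fin n → F) → ℕ → List (Fin n → F) → Prop) : Prop :=
  ∀ (l : List ℕ) (A₂ A₃ : ℕ → F) (S : Set (Fin n → F)) (o : List (Fin n → F)),
    BoundedRegs M l → l.getD 5 0 = 0 → J S (l.getD 29 0) o →
    RunsWithin O q U body kb (fun s => ∃ φ z A₃ o, s = mkState ((l.set 29 φ).set 30 z)
      (arrays A₀ A₁ A₂ A₃) o ∧ φ ≤ M ∧ z ≤ M ∧ J (insert (fun i : Fin n => A₂ i) S) φ o)
      (mkState l (arrays A₀ A₁ A₂ A₃) o)

variable {body : Prog} {kb : ℕ} {J : Set (Fin n → F) → ℕ → List (Fin n → F) → Prop}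

/-- The counter runs downward, so the numbers `e` already processed form the interval from `j` to
`E`. The state after the body is known up to the flag, the scratch register, array `3` and the
output. -/
theorem pointLoop_spec (hU : 1 + 3 * M + n + q ≤ U)
    (hbody : Processes O q U M A₀ A₁ body kb J) (hp : 1 ≤ p) (hpM : p ≤ PM)
    (hDM : D * PM ≤ M) (hPM : 2 * PM ≤ M) (hnM : (n + 1) ^ (r + 2) ≤ M) {R : State F n → Prop}
    (hl : BoundedRegs M (mainRegs n d r δ ℓ D PM H E p x ci E e i x₁ dm tm w ex ev x₂ dg yf φ z))
    {S : Set (Fin n → F)} (hJ : J S φ o)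
    (h : ∀ y e i x₁ dm tm w ex ev x₂ dg yf φ z A₂ A₃ o, BoundedRegs M
        (mainRegs n d r δ ℓ D PM H E p x ci y e i x₁ dm tm w ex ev x₂ dg yf φ z) →
      J (S ∪ pointsOfBase n d r D E A₀ A₁ p ci) φ o →
      R (mkState (mainRegs n d r δ ℓ D PM H E p x ci y e i x₁ dm tm w ex ev x₂ dg yf φ z)
        (arrays A₀ A₁ A₂ A₃) o)) :
    RunsWithin O q U (pointLoop body) (E * (n * ((r + 1) * (3 * M + 11) + 3 * M + 17) + kb + 8) + 1)
      R (mkState (mainRegs n d r δ ℓ D PM H E p x ci E e i x₁ dm tm w ex ev x₂ dg yf φ z)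
        (arrays A₀ A₁ A₂ A₃) o) := by
  refine (runsWithin_for hU (k := n * ((r + 1) * (3 * M + 11) + 3 * M + 17) + kb + 7)
    (fun j l m o => j ≤ E ∧ ∃ e i x₁ dm tm w ex ev x₂ dg yf φ z A₂ A₃,
      l = mainRegs n d r δ ℓ D PM H E p x ci j e i x₁ dm tm w ex ev x₂ dg yf φ z ∧
      BoundedRegs M l ∧ m = arrays A₀ A₁ A₂ A₃ ∧
      J (S ∪ enumPoint n d r D A₀ A₁ p ci '' Set.Ico j E) φ o) ?_ ?_ E ?_).mono le_rfl ?_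
  · rintro j l m o ⟨-, e, i, x₁, dm, tm, w, ex, ev, x₂, dg, yf, φ, z, A₂, A₃, rfl, hb, -⟩
    exact ⟨hb, rfl⟩
  · clear hl hJ
    rintro j l m o ⟨hj, e, i, x₁, dm, tm, w, ex, ev, x₂, dg, yf, φ, z, A₂, A₃, rfl, hb, rfl, hJ⟩
    have hjM : j + 1 ≤ M := hb.getD_le 16
    simp only [block]
    apply RunsWithin.mono (k := 1 + ((n * ((r + 1) * (3 * M + 11) + 3 * M + 17) + 5) + (kb + 1))) _
      (by omega) (fun _ h => h)
    refine .seq (runsWithin_natOp hU hb (v := j) (by norm_num) rfl ?_)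
    have hb := hb.set 17 (v := j) (by omega)
    refine .seq (pointProg_spec hU hp hpM hDM hPM hnM hb ?_)
    intro i x₁ dm tm w ex ev x₂ dg yf A₂ A₃ hb hA₂
    refine .seq ((hbody _ A₂ A₃ _ o hb rfl hJ).mono le_rfl ?_)
    rintro _ ⟨φ, z, A₃, o, rfl, hφ, hz, hJ⟩
    have hb := (hb.set 29 hφ).set 30 hz
    refine runsWithin_natOp hU hb (v := j) (by norm_num) rfl ?_
    have hb := hb.set 16 (v := j) (by omega)
    refine ⟨_, _, _, rfl, by omega, j, i, x₁, dm, tm, w, ex, ev, x₂, dg, yf, φ, z, A₂, A₃, rfl, hb,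
      rfl, ?_⟩
    have hpt : enumPoint n d r D A₀ A₁ p ci j = fun i : Fin n => A₂ i :=
      funext fun i => (hA₂ i i.2).symm
    rwa [Ico_eq_insert_succ (by omega), Set.image_insert_eq, Set.union_insert, hpt]
  · exact ⟨le_rfl, e, i, x₁, dm, tm, w, ex, ev, x₂, dg, yf, φ, z, A₂, A₃, rfl, hl, rfl,
      by simpa using hJ⟩
  · rintro _ ⟨l, m, o, rfl, -, e, i, x₁, dm, tm, w, ex, ev, x₂, dg, yf, φ, z, A₂, A₃, rfl, hb, rfl,
      hJ⟩
    exact h _ _ _ _ _ _ _ _ _ _ _ _ _ _ _ _ _ hb hJ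

theorem baseLoop_spec (hU : 1 + 3 * M + n + q ≤ U)
    (hbody : Processes O q U M A₀ A₁ body kb J) (hp : 1 ≤ p) (hpM : p ≤ PM)
    (hDM : D * PM ≤ M) (hPM : 2 * PM ≤ M) (hnM : (n + 1) ^ (r + 2) ≤ M) {R : State F n → Prop}
    (hl : BoundedRegs M (mainRegs n d r δ ℓ D PM H E p H ci y e i x₁ dm tm w ex ev x₂ dg yf φ z))
    {S : Set (Fin n → F)} (hJ : J S φ o)
    (h : ∀ x ci y e i x₁ dm tm w ex ev x₂ dg yf φ z A₂ A₃ o, BoundedRegs M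
        (mainRegs n d r δ ℓ D PM H E p x ci y e i x₁ dm tm w ex ev x₂ dg yf φ z) →
      J (S ∪ pointsOfModulus n d r D E H A₀ A₁ p) φ o →
      R (mkState (mainRegs n d r δ ℓ D PM H E p x ci y e i x₁ dm tm w ex ev x₂ dg yf φ z)
        (arrays A₀ A₁ A₂ A₃) o)) :
    RunsWithin O q U (baseLoop body)
      (H * (E * (n * ((r + 1) * (3 * M + 11) + 3 * M + 17) + kb + 8) + 5) + 1)
      R (mkState (mainRegs n d r δ ℓ D PM H E p H ci y e i x₁ dm tm w ex ev x₂ dg yf φ z)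
        (arrays A₀ A₁ A₂ A₃) o) := by
  have hE : E ≤ M := hl.getD_le 10
  refine (runsWithin_for hU
    (k := E * (n * ((r + 1) * (3 * M + 11) + 3 * M + 17) + kb + 8) + 4)
    (fun j l m o => j ≤ H ∧ ∃ ci y e i x₁ dm tm w ex ev x₂ dg yf φ z A₂ A₃,
      l = mainRegs n d r δ ℓ D PM H E p j ci y e i x₁ dm tm w ex ev x₂ dg yf φ z ∧
      BoundedRegs M l ∧ m = arrays A₀ A₁ A₂ A₃ ∧
      J (S ∪ ⋃ c ∈ Set.Ico j H, pointsOfBase n d r D E A₀ A₁ p c) φ o) ?_ ?_ H ?_).mono le_rfl ?_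
  · rintro j l m o ⟨-, ci, y, e, i, x₁, dm, tm, w, ex, ev, x₂, dg, yf, φ, z, A₂, A₃, rfl, hb, -⟩
    exact ⟨hb, rfl⟩
  · clear hl hJ
    rintro j l m o ⟨hj, ci, y, e, i, x₁, dm, tm, w, ex, ev, x₂, dg, yf, φ, z, A₂, A₃, rfl, hb, rfl,
      hJ⟩
    have hjM : j + 1 ≤ M := hb.getD_le 14
    simp only [block]
    apply RunsWithin.mono
      (k := 1 + (1 + (E * (n * ((r + 1) * (3 * M + 11) + 3 * M + 17) + kb + 8) + 1 + 1))) _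
      (by omega) (fun _ h => h)
    refine .seq (runsWithin_natOp hU hb (v := j) (by norm_num) rfl ?_)
    have hb := hb.set 15 (v := j) (by omega)
    refine .seq (runsWithin_natOp hU hb (v := E) (by norm_num) rfl ?_)
    have hb := hb.set 16 hE
    refine .seq (pointLoop_spec hU hbody hp hpM hDM hPM hnM hb hJ ?_)
    intro y e i x₁ dm tm w ex ev x₂ dg yf φ z A₂ A₃ o hb hJ
    refine runsWithin_natOp hU hb (v := j) (by norm_num) rfl ?_
    have hb := hb.set 14 (v := j) (by omega)
    refine ⟨_, _, _, rfl, by omega, j, y, e, i, x₁, dm, tm, w, ex, ev, x₂, dg, yf, φ, z, A₂, A₃,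
      rfl, hb, rfl, ?_⟩
    rwa [Ico_eq_insert_succ (by omega), Set.biUnion_insert,
      Set.union_comm (pointsOfBase n d r D E A₀ A₁ p j), ← Set.union_assoc]
  · exact ⟨le_rfl, ci, y, e, i, x₁, dm, tm, w, ex, ev, x₂, dg, yf, φ, z, A₂, A₃, rfl, hl, rfl,
      by simpa using hJ⟩
  · rintro _ ⟨l, m, o, rfl, -, ci, y, e, i, x₁, dm, tm, w, ex, ev, x₂, dg, yf, φ, z, A₂, A₃, rfl,
      hb, rfl, hJ⟩
    exact h _ _ _ _ _ _ _ _ _ _ _ _ _ _ _ _ _ _ _ hb hJ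

theorem enumProg_spec (hU : 1 + 3 * M + n + q ≤ U)
    (hbody : Processes O q U M A₀ A₁ body kb J)
    (hDM : D * PM ≤ M) (hPM : 2 * PM ≤ M) (hnM : (n + 1) ^ (r + 2) ≤ M) {R : State F n → Prop}
    (hl : BoundedRegs M (mainRegs n d r δ ℓ D PM H E p x ci y e i x₁ dm tm w ex ev x₂ dg yf φ z))
    (hJ : J ∅ φ o)
    (h : ∀ l A₂ A₃ o, BoundedRegs M l → l.getD 6 0 = 1 →
      J (enumPoints n d r D E H PM A₀ A₁) (l.getD 29 0) o →
      R (mkState l (arrays A₀ A₁ A₂ A₃) o)) :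
    RunsWithin O q U (enumProg body)
      (PM * (H * (E * (n * ((r + 1) * (3 * M + 11) + 3 * M + 17) + kb + 8) + 5) + 4) + 2)
      R (mkState (mainRegs n d r δ ℓ D PM H E p x ci y e i x₁ dm tm w ex ev x₂ dg yf φ z)
        (arrays A₀ A₁ A₂ A₃) o) := by
  have hH : H ≤ M := hl.getD_le 9
  simp only [enumProg, block]
  apply RunsWithin.mono (k := 1 + (PM * (H * (E * (n * ((r + 1) * (3 * M + 11) + 3 * M + 17) + kb +
    8) + 5) + 4) + 1)) _ (by omega) (fun _ h => h)
  refine .seq (runsWithin_natOp hU hl (v := PM) (by norm_num) rfl ?_)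
  have hb := hl.set 13 (v := PM) (by omega)
  refine (runsWithin_for hU
    (k := H * (E * (n * ((r + 1) * (3 * M + 11) + 3 * M + 17) + kb + 8) + 5) + 3)
    (fun j l m o => j ≤ PM ∧ ∃ x ci y e i x₁ dm tm w ex ev x₂ dg yf φ z A₂ A₃,
      l = mainRegs n d r δ ℓ D PM H E j x ci y e i x₁ dm tm w ex ev x₂ dg yf φ z ∧
      BoundedRegs M l ∧ m = arrays A₀ A₁ A₂ A₃ ∧
      -- Here the counter itself is the modulus, without subtraction of `1`, so the range is shifted
      -- by one against the inner loops.
      J (⋃ p ∈ Set.Ico (j + 1) (PM + 1), pointsOfModulus n d r D E H A₀ A₁ p) φ o)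
    ?_ ?_ PM ?_).mono le_rfl ?_
  · rintro j l m o ⟨-, x, ci, y, e, i, x₁, dm, tm, w, ex, ev, x₂, dg, yf, φ, z, A₂, A₃, rfl, hb, -⟩
    exact ⟨hb, rfl⟩
  · clear hb hJ
    rintro j l m o ⟨hj, x, ci, y, e, i, x₁, dm, tm, w, ex, ev, x₂, dg, yf, φ, z, A₂, A₃, rfl, hb,
      rfl, hJ⟩
    have hjM : j + 1 ≤ M := hb.getD_le 13
    apply RunsWithin.mono (k := 1 + (H * (E * (n * ((r + 1) * (3 * M + 11) + 3 * M + 17) + kb + 8) +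
      5) + 1 + 1)) _ (by omega) (fun _ h => h)
    refine .seq (runsWithin_natOp hU hb (v := H) (by norm_num) rfl ?_)
    have hb := hb.set 14 hH
    refine .seq (baseLoop_spec hU hbody (Nat.succ_pos j) hj hDM hPM hnM hb hJ ?_)
    intro x ci y e i x₁ dm tm w ex ev x₂ dg yf φ z A₂ A₃ o hb hJ
    refine runsWithin_natOp hU hb (v := j) (by norm_num) rfl ?_
    have hb := hb.set 13 (v := j) (by omega)
    refine ⟨_, _, _, rfl, by omega, x, ci, y, e, i, x₁, dm, tm, w, ex, ev, x₂, dg, yf, φ, z, A₂, A₃,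
      rfl, hb, rfl, ?_⟩
    rwa [Ico_eq_insert_succ (by omega), Set.biUnion_insert, Set.union_comm]
  · exact ⟨le_rfl, x, ci, y, e, i, x₁, dm, tm, w, ex, ev, x₂, dg, yf, φ, z, A₂, A₃, rfl, hb, rfl,
      by simpa using hJ⟩
  · rintro _ ⟨l, m, o, rfl, -, x, ci, y, e, i, x₁, dm, tm, w, ex, ev, x₂, dg, yf, φ, z, A₂, A₃, rfl,
      hb, rfl, hJ⟩
    exact h _ _ _ _ hb rfl hJ

end Enumeration

/-! ### Correctness of the computation of the parameters. -/

section Setup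

variable {F : Type u} [Field F] {n : ℕ} {O : (Fin n → F) → F} {q U M : ℕ} {d r δ ℓ : ℕ}

theorem setupParamD_spec (hU : 1 + 3 * M + n + q ≤ U) (hδ1 : 1 ≤ δ)
    (hl : BoundedRegs M [n, d, r, δ, ℓ, 0, 0, 0, 0, 0, 0, 0, 0, 0, 0, 0, 0, 0, 0, 0, 0, 0, 0, 0, 0,
      0, 0, 0, 0, 0, 0])
    (hn : n + 1 ≤ M) (hd : d + 1 ≤ M) (hr : r + 1 ≤ M) (hnδ : 2 * δ * n ≤ M)
    (hD : ∀ j ≤ r + 1, (2 * δ * n) ^ j ≤ M)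
    {m : ℕ → ℕ → F} {o : List (Fin n → F)} {R : State F n → Prop}
    (h : BoundedRegs M (mainRegs n d r δ ℓ (paramD n r δ) 0 0 0 0 (2 * n) (2 * δ * n)
        0 0 0 0 0 0 0 0 0 0 0 0 0 0) →
      R (mkState (mainRegs n d r δ ℓ (paramD n r δ) 0 0 0 0 (2 * n) (2 * δ * n)
        0 0 0 0 0 0 0 0 0 0 0 0 0 0) m o)) :
    RunsWithin O q U setupParamD (3 * M + 9) R
      (mkState [n, d, r, δ, ℓ, 0, 0, 0, 0, 0, 0, 0, 0, 0, 0, 0, 0, 0, 0, 0, 0, 0, 0, 0, 0, 0, 0, 0, 0,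
        0, 0] m o) := by
  have h1M : 1 ≤ M := by omega
  have h2n : 2 * n ≤ M := (Nat.mul_le_mul_right n (Nat.le_mul_of_pos_right 2 hδ1)).trans hnδ
  refine RunsWithin.mono (k := 1 + (1 + (1 + (1 + (1 + (1 + (3 * M + 3))))))) ?_ (by omega)
    (fun _ h => h)
  simp only [setupParamD, block]
  refine .seq (runsWithin_natConst hU hl (by norm_num) h1M ?_)
  have hb := hl.set 6 h1M
  refine .seq (runsWithin_natOp hU hb (v := r + 1) (by norm_num) rfl ?_)
  have hb := hb.set 28 hr
  refine .seq (runsWithin_natOp hU hb (v := d + 1) (by norm_num) rfl ?_)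
  have hb := hb.set 11 hd
  refine .seq (runsWithin_natOp hU hb (v := n + 1) (by norm_num) rfl ?_)
  have hb := hb.set 12 hn
  refine .seq (runsWithin_natOp hU hb (v := 2 * n) (by norm_num)
    (show n + n = 2 * n by omega) ?_)
  have hb := hb.set 14 h2n
  refine .seq (runsWithin_natOp hU hb (v := 2 * δ * n) (by norm_num)
    (show 2 * n * δ = 2 * δ * n by ring) ?_)
  have hb := hb.set 15 hnδ
  refine natPow_spec hU hb rfl rfl (b := 2 * δ * n) (e := r + 1) (by norm_num) (by norm_num)
    (by norm_num) (by norm_num) (by norm_num) (by norm_num) (by norm_num) rfl rfl hD ?_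
  have hb := (hb.set 7 (hD _ le_rfl)).set 13 (Nat.zero_le M)
  exact h hb

theorem setupPow_spec (hU : 1 + 3 * M + n + q ≤ U) {D y : ℕ}
    (hl : BoundedRegs M (mainRegs n d r δ ℓ D 0 0 0 0 (2 * n) y
        0 0 0 0 0 0 0 0 0 0 0 0 0 0))
    (hℓ : 2 * n * r * ℓ ≤ M) (hnr : 2 * n * r ≤ M) (hr : 2 * (r + 1) ≤ M)
    (hP : ∀ j ≤ 2 * (r + 1), (2 * n * r * ℓ) ^ j ≤ M)
    {m : ℕ → ℕ → F} {o : List (Fin n → F)} {R : State F n → Prop}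
    (h : ∀ y e, BoundedRegs M (mainRegs n d r δ ℓ D ((2 * n * r * ℓ) ^ (2 * (r + 1))) 0 0 0 (2 * n) y
        e 0 0 0 0 0 0 0 0 0 0 0 0 0) →
      R (mkState (mainRegs n d r δ ℓ D ((2 * n * r * ℓ) ^ (2 * (r + 1))) 0 0 0 (2 * n) y
        e 0 0 0 0 0 0 0 0 0 0 0 0 0) m o)) :
    RunsWithin O q U setupPow (3 * M + 6) R
      (mkState (mainRegs n d r δ ℓ D 0 0 0 0 (2 * n) y 0 0 0 0 0 0 0 0 0 0 0 0 0 0) m o) := by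
  refine RunsWithin.mono (k := 1 + (1 + (1 + (3 * M + 3)))) ?_ (by omega) (fun _ h => h)
  simp only [setupPow, block]
  refine .seq (runsWithin_natOp hU hl (v := 2 * n * r) (by norm_num) rfl ?_)
  have hb := hl.set 15 hnr
  refine .seq (runsWithin_natOp hU hb (v := 2 * n * r * ℓ) (by norm_num) rfl ?_)
  have hb := hb.set 15 hℓ
  refine .seq (runsWithin_natOp hU hb (v := 2 * (r + 1)) (by norm_num)
    (show r + 1 + (r + 1) = _ by omega) ?_)
  have hb := hb.set 16 hr
  refine natPow_spec hU hb rfl rfl (b := 2 * n * r * ℓ) (e := 2 * (r + 1)) (by norm_num)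
    (by norm_num) (by norm_num) (by norm_num) (by norm_num) (by norm_num) (by norm_num) rfl rfl
    hP ?_
  have hb := (hb.set 8 (hP _ le_rfl)).set 13 (Nat.zero_le M)
  exact h _ _ hb

theorem setupClog_spec (hU : 1 + 3 * M + n + q ≤ U) {D W x ci y : ℕ} (hM : 1 ≤ M)
    (hl : BoundedRegs M (mainRegs n d r δ ℓ D W 0 0 0 x ci y 0 0 0 0 0 0 0 0 0 0 0 0 0))
    (hclog : Nat.clog 2 D ≤ M) (hpw : ∀ k ≤ Nat.clog 2 D, 2 ^ k ≤ M)
    {m : ℕ → ℕ → F} {o : List (Fin n → F)} {R : State F n → Prop}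
    (h : ∀ e x₁, BoundedRegs M (mainRegs n d r δ ℓ D W 0 0 0 x ci y e (Nat.clog 2 D) x₁
        0 0 0 0 0 0 0 0 0 0) →
      R (mkState (mainRegs n d r δ ℓ D W 0 0 0 x ci y e (Nat.clog 2 D) x₁
        0 0 0 0 0 0 0 0 0 0) m o)) :
    RunsWithin O q U setupClog (4 * M + 4) R
      (mkState (mainRegs n d r δ ℓ D W 0 0 0 x ci y 0 0 0 0 0 0 0 0 0 0 0 0 0) m o) := by
  have hD : D ≤ M := hl.getD_le 7
  refine RunsWithin.mono (k := 1 + (1 + (1 + (Nat.clog 2 D * (3 + 1) + 1)))) ?_ (by omega)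
    (fun _ h => h)
  simp only [setupClog, block]
  refine .seq (runsWithin_natConst hU hl (by norm_num) hM ?_)
  have hb := hl.set 17 hM
  refine .seq (runsWithin_natConst hU hb (by norm_num) (Nat.zero_le M) ?_)
  have hb := hb.set 18 (Nat.zero_le M)
  refine .seq (runsWithin_natOp hU hb (v := D - 1) (by norm_num) rfl ?_)
  have hb := hb.set 19 (v := D - 1) (by omega)
  -- The loop tests the truncated difference `D - 2 ^ k`, which first vanishes at `k = Nat.clog 2
  -- D`.
  refine (RunsWithin.while (k := 3) (fun j s => ∃ k, k + j = Nat.clog 2 D ∧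
    ∃ l, s = mkState l m o ∧ l = mainRegs n d r δ ℓ D W 0 0 0 x ci y (2 ^ k) k
      (D - 2 ^ k) 0 0 0 0 0 0 0 0 0 0 ∧ BoundedRegs M l) ?_ ?_ ?_
      (Nat.clog 2 D) _ ?_).mono le_rfl ?_
  · rintro j _ ⟨k, -, l, rfl, -, hb⟩
    have := (natSize_le_self (l.getD 19 0)).trans (hb.getD_le 19)
    change 1 + (l.getD 19 0).size ≤ U
    omega
  · rintro _ ⟨k, hk, l, rfl, rfl, hb⟩
    obtain rfl : k = Nat.clog 2 D := by omega
    exact Nat.sub_eq_zero_of_le (Nat.le_pow_clog one_lt_two _)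
  · clear hb
    rintro j _ ⟨k, hk, l, rfl, rfl, hb⟩
    have hlt : 2 ^ k < D := (Nat.lt_clog_iff_pow_lt one_lt_two).1 (by omega)
    refine ⟨(Nat.sub_pos_of_lt hlt).ne', RunsWithin.mono (k := 1 + (1 + 1)) ?_ le_rfl fun _ h => h⟩
    refine .seq (runsWithin_natOp hU hb (v := 2 ^ (k + 1)) (by norm_num)
      (show 2 ^ k + 2 ^ k = _ by rw [pow_succ, mul_two]) ?_)
    have hb := hb.set 17 (hpw (k + 1) (by omega))
    refine .seq (runsWithin_natOp hU hb (v := k + 1) (by norm_num) rfl ?_)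
    have hb := hb.set 18 (v := k + 1) (by omega)
    refine runsWithin_natOp hU hb (v := D - 2 ^ (k + 1)) (by norm_num) rfl ?_
    have hb := hb.set 19 (v := D - 2 ^ (k + 1)) ((Nat.sub_le _ _).trans hD)
    exact ⟨k + 1, by omega, _, rfl, rfl, hb⟩
  · exact ⟨0, by omega, _, rfl, rfl, hb⟩
  · rintro _ ⟨k, hk, l, rfl, rfl, hb⟩
    obtain rfl : k = Nat.clog 2 D := by omega
    exact h _ _ hb

theorem setupCounts_spec (hU : 1 + 3 * M + n + q ≤ U) {D W C x ci y e x₁ : ℕ}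
    (hl : BoundedRegs M (mainRegs n d r δ ℓ D W 0 0 0 x ci y e C x₁ 0 0 0 0 0 0 0 0 0 0))
    (hC : C ^ 2 ≤ M) (hPM : W * C ^ 2 + 1 ≤ M) (hδr : δ * r ≤ M)
    (hH : δ * r * (W * C ^ 2 + 1) ≤ M) (hE : ∀ j ≤ r + 1, (d + 1) ^ j ≤ M)
    {m : ℕ → ℕ → F} {o : List (Fin n → F)} {R : State F n → Prop}
    (h : ∀ i, BoundedRegs M (mainRegs n d r δ ℓ D (W * C ^ 2 + 1) (δ * r * (W * C ^ 2 + 1))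
        ((d + 1) ^ (r + 1)) 0 x ci y e i x₁ 0 0 0 0 0 0 0 0 0 0) →
      R (mkState (mainRegs n d r δ ℓ D (W * C ^ 2 + 1) (δ * r * (W * C ^ 2 + 1))
        ((d + 1) ^ (r + 1)) 0 x ci y e i x₁ 0 0 0 0 0 0 0 0 0 0) m o)) :
    RunsWithin O q U setupCounts (3 * M + 8) R
      (mkState (mainRegs n d r δ ℓ D W 0 0 0 x ci y e C x₁ 0 0 0 0 0 0 0 0 0 0) m o) := by
  refine RunsWithin.mono (k := 1 + (1 + (1 + (1 + (1 + (3 * M + 3)))))) ?_ (by omega)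
    (fun _ h => h)
  simp only [setupCounts, block]
  refine .seq (runsWithin_natOp hU hl (v := C ^ 2) (by norm_num) (sq C).symm ?_)
  have hb := hl.set 18 hC
  refine .seq (runsWithin_natOp hU hb (v := W * C ^ 2) (by norm_num) rfl ?_)
  have hb := hb.set 8 (v := W * C ^ 2) (by omega)
  refine .seq (runsWithin_natOp hU hb (v := W * C ^ 2 + 1) (by norm_num) rfl ?_)
  have hb := hb.set 8 hPM
  refine .seq (runsWithin_natOp hU hb (v := δ * r) (by norm_num) rfl ?_)
  have hb := hb.set 9 hδr
  refine .seq (runsWithin_natOp hU hb (v := δ * r * (W * C ^ 2 + 1)) (by norm_num) rfl ?_)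
  have hb := hb.set 9 hH
  refine natPow_spec hU hb rfl rfl (b := d + 1) (e := r + 1) (by norm_num)
    (by norm_num) (by norm_num) (by norm_num) (by norm_num) (by norm_num) (by norm_num) rfl rfl
    hE ?_
  have hb := (hb.set 10 (hE _ le_rfl)).set 13 (Nat.zero_le M)
  exact h _ hb

theorem setupProg_spec (hU : 1 + 3 * M + n + q ≤ U) (hδ1 : 1 ≤ δ)
    (hn : n + 1 ≤ M) (hd : d + 1 ≤ M) (hr : 2 * (r + 1) ≤ M) (hδ : δ ≤ M) (hℓ : ℓ ≤ M)
    (hnδ : 2 * δ * n ≤ M) (hnr : 2 * n * r ≤ M) (hnrℓ : 2 * n * r * ℓ ≤ M)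
    (hD : ∀ j ≤ r + 1, (2 * δ * n) ^ j ≤ M) (hD2 : 2 * paramD n r δ ≤ M)
    (hP : ∀ j ≤ 2 * (r + 1), (2 * n * r * ℓ) ^ j ≤ M)
    (hC : Nat.clog 2 (paramD n r δ) ^ 2 ≤ M) (hPM : pMax n r δ ℓ ≤ M) (hδr : δ * r ≤ M)
    (hH : δ * r * pMax n r δ ℓ ≤ M) (hE : ∀ j ≤ r + 1, (d + 1) ^ j ≤ M)
    {m : ℕ → ℕ → F} {o : List (Fin n → F)} {R : State F n → Prop}
    (h : ∀ x ci y e i x₁, BoundedRegs M (mainRegs n d r δ ℓ (paramD n r δ) (pMax n r δ ℓ)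
        (δ * r * pMax n r δ ℓ) ((d + 1) ^ (r + 1)) 0 x ci y e i x₁ 0 0 0 0 0 0 0 0 0 0) →
      R (mkState (mainRegs n d r δ ℓ (paramD n r δ) (pMax n r δ ℓ)
        (δ * r * pMax n r δ ℓ) ((d + 1) ^ (r + 1)) 0 x ci y e i x₁ 0 0 0 0 0 0 0 0 0 0) m o)) :
    RunsWithin O q U setupProg (13 * M + 27) R
      (mkState [n, d, r, δ, ℓ, 0, 0, 0, 0, 0, 0, 0, 0, 0, 0, 0, 0, 0, 0, 0, 0, 0, 0, 0, 0, 0, 0, 0, 0,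
        0, 0] m o) := by
  have h1M : 1 ≤ M := by omega
  have hclog : Nat.clog 2 (paramD n r δ) ≤ M := (Nat.le_self_pow two_ne_zero _).trans hC
  -- The last power arises by doubling one below `paramD`, hence the requirement that `2 * paramD`
  -- fit.
  have hpw : ∀ k ≤ Nat.clog 2 (paramD n r δ), 2 ^ k ≤ M := by
    rintro (_ | k) hk
    · simpa using h1M
    · have := (Nat.lt_clog_iff_pow_lt one_lt_two).1 (Nat.lt_of_succ_le hk)
      rw [pow_succ]
      omega
  have hb : BoundedRegs M [n, d, r, δ, ℓ, 0, 0, 0, 0, 0, 0, 0, 0, 0, 0, 0, 0, 0, 0, 0, 0, 0, 0, 0, 0,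
      0, 0, 0, 0, 0, 0] := by
    refine ⟨rfl, ?_⟩
    simp only [List.forall_mem_cons, Nat.zero_le, List.not_mem_nil, false_imp_iff,
      implies_true, and_true]
    omega
  refine RunsWithin.mono (k := (3 * M + 9) + ((3 * M + 6) + ((4 * M + 4) + (3 * M + 8)))) ?_
    (by omega) (fun _ h => h)
  simp only [setupProg, block]
  refine .seq (setupParamD_spec hU hδ1 hb hn hd (by omega) hnδ hD fun hb => ?_)
  refine .seq (setupPow_spec hU hb hnrℓ hnr hr hP fun y e hb => ?_)
  refine .seq (setupClog_spec hU h1M hb hclog hpw fun e x₁ hb => ?_)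
  exact setupCounts_spec hU hb hC hPM hδr hH hE fun i hb => h _ _ _ _ _ _ hb

theorem initState_eq_mkState (n d r δ ℓ : ℕ) (h₁ h₂ : List F) :
    initState n d r δ ℓ h₁ h₂ = mkState [n, d, r, δ, ℓ, 0, 0, 0, 0, 0, 0, 0, 0, 0, 0, 0, 0, 0, 0, 0, 0,
      0, 0, 0, 0, 0, 0, 0, 0, 0, 0]
      (arrays (fun i => h₁.getD i 0) (fun i => h₂.getD i 0) (fun _ => 0) (fun _ => 0)) [] := by
  simp only [initState, mkState, State.mk.injEq, and_true]
  constructor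
  · funext x
    match x with
    | 0 | 1 | 2 | 3 | 4 => rfl
    | k + 5 =>
      change [].getD k 0 = (List.replicate 26 0).getD k 0
      rw [List.getD_nil, List.getD_eq_getElem?_getD, List.getElem?_getD_replicate_default_eq]
  · funext v i
    match v with
    | 0 | 1 | 2 | 3 | _ + 4 => rfl

end Setup

/-! ### The two loop bodies: output and zero test. -/

section Bodies

variable {F : Type u} [Field F] {n : ℕ} {O : (Fin n → F) → F} {q U M : ℕ} {A₀ A₁ : ℕ → F}

theorem set_getD_self {l : List ℕ} (x : ℕ) : l.set x (l.getD x 0) = l := by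
  by_cases h : x < l.length
  · rw [List.getD_eq_getElem _ _ h, List.set_getElem_self]
  · rw [List.set_eq_of_length_le (not_lt.1 h)]

/-- Only the set of output points is tracked; repetitions in the list are harmless. -/
theorem processes_emit (hU : 1 + 3 * M + n + q ≤ U) :
    Processes O q U M A₀ A₁ (.emit 2) 1 (fun S _ o => {v | v ∈ o} = S) := by
  intro l A₂ A₃ S o hl _ hJ
  refine runsWithin_emit hU ⟨l.getD 29 0, l.getD 30 0, A₃,
    o ++ [fun i : Fin n => A₂ i], ?_, hl.getD_le _, hl.getD_le _, ?_⟩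
  · rw [set_getD_self, set_getD_self]
    rfl
  · subst hJ
    ext v
    simp [or_comm]

/-- Tests whether the oracle vanishes at the point in array `2` and sets a flag if not. -/
def testProg : Prog :=
  block [.query 2 ⟨3, 5⟩, .ifField ⟨3, 5⟩ (.natConst 30 0) (.natConst 29 1)]

/-- The flag is set at the first nonzero answer and never reset, so at the end it tells whether the
oracle vanishes on all processed points. -/
theorem processes_testProg (hU : 1 + 3 * M + n + q ≤ U) (hM : 1 ≤ M) :
    Processes O q U M A₀ A₁ testProg 3 (fun S φ _ =>
      (φ = 0 ∧ ∀ v ∈ S, O v = 0) ∨ (φ = 1 ∧ ∃ v ∈ S, O v ≠ 0)) := by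
  intro l A₂ A₃ S o hl h5 hJ
  simp only [testProg, block]
  refine RunsWithin.seq (k := 1) (k' := 2) (runsWithin_query hU hl (m' := arrays A₀ A₁ A₂
    (Function.update A₃ 0 (O fun i : Fin n => A₂ i))) ?_ ?_)
  · change Function.update (arrays A₀ A₁ A₂ A₃) 3 (Function.update A₃ (l.getD 5 0) _) = _
    rw [h5, update_arrays_three]
    rfl
  have hval : arrays A₀ A₁ A₂ (Function.update A₃ 0 (O fun i : Fin n => A₂ i)) 3 (l.getD 5 0) =
      O fun i : Fin n => A₂ i := by
    rw [h5]
    exact Function.update_self (β := fun _ => F) _ _ _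
  refine runsWithin_ifField hU hl (fun h0 => ?_) (fun h0 => ?_)
  · replace h0 := hval.symm.trans h0
    refine runsWithin_natConst hU hl (by norm_num) (Nat.zero_le M)
      ⟨l.getD 29 0, 0, Function.update A₃ 0 (O fun i : Fin n => A₂ i), o,
        by rw [set_getD_self], hl.getD_le _, Nat.zero_le _, ?_⟩
    rcases hJ with ⟨hφ, hJ⟩ | ⟨hφ, v, hv, hJ⟩
    · refine .inl ⟨hφ, ?_⟩
      rintro v (rfl | hv)
      exacts [h0, hJ v hv]
    · exact .inr ⟨hφ, v, .inr hv, hJ⟩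
  · replace h0 : O (fun i : Fin n => A₂ i) ≠ 0 := fun h => h0 (hval.trans h)
    refine runsWithin_natConst hU hl (by norm_num) hM
      ⟨1, (l.set 29 1).getD 30 0, Function.update A₃ 0 (O fun i : Fin n => A₂ i), o,
        by rw [set_getD_self], hM, (hl.set 29 hM).getD_le _,
        .inr ⟨rfl, _, .inl rfl, h0⟩⟩

end Bodies

/-! ### The enumerated points are those of the explicit set. -/

section Points

variable {F : Type u}

theorem Enumerates.length_eq {h : List F} {H : Finset F} (hh : Enumerates h H) :
    h.length = H.card := by
  classical
  rw [← List.toFinset_card_of_nodup hh.1]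
  congr 1
  ext x
  rw [List.mem_toFinset, hh.2]

variable [Field F]

theorem pointCoord_eq_eval_psi (n d r D p : ℕ) (c : F) (A : ℕ → F) (e : ℕ) (i : Fin n) :
    pointCoord n d r D p c A e i = MvPolynomial.eval (fun j : Fin (r + 1) =>
      A (e / (d + 1) ^ (j : ℕ) % (d + 1))) (psi F n r D 2 p c (MvPolynomial.X i)) := by
  rw [eval_psi_X, pointCoord, partialCoord, Finset.sum_range, Fin.sum_univ_succ, ← add_assoc]
  simp only [coeffExp, Fin.val_zero, Fin.val_succ]

theorem Enumerates.exists_getD {h : List F} {H : Finset F} (hh : Enumerates h H) {x : F}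
    (hx : x ∈ H) : ∃ i < H.card, h.getD i 0 = x := by
  obtain ⟨i, hi, rfl⟩ := List.getElem_of_mem ((hh.2 x).2 hx)
  exact ⟨i, hh.length_eq ▸ hi, List.getD_eq_getElem _ _ hi⟩

theorem Enumerates.getD_mem {h : List F} {H : Finset F} (hh : Enumerates h H) {i : ℕ}
    (hi : i < H.card) : h.getD i 0 ∈ H := by
  rw [← hh.length_eq] at hi
  rw [List.getD_eq_getElem _ _ hi]
  exact (hh.2 _).1 (List.getElem_mem hi)

/-- Numbers below `(d + 1) ^ (r + 1)` correspond through their digits to tuples of addresses in the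
list of `H₂`. All addresses are below the list lengths, so the default value `0` never enters. -/
theorem enumPoints_eq_hittingSet {n d r δ ℓ : ℕ} {H₁ H₂ : Finset F}
    (hH₁ : H₁.card = δ * r * pMax n r δ ℓ) (hH₂ : H₂.card = d + 1) {h₁ h₂ : List F}
    (hh₁ : Enumerates h₁ H₁) (hh₂ : Enumerates h₂ H₂) :
    enumPoints n d r (paramD n r δ) ((d + 1) ^ (r + 1)) (δ * r * pMax n r δ ℓ) (pMax n r δ ℓ)
      (fun i => h₁.getD i 0) (fun i => h₂.getD i 0) = hittingSet n r δ ℓ H₁ H₂ := by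
  ext v
  simp only [enumPoints, pointsOfModulus, pointsOfBase, Set.mem_iUnion, Set.mem_image, Set.mem_Ico,
    Nat.zero_le, true_and, exists_prop, hittingSet, Set.mem_ofPred_eq]
  constructor
  · rintro ⟨p, ⟨hp, hpM⟩, c, hc, e, -, rfl⟩
    refine ⟨p, hp, by omega, h₁.getD c 0, hh₁.getD_mem (hH₁ ▸ hc),
      fun j => h₂.getD (e / (d + 1) ^ (j : ℕ) % (d + 1)) 0,
      fun j => hh₂.getD_mem (by
        rw [hH₂]
        exact Nat.mod_lt _ (Nat.succ_pos d)), ?_⟩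
    funext i
    exact pointCoord_eq_eval_psi _ _ _ _ _ _ _ _ _
  · rintro ⟨p, hp, hpM, c, hc, a, ha, rfl⟩
    obtain ⟨k, hk, rfl⟩ := hh₁.exists_getD hc
    choose f hf hfa using fun j => hh₂.exists_getD (ha j)
    rw [hH₂] at hf
    refine ⟨p, ⟨hp, by omega⟩, k, hH₁ ▸ hk, finFunctionFinEquiv fun j => ⟨f j, hf j⟩, Fin.is_lt _, ?_⟩
    funext i
    refine (pointCoord_eq_eval_psi _ _ _ _ _ _ _ _ _).trans ?_
    congr 2
    funext j
    rw [← finFunctionFinEquiv_symm_apply_val, Equiv.symm_apply_apply]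
    exact hfa j

end Points

/-! ### Estimates for the running time. -/

section Bounds

theorem mul_add_le_mul_pow {B X Y a c i j : ℕ} (hB : 1 ≤ B) (hX : X ≤ a * B ^ i) (hY : Y ≤ B ^ j) :
    Y * X + c ≤ (a + c) * B ^ (j + i) := by
  have h1 : 1 ≤ B ^ (j + i) := Nat.one_le_pow _ _ hB
  calc Y * X + c ≤ B ^ j * (a * B ^ i) + c * B ^ (j + i) :=
        Nat.add_le_add (Nat.mul_le_mul hY hX) (Nat.le_mul_of_pos_right c h1)
    _ = (a + c) * B ^ (j + i) := by ring

/-- Turns exponents such as `r + 1` into multiples of `r`, as needed for a bound of the form `P ^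
r`. -/
theorem pow_le_pow_pow {N b a j c r : ℕ} (hN : 1 ≤ N) (hb : b ≤ N ^ a) (hj : a * j ≤ c * r) :
    b ^ j ≤ (N ^ r) ^ c := by
  rw [← pow_mul, mul_comm r c]
  calc b ^ j ≤ (N ^ a) ^ j := Nat.pow_le_pow_left hb j
    _ = N ^ (a * j) := (pow_mul _ _ _).symm
    _ ≤ N ^ (c * r) := Nat.pow_le_pow_right hN hj

/-- From the innermost loop outward, the step count is of order `B ^ 27`, `B ^ 28`, `B ^ 30`, `B ^
53` and `B ^ 74`, with final constant `97`. The cost of a step is at most `6 * B ^ 26`. -/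
theorem time_le {B M n r kb E H PM q : ℕ} (hB : 1 ≤ B) (hM : M = B ^ 26) (hn : n ≤ B) (hq : q ≤ B)
    (hr : r + 1 ≤ B) (hkb : kb ≤ 3) (hE : E ≤ B ^ 2) (hH : H ≤ B ^ 23) (hPM : PM ≤ B ^ 21) :
    ((13 * M + 27) + (PM * (H * (E * (n * ((r + 1) * (3 * M + 11) + 3 * M + 17) + kb + 8) + 5) + 4)
      + 2) + 1) * (1 + 3 * M + n + q) ≤ 582 * B ^ 100 := by
  have h1 : 1 ≤ B ^ 26 := Nat.one_le_pow _ _ hB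
  have h26 : B ≤ B ^ 26 := Nat.le_self_pow (by norm_num) B
  have h27 : B ^ 26 ≤ B ^ 27 := Nat.pow_le_pow_right hB (by norm_num)
  have h74 : B ^ 26 ≤ B ^ 74 := Nat.pow_le_pow_right hB (by norm_num)
  have e0 : (r + 1) * (3 * M + 11) + 3 * M + 17 ≤ 34 * B ^ 27 := by
    have := mul_add_le_mul_pow (c := 0) (a := 14) (i := 26) (j := 1) hB (X := 3 * M + 11)
      (by omega) (hr.trans_eq (pow_one B).symm)
    norm_num at this
    omega
  have e1 := mul_add_le_mul_pow (c := kb + 8) (j := 1) hB e0 (hn.trans_eq (pow_one B).symm)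
  rw [← add_assoc] at e1
  replace e1 := e1.trans (Nat.mul_le_mul_right _ (show 34 + (kb + 8) ≤ 45 by omega))
  have e2 := mul_add_le_mul_pow (c := 5) hB e1 hE
  have e3 := mul_add_le_mul_pow (c := 4) hB e2 hH
  have e4 := mul_add_le_mul_pow (c := 2) hB e3 hPM
  norm_num at e4
  calc _ ≤ (97 * B ^ 74) * (6 * B ^ 26) := Nat.mul_le_mul (by omega) (by omega)
    _ = 582 * B ^ 100 := by ring

end Bounds

/-! ### Assembling the algorithms and their time bound. -/

section Algorithm

variable {F : Type u} [Field F] {n : ℕ} {O : (Fin n → F) → F} {q : ℕ} {d r δ ℓ : ℕ}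

/-- Running `body` on all points of the explicit set, and then `last`, takes a number of steps that
is polynomial up to the exponent `r`. -/
theorem exists_exec_of_processes {Z : ℕ} (hn1 : 1 ≤ n) (hr1 : 1 ≤ r) (hδ1 : 1 ≤ δ)
    (hn : n ≤ Z) (hd : d ≤ Z) (hr : r ≤ Z) (hδ : δ ≤ Z) (hℓ : ℓ ≤ Z) (hq : q ≤ Z)
    {H₁ H₂ : Finset F} (hH₁ : H₁.card = δ * r * pMax n r δ ℓ) (hH₂ : H₂.card = d + 1)
    {h₁ h₂ : List F} (hh₁ : Enumerates h₁ H₁) (hh₂ : Enumerates h₂ H₂) {body : Prog} {kb : ℕ}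
    (hkb : kb ≤ 3) {J : Set (Fin n → F) → ℕ → List (Fin n → F) → Prop}
    (hbody : ∀ U M A₀ A₁, 1 + 3 * M + n + q ≤ U → 1 ≤ M → Processes O q U M A₀ A₁ body kb J)
    (hJ : J ∅ 0 []) :
    ∃ s t, Exec O q (.seq (.seq setupProg (enumProg body)) (.natOp .sub 0 6 29))
      (initState n d r δ ℓ h₁ h₂) s t ∧ t ≤ (582 * (2 * Z) ^ 100) ^ r ∧
      ∃ φ, J (hittingSet n r δ ℓ H₁ H₂) φ s.out ∧ s.reg 0 = 1 - φ := by
  have hZ : 1 ≤ 2 * Z := by omega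
  -- The factor `2` gives `r + 1 ≤ 2 ^ r ≤ B` and lets each constant factor `2` be absorbed into one
  -- more power of `B`.
  obtain ⟨B, hBdef⟩ : ∃ B, B = (2 * Z) ^ r := ⟨_, rfl⟩
  -- Among the bounds for register contents, the largest is that for `paramD * pMax`, namely `B ^
  -- 25`.
  obtain ⟨M, hM⟩ : ∃ M, M = B ^ 26 := ⟨_, rfl⟩
  have hZB : 2 * Z ≤ B := hBdef ▸ Nat.le_self_pow (by omega) _
  have hB : 1 ≤ B := by omega
  have hmono : ∀ {i j}, i ≤ j → B ^ i ≤ B ^ j := fun h => Nat.pow_le_pow_right hB h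
  have hpow : ∀ {i}, i ≤ 26 → B ^ i ≤ M := fun h => hM ▸ hmono h
  have hBM : B ≤ M := by simpa using hpow (i := 1) (by norm_num)
  have hrB : r + 1 ≤ B := hBdef ▸ (Nat.lt_two_pow_self (n := r)).trans_le
    (Nat.pow_le_pow_left (by omega) r)
  have hB2 : ∀ {i}, 2 * B ^ i ≤ B ^ (i + 1) := fun {i} => by
    rw [pow_succ, mul_comm]
    exact Nat.mul_le_mul_left _ (by omega)
  have hnδ : 2 * δ * n ≤ (2 * Z) ^ 2 := by
    calc 2 * δ * n ≤ (2 * Z) * (2 * Z) :=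
          Nat.mul_le_mul (Nat.mul_le_mul_left 2 hδ) (by omega)
      _ = (2 * Z) ^ 2 := (sq _).symm
  have hnr : 2 * n * r ≤ (2 * Z) ^ 2 := by
    calc 2 * n * r ≤ (2 * Z) * (2 * Z) :=
          Nat.mul_le_mul (Nat.mul_le_mul_left 2 hn) (by omega)
      _ = (2 * Z) ^ 2 := (sq _).symm
  have hnrℓ : 2 * n * r * ℓ ≤ (2 * Z) ^ 3 := by
    rw [pow_succ]
    exact Nat.mul_le_mul hnr (by omega)
  have hD : ∀ j ≤ r + 1, (2 * δ * n) ^ j ≤ B ^ 4 := fun j hj =>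
    hBdef ▸ pow_le_pow_pow hZ hnδ (by omega)
  have hP : ∀ j ≤ 2 * (r + 1), (2 * n * r * ℓ) ^ j ≤ B ^ 12 := fun j hj =>
    hBdef ▸ pow_le_pow_pow hZ hnrℓ (by omega)
  have hE : ∀ j ≤ r + 1, (d + 1) ^ j ≤ B ^ 2 := fun j hj =>
    hBdef ▸ pow_le_pow_pow hZ (a := 1) (by rw [pow_one]; omega) (by omega)
  have hnr2 : (n + 1) ^ (r + 2) ≤ B ^ 3 :=
    hBdef ▸ pow_le_pow_pow hZ (a := 1) (by rw [pow_one]; omega) (by omega)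
  have hDle : paramD n r δ ≤ B ^ 4 := hD _ le_rfl
  have hC : Nat.clog 2 (paramD n r δ) ^ 2 ≤ B ^ 8 := by
    calc _ ≤ (B ^ 4) ^ 2 := Nat.pow_le_pow_left
          ((Nat.clog_le_of_le_pow Nat.lt_two_pow_self.le).trans hDle) 2
      _ = B ^ 8 := by ring
  have hPM : pMax n r δ ℓ ≤ B ^ 21 := by
    have h1 : 1 ≤ B ^ 20 := Nat.one_le_pow _ _ hB
    calc pMax n r δ ℓ ≤ B ^ 12 * B ^ 8 + B ^ 20 :=
          Nat.add_le_add (Nat.mul_le_mul (hP _ le_rfl) hC) h1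
      _ = 2 * B ^ 20 := by ring
      _ ≤ B ^ 21 := hB2
  have hδr : δ * r ≤ B ^ 2 := by
    rw [sq]
    exact Nat.mul_le_mul (by omega) (by omega)
  have hH : δ * r * pMax n r δ ℓ ≤ B ^ 23 := by
    calc _ ≤ B ^ 2 * B ^ 21 := Nat.mul_le_mul hδr hPM
      _ = B ^ 23 := by ring
  have hDPM : paramD n r δ * pMax n r δ ℓ ≤ B ^ 25 := by
    calc _ ≤ B ^ 4 * B ^ 21 := Nat.mul_le_mul hDle hPM
      _ = B ^ 25 := by ring
  have hsq : (2 * Z) ^ 2 ≤ B ^ 2 := Nat.pow_le_pow_left hZB 2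
  have hcube : (2 * Z) ^ 3 ≤ B ^ 3 := Nat.pow_le_pow_left hZB 3
  have h2r : 2 * (r + 1) ≤ B ^ 2 := by
    rw [sq]
    exact Nat.mul_le_mul (by omega) hrB
  have hrun : RunsWithin O q (1 + 3 * M + n + q)
      (.seq (.seq setupProg (enumProg body)) (.natOp .sub 0 6 29))
      ((13 * M + 27) + ((pMax n r δ ℓ) * ((δ * r * pMax n r δ ℓ) * (((d + 1) ^ (r + 1)) *
        (n * ((r + 1) * (3 * M + 11) + 3 * M + 17) + kb + 8) + 5) + 4) + 2) + 1)
      (fun s => ∃ φ, J (hittingSet n r δ ℓ H₁ H₂) φ s.out ∧ s.reg 0 = 1 - φ)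
      (initState n d r δ ℓ h₁ h₂) := by
    rw [initState_eq_mkState]
    refine .seq (.seq (setupProg_spec le_rfl hδ1 (by omega) (by omega) (h2r.trans (hpow (by norm_num)))
      (by omega) (by omega) (hnδ.trans (hsq.trans (hpow (by norm_num))))
      (hnr.trans (hsq.trans (hpow (by norm_num)))) (hnrℓ.trans (hcube.trans (hpow (by norm_num))))
      (fun j hj => (hD j hj).trans (hpow (by norm_num)))
      ((Nat.mul_le_mul_left 2 hDle).trans (hB2.trans (hpow (by norm_num))))
      (fun j hj => (hP j hj).trans (hpow (by norm_num))) (hC.trans (hpow (by norm_num)))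
      (hPM.trans (hpow (by norm_num))) (hδr.trans (hpow (by norm_num)))
      (hH.trans (hpow (by norm_num))) (fun j hj => (hE j hj).trans (hpow (by norm_num)))
      fun x ci y e i x₁ hb => ?_))
    refine enumProg_spec le_rfl (hbody _ _ _ _ le_rfl (by omega)) (hDPM.trans (hpow (by norm_num)))
      ((Nat.mul_le_mul_left 2 hPM).trans (hB2.trans (hpow (by norm_num))))
      (hnr2.trans (hpow (by norm_num))) hb hJ ?_
    intro l A₂ A₃ o hl h6 hJ
    rw [enumPoints_eq_hittingSet hH₁ hH₂ hh₁ hh₂] at hJ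
    refine runsWithin_natOp le_rfl hl (by norm_num) rfl ⟨_, hJ, ?_⟩
    refine (getD_set_self hl.1 (by norm_num)).trans ?_
    rw [h6]
    rfl
  obtain ⟨s, t, hs, ht, hR⟩ := hrun
  refine ⟨s, t, hs, ht.trans ?_, hR⟩
  refine (time_le hB hM (by omega) (by omega) hrB hkb (hE _ le_rfl) hH hPM).trans ?_
  -- The constant `582` may be raised to the power `r` because `r` is positive.
  rw [mul_pow, ← pow_mul, mul_comm 100 r, pow_mul, ← hBdef]
  exact Nat.mul_le_mul_right _ (Nat.le_self_pow (by omega) _)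

theorem Dag.le_nodes {K : Type u} {n k : ℕ} (G : Dag K n k) : n ≤ k := by
  induction G with
  | inputs => exact le_rfl
  | const _ _ ih => omega
  | add _ _ _ ih => omega
  | mul _ _ _ ih => omega

/-- The polynomial `a (2 X) ^ k`, as a bound on running times. -/
noncomputable def timePoly (a k : ℕ) : Polynomial ℕ :=
  Polynomial.C a * (Polynomial.C 2 * Polynomial.X) ^ k

theorem eval_timePoly (a k Z : ℕ) : (timePoly a k).eval Z = a * (2 * Z) ^ k := by
  rw [timePoly, Polynomial.eval_mul, Polynomial.eval_pow, Polynomial.eval_mul, Polynomial.eval_C,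
    Polynomial.eval_C, Polynomial.eval_X]

end Algorithm

end PIT

theorem theorem1 :
    -- the explicit set is a hitting set
    (∀ (K : Type u) [Field K] (n d r δ ℓ : ℕ), 1 ≤ n → 1 ≤ d → 1 ≤ r → 1 ≤ δ → 1 ≤ ℓ →
      (ringChar K = 0 ∨ δ ^ r < ringChar K) →
      ∀ H₁ H₂ : Finset (AlgebraicClosure K), H₁.card = δ * r * pMax n r δ ℓ → H₂.card = d + 1 →
        IsHittingSet (hittingSet n r δ ℓ H₁ H₂) (sparseInputCircuits K n d r δ ℓ)) ∧
    -- it can be constructed in time `poly(d r δ ℓ n) ^ r`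
    (∃ (A : Prog) (P : Polynomial ℕ),
      ∀ (K : Type u) [Field K] (n d r δ ℓ : ℕ), 1 ≤ n → 1 ≤ d → 1 ≤ r → 1 ≤ δ → 1 ≤ ℓ →
      ∀ H₁ H₂ : Finset (AlgebraicClosure K), H₁.card = δ * r * pMax n r δ ℓ → H₂.card = d + 1 →
      ∀ h₁ h₂ : List (AlgebraicClosure K), Enumerates h₁ H₁ → Enumerates h₂ H₂ →
        ∃ (s : State (AlgebraicClosure K) n) (t : ℕ),
          Exec (fun _ => 0) 0 A (initState n d r δ ℓ h₁ h₂) s t ∧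
          t ≤ P.eval (d * r * δ * ℓ * n) ^ r ∧
          {v | v ∈ s.out} = hittingSet n r δ ℓ H₁ H₂) ∧
    -- blackbox zero test in time `poly(size · d ℓ δ) ^ r`, each query costing the circuit size
    (∃ (B : Prog) (P : Polynomial ℕ),
      ∀ (K : Type u) [Field K] (n d r δ ℓ : ℕ), 1 ≤ n → 1 ≤ d → 1 ≤ r → r ≤ n → 1 ≤ δ → 1 ≤ ℓ →
      (ringChar K = 0 ∨ δ ^ r < ringChar K) →
      ∀ H₁ H₂ : Finset (AlgebraicClosure K), H₁.card = δ * r * pMax n r δ ℓ → H₂.card = d + 1 →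
      ∀ h₁ h₂ : List (AlgebraicClosure K), Enumerates h₁ H₁ → Enumerates h₂ H₂ →
      ∀ C' ∈ sparseInputCircuits K n d r δ ℓ,
        ∃ (s : State (AlgebraicClosure K) n) (t : ℕ),
          Exec (fun a => MvPolynomial.aeval a C'.poly) C'.size B
            (initState n d r δ ℓ h₁ h₂) s t ∧
          t ≤ P.eval (C'.size * (d * ℓ * δ)) ^ r ∧
          (s.reg 0 = 1 ↔ C'.poly = 0)) := by

  refine ⟨fun K _ n d r δ ℓ hn _ hr hδ hℓ hchar H₁ H₂ hH₁ hH₂ =>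
      isHittingSet_hittingSet hn hr hδ hℓ hchar H₁ H₂ hH₁ hH₂,
    -- The last instruction turns the flag into the answer `1 - φ` in register `0`; in the
    -- enumeration it is harmless.
    ⟨.seq (.seq setupProg (enumProg (.emit 2))) (.natOp .sub 0 6 29), timePoly 582 100, ?_⟩,
    ⟨.seq (.seq setupProg (enumProg testProg)) (.natOp .sub 0 6 29), timePoly 582 100, ?_⟩⟩
  · intro K _ n d r δ ℓ hn hd hr hδ hℓ H₁ H₂ hH₁ hH₂ h₁ h₂ hh₁ hh₂
    have hpos : 0 < d * r * δ * ℓ * n := by positivity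
    obtain ⟨s, t, hs, ht, φ, hJ, -⟩ := exists_exec_of_processes (O := fun _ => 0) (q := 0)
      hn hr hδ (Nat.le_of_dvd hpos (Dvd.intro_left _ rfl))
      (Nat.le_of_dvd hpos ⟨r * δ * ℓ * n, by ring⟩) (Nat.le_of_dvd hpos ⟨d * δ * ℓ * n, by ring⟩)
      (Nat.le_of_dvd hpos ⟨d * r * ℓ * n, by ring⟩) (Nat.le_of_dvd hpos ⟨d * r * δ * n, by ring⟩)
      (Nat.zero_le _) hH₁ hH₂ hh₁ hh₂ (by norm_num) (fun U M A₀ A₁ hU _ => processes_emit hU)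
      (by simp)
    exact ⟨s, t, hs, by rwa [eval_timePoly], hJ⟩
  · intro K _ n d r δ ℓ hn hd hr hrn hδ hℓ hchar H₁ H₂ hH₁ hH₂ h₁ h₂ hh₁ hh₂ C' hC'
    -- As input nodes count towards the size, `r ≤ n ≤ C'.size`; so `n` and `r` need not appear in
    -- the time bound.
    have hnC : n ≤ C'.size := C'.dag.le_nodes
    have hpos : 0 < d * ℓ * δ := by positivity
    have hsize : C'.size ≤ C'.size * (d * ℓ * δ) := Nat.le_mul_of_pos_right _ hpos
    have hle : d * ℓ * δ ≤ C'.size * (d * ℓ * δ) := Nat.le_mul_of_pos_left _ (by omega)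
    obtain ⟨s, t, hs, ht, φ, hJ, hreg⟩ := exists_exec_of_processes
      (O := fun a => MvPolynomial.aeval a C'.poly) (q := C'.size) hn hr hδ (hnC.trans hsize)
      ((Nat.le_of_dvd hpos ⟨ℓ * δ, by ring⟩).trans hle) ((hrn.trans hnC).trans hsize)
      ((Nat.le_of_dvd hpos ⟨d * ℓ, by ring⟩).trans hle)
      ((Nat.le_of_dvd hpos ⟨d * δ, by ring⟩).trans hle) hsize hH₁ hH₂ hh₁ hh₂ le_rfl
      (fun U M A₀ A₁ hU hM => processes_testProg hU hM) (.inl ⟨rfl, by simp⟩)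
    refine ⟨s, t, hs, by rwa [eval_timePoly], ?_⟩
    rw [hreg]
    -- An unset flag means vanishing on the whole hitting set, hence `C'.poly = 0`; a set flag comes
    -- with a point of nonvanishing.
    rcases hJ with ⟨rfl, h⟩ | ⟨rfl, v, -, hv⟩
    · refine ⟨fun _ => ?_, fun _ => rfl⟩
      by_contra hne
      obtain ⟨a, ha, hva⟩ :=
        isHittingSet_hittingSet hn hr hδ hℓ hchar H₁ H₂ hH₁ hH₂ C' hC' hne
      exact hva (h a ha)
    · refine ⟨fun h => by norm_num at h, fun h => ?_⟩
      rw [h, map_zero] at hv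
      exact absurd rfl hv
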